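/- Let $\nu>0$ and $h\in[0,1)$, put $\theta_h=\arcsin h$, and let $(-d^2/dx^2)^{1/2}$ be the operator with Fourier symbol $|k|$, regarded as a map from $H^1(\mathbb R)$, modulo additive constants, to $L^2(\mathbb R)$. For $\theta:\mathbb R\to\mathbb R$ let $$E(\theta)=\frac12\int_{\mathbb R}\Big\{(\theta')^2+(\sin\theta-h)^2+\frac{\nu}{2}(\sin\theta-h)\Big(-\frac{d^2}{dx^2}\Big)^{1/2}(\sin\theta-h)\Big\}\,dx .$$ Then, up to translations, there exists exactly one non-increasing smooth function $\theta:\mathbb R\to\mathbb R$ with finite energy, $E(\theta)<\infty$, which solves $$-\theta''+(\sin\theta-h)\cos\theta+\frac{\nu}{2}\cos\theta\,\Big(-\frac{d^2}{dx^2}\Big)^{1/2}\sin\theta=0\quad\text{on }\mathbb R$$ and satisfies $\lim_{x\to+\infty}\theta(x)=\theta_h$ and $\lim_{x\to-\infty}\theta(x)=\pi-\theta_h$. Moreover, every such $\theta$ minimizes $E$ over the class $\mathcal A=\{\theta\in H^1_{\mathrm{loc}}(\mathbb R):\theta-\eta_h\in H^1(\mathbb R)\}$, where $\eta_h$ is a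 fixed smooth non-increasing function with values in $[0,\pi]$, equal to $\theta_h$ for $x>1$ and to $\pi-\theta_h$ for $x<-1$ (the class does not depend on the choice of $\eta_h$). -/

import Mathlib

open MeasureTheory Filter Topology
open scoped ContDiff FourierTransform

namespace NeelWall

noncomputable section

/-- `g` is a weak (distributional) derivative of `f` on the real line: both are locally integrable
and `∫ f φ' = - ∫ g φ` for every smooth compactly supported `φ`. -/
def IsWeakDeriv (f g : ℝ → ℝ) : Prop :=
  LocallyIntegrable f ∧ LocallyIntegrable g ∧
    ∀ φ : ℝ → ℝ, ContDiff ℝ ∞ φ → HasCompactSupport φ →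
      ∫ x, f x * deriv φ x = -∫ x, g x * φ x

/-- Weak derivatives are unique almost everywhere. -/
theorem IsWeakDeriv.ae_unique {f g₁ g₂ : ℝ → ℝ} (h₁ : IsWeakDeriv f g₁) (h₂ : IsWeakDeriv f g₂) :
    g₁ =ᵐ[volume] g₂ := by
  have key : ∀ᵐ x ∂(volume : Measure ℝ), (g₁ - g₂) x = 0 := by
    refine ae_eq_zero_of_integral_contDiff_smul_eq_zero (h₁.2.1.sub h₂.2.1) ?_
    intro φ hφ hc
    have e₁ := h₁.2.2 φ hφ hc
    have e₂ := h₂.2.2 φ hφ hc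
    have i₁ : Integrable (fun x => φ x • g₁ x) :=
      h₁.2.1.integrable_smul_left_of_hasCompactSupport hφ.continuous hc
    have i₂ : Integrable (fun x => φ x • g₂ x) :=
      h₂.2.1.integrable_smul_left_of_hasCompactSupport hφ.continuous hc
    have : (fun x => φ x • (g₁ - g₂) x) = fun x => φ x • g₁ x - φ x • g₂ x := by
      funext x; simp [mul_sub]
    rw [this, integral_sub i₁ i₂]
    simp only [smul_eq_mul, mul_comm (φ _)]
    linarith
  filter_upwards [key] with x hx
  simpa [sub_eq_zero] using hx

open Classical in
/-- The weak derivative of `f`, determined up to null sets (and `0` by convention if `f` has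
none). -/
def weakDeriv (f : ℝ → ℝ) : ℝ → ℝ :=
  if H : ∃ g, IsWeakDeriv f g then H.choose else 0

theorem IsWeakDeriv.weakDeriv_ae_eq {f g : ℝ → ℝ} (h : IsWeakDeriv f g) :
    weakDeriv f =ᵐ[volume] g := by
  have H : ∃ g, IsWeakDeriv f g := ⟨g, h⟩
  rw [weakDeriv, dif_pos H]
  exact H.choose_spec.ae_unique h

/-- The Sobolev space `H¹(ℝ)`. -/
def MemH1 (f : ℝ → ℝ) : Prop :=
  MemLp f 2 ∧ ∃ g, IsWeakDeriv f g ∧ MemLp g 2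

/-- `v = (-d²/dx²)^{1/2} f`, where `(-d²/dx²)^{1/2}` is the operator with Fourier symbol `|k|`,
acting on square integrable functions modulo additive constants: for some constant `c`, both
`f - c` and `v` are square integrable, and the `L²` Fourier transform of `v` is that of `f - c`
multiplied by `|k|`. Here the Fourier transform is normalized as `∫ exp(-2πixξ) u(x) dx`, so that
the wave number is `k = 2πξ`. -/
def IsHalfLaplacian (f v : ℝ → ℝ) : Prop :=
  ∃ (c : ℝ) (hf : MemLp (fun x => ((f x - c : ℝ) : ℂ)) 2 (volume : Measure ℝ))
    (hv : MemLp (fun x => (v x : ℂ)) 2 (volume : Measure ℝ)),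
    ∀ᵐ ξ : ℝ, (𝓕 (hv.toLp _) : Lp ℂ 2 (volume : Measure ℝ)) ξ =
      ((|2 * Real.pi * ξ| : ℝ) : ℂ) * (𝓕 (hf.toLp _) : Lp ℂ 2 (volume : Measure ℝ)) ξ

/-- The operator `(-d²/dx²)^{1/2}` is single-valued almost everywhere. -/
theorem IsHalfLaplacian.ae_unique {f v w : ℝ → ℝ} (h₁ : IsHalfLaplacian f v)
    (h₂ : IsHalfLaplacian f w) : v =ᵐ[volume] w := by
  obtain ⟨c, hf, hv, e₁⟩ := h₁
  obtain ⟨d, hf', hw, e₂⟩ := h₂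
  have hcd : c = d := by
    have h := hf.sub hf'
    have h' : MemLp (fun _ : ℝ => ((d - c : ℝ) : ℂ)) 2 (volume : Measure ℝ) := by
      convert h using 1
      funext x
      simp
    rw [memLp_const_iff (by norm_num) (by norm_num)] at h'
    rcases h' with h' | h'
    · have h'' : d - c = 0 := by exact_mod_cast h'
      linarith
    · simp at h'
  subst hcd
  have e : (𝓕 (hv.toLp _) : Lp ℂ 2 (volume : Measure ℝ)) = 𝓕 (hw.toLp _) := by
    apply Lp.ext
    filter_upwards [e₁, e₂] with ξ a b
    rw [a, b]
  have e' := (Lp.fourierTransformₗᵢ ℝ ℂ).injective e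
  rw [MemLp.toLp_eq_toLp_iff] at e'
  filter_upwards [e'] with x hx
  exact_mod_cast hx

open Classical in
/-- The operator `(-d²/dx²)^{1/2}`; its value is determined up to null sets (and is `0` by
convention outside its domain). -/
def halfLaplacian (f : ℝ → ℝ) : ℝ → ℝ :=
  if H : ∃ v, IsHalfLaplacian f v then H.choose else 0

theorem IsHalfLaplacian.halfLaplacian_ae_eq {f v : ℝ → ℝ} (h : IsHalfLaplacian f v) :
    halfLaplacian f =ᵐ[volume] v := by
  have H : ∃ v, IsHalfLaplacian f v := ⟨v, h⟩
  rw [halfLaplacian, dif_pos H]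
  exact H.choose_spec.ae_unique h

/-- The one-dimensional thin film energy
`E(θ) = ½ ∫ { (θ')² + (sin θ - h)² + (ν/2) (sin θ - h) (-d²/dx²)^{1/2} (sin θ - h) } dx`. -/
def energy (ν h : ℝ) (θ : ℝ → ℝ) : ℝ :=
  (1 / 2) * ∫ x, ((weakDeriv θ x) ^ 2 + (Real.sin (θ x) - h) ^ 2 +
    ν / 2 * ((Real.sin (θ x) - h) * halfLaplacian (fun y => Real.sin (θ y) - h) x))

/-- `θ` has finite energy: `θ'` and `sin θ - h` are square integrable and `(-d²/dx²)^{1/2}` is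
defined on `sin θ - h`, with values in `L²`, so that each of the three terms of the energy density
is integrable. -/
def HasFiniteEnergy (h : ℝ) (θ : ℝ → ℝ) : Prop :=
  (∃ g, IsWeakDeriv θ g ∧ MemLp g 2) ∧
    MemLp (fun x => Real.sin (θ x) - h) 2 ∧
    ∃ v, IsHalfLaplacian (fun x => Real.sin (θ x) - h) v

/-- A fixed smooth nonincreasing function `η_h` equal to `π - arcsin h` on `(-∞, -1]` and to
`arcsin h` on `[1, ∞)`. -/
def etaRef (h x : ℝ) : ℝ :=
  (Real.pi - Real.arcsin h) -
    (Real.pi - 2 * Real.arcsin h) * Real.smoothTransition ((x + 1) / 2)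

/-- The admissible class `{θ : θ - η_h ∈ H¹(ℝ)}`. -/
def Admissible (h : ℝ) (θ : ℝ → ℝ) : Prop :=
  MemH1 (fun x => θ x - etaRef h x)

/-- `θ` minimizes the energy over the admissible class. -/
def IsEnergyMinimizer (ν h : ℝ) (θ : ℝ → ℝ) : Prop :=
  Admissible h θ ∧ ∀ φ : ℝ → ℝ, Admissible h φ → energy ν h θ ≤ energy ν h φ

/-- The Euler–Lagrange equation
`-θ'' + (sin θ - h) cos θ + (ν/2) cos θ (-d²/dx²)^{1/2} sin θ = 0`, for a twice differentiable
`θ`. As `(-d²/dx²)^{1/2}` takes values in `L²`, this is an equality almost everywhere. -/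
def SolvesEulerLagrange (ν h : ℝ) (θ : ℝ → ℝ) : Prop :=
  ∀ᵐ x : ℝ, -deriv (deriv θ) x + (Real.sin (θ x) - h) * Real.cos (θ x) +
    ν / 2 * Real.cos (θ x) * halfLaplacian (fun y => Real.sin (θ y)) x = 0

/-- A monotone Néel wall profile: a smooth nonincreasing solution of the Euler–Lagrange equation
with finite energy, which tends to `arcsin h` at `+∞` and to `π - arcsin h` at `-∞`. -/
structure IsMonotoneProfile (ν h : ℝ) (θ : ℝ → ℝ) : Prop where
  smooth : ContDiff ℝ ∞ θ
  antitone : Antitone θ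
  solves : SolvesEulerLagrange ν h θ
  tendsto_top : Tendsto θ atTop (𝓝 (Real.arcsin h))
  tendsto_bot : Tendsto θ atBot (𝓝 (Real.pi - Real.arcsin h))
  finite_energy : HasFiniteEnergy h θ

end

end NeelWall

/-! ### Primitives of locally integrable functions and weak derivatives. -/

namespace NeelWall

/-! The source of everything is a hidden convexity. For an angle in [-π/2, π/2] with sine u, the
Dirichlet density equals u'² / (1 - u²), which is jointly convex in (u, u'); the other two terms are
nonnegative quadratic forms in u - h, and the middle one is strictly convex.

Existence. A wall crosses π/2; translate the crossing to 0 and replace θ by arcsin (sin θ). This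
folding keeps the sine and is 1-Lipschitz, so the energy does not increase
(`IsWall.foldedEnergy_fold_le`). Among folded profiles, which take the value π/2 at 0, the energy is
convex along means of sines (`foldedEnergy_midAngle_le`). Hence the sines of a minimizing sequence
are Cauchy in L², Hölder bounds turn this into pointwise convergence, and Fatou's lemma gives a
minimizer (`exists_minimizer`), unique by the strict convexity (`minimizer_unique`). Reflection and
two-point symmetrization about points a > 0 do not raise the energy, so by uniqueness the minimizer
is even and nonincreasing on the positive half-line. Replacing ψ by π - ψ on the left unfolds it
into a monotone wall of the same energy, which therefore minimizes over the whole admissible class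
(`exists_minimizing_wall`).

Both derivative terms are treated as forms ∬ K(x - y) (f x - f y)² with K nonincreasing in |z|: the
half-Laplacian term has K = z⁻² up to a constant, and the Dirichlet integral is reached through
normalized box kernels shrinking to 0. Convexity, symmetrization and lower semicontinuity are thus
proved once, for general kernels and without derivatives. The Fourier transform links these forms to
weak derivatives and to the operator.

A minimizer satisfies the weak Euler–Lagrange equation by one-sided quadratic bounds along smooth
variations, and a bootstrap in the spaces H^k makes it smooth.

Uniqueness (`IsCentered.unique`). For two profiles θ, φ with value π/2 at 0, put w = sin φ - sin θ
and B = w (φ' / cos φ - θ' / cos θ). The slopes are the momenta conjugate to u in the convex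
density, and the equation gives B' = w² + (ν/2) w (-d²/dx²)^{1/2} w + N with N ≥ 0. Since B is
continuous and vanishes at ±∞, integration forces w = 0. Minimality of every profile follows, since
each is a translate of the minimizing one. -/

/-- `f` is locally absolutely continuous with almost everywhere derivative `g`. -/
def IsPrimitive (f g : ℝ → ℝ) : Prop :=
  LocallyIntegrable g ∧ ∀ a b, f b - f a = ∫ x in a..b, g x

theorem intervalIntegrable_of_locallyIntegrable {g : ℝ → ℝ}
    (hg : LocallyIntegrable g) (a b : ℝ) : IntervalIntegrable g volume a b :=
  intervalIntegrable_iff.mpr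
    ((hg.integrableOn_isCompact isCompact_uIcc).mono_set Set.uIoc_subset_uIcc)

theorem locallyIntegrable_continuous_mul {f g : ℝ → ℝ}
    (hg : LocallyIntegrable g) (hf : Continuous f) : LocallyIntegrable (fun x => f x * g x) := by
  have := (locallyIntegrableOn_univ.mpr hg).continuousOn_smul isOpen_univ.isLocallyClosed
    hf.continuousOn
  rw [locallyIntegrableOn_univ] at this
  simpa using this

namespace IsPrimitive

variable {f g f₁ g₁ f₂ g₂ : ℝ → ℝ}

theorem eq_add (h : IsPrimitive f g) (a : ℝ) : f = fun x => f a + ∫ t in a..x, g t := by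
  funext x; linarith [h.2 a x]

theorem absolutelyContinuous (h : IsPrimitive f g) (a b : ℝ) :
    AbsolutelyContinuousOnInterval f a b := by
  have h1 := (intervalIntegrable_of_locallyIntegrable h.1 a b).absolutelyContinuousOnInterval_intervalIntegral
    (c := a) (by simp)
  have h2 : AbsolutelyContinuousOnInterval (fun _ : ℝ => f a) a b := by
    refine LipschitzOnWith.absolutelyContinuousOnInterval (K := 0) ?_
    exact (LipschitzWith.const (f a)).lipschitzOnWith
  rw [h.eq_add a]
  simpa using h2.fun_add h1

theorem continuous (h : IsPrimitive f g) : Continuous f := by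
  rw [h.eq_add 0]
  exact continuous_const.add
    (intervalIntegral.continuous_primitive (fun a b => intervalIntegrable_of_locallyIntegrable h.1 a b) 0)

theorem ae_hasDerivAt (h : IsPrimitive f g) : ∀ᵐ x, HasDerivAt f (g x) x := by
  filter_upwards [LocallyIntegrable.ae_hasDerivAt_integral h.1] with x hx
  rw [h.eq_add 0]
  exact (hx 0).const_add _

/-- The fundamental theorem of calculus for absolutely continuous functions. Products and Lipschitz
compositions then only require differentiation at almost every point, with no mollification. -/
theorem of_absolutelyContinuous (hac : ∀ a b, AbsolutelyContinuousOnInterval f a b)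
    (hg : LocallyIntegrable g) (hd : ∀ᵐ x, HasDerivAt f (g x) x) : IsPrimitive f g := by
  refine ⟨hg, fun a b => ?_⟩
  rw [← (hac a b).integral_deriv_eq_sub]
  refine intervalIntegral.integral_congr_ae ?_
  filter_upwards [hd] with x hx _
  exact hx.deriv

theorem of_hasDerivAt (hd : ∀ x, HasDerivAt f (g x) x) (hg : Continuous g) : IsPrimitive f g :=
  ⟨hg.locallyIntegrable, fun a b => (intervalIntegral.integral_eq_sub_of_hasDerivAt
    (fun x _ => hd x) (hg.intervalIntegrable a b)).symm⟩

theorem congr_deriv (h : IsPrimitive f g₁) (he : g₁ =ᵐ[volume] g₂) : IsPrimitive f g₂ := by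
  refine ⟨(locallyIntegrable_congr he).mp h.1, fun a b => ?_⟩
  rw [h.2 a b]
  refine intervalIntegral.integral_congr_ae ?_
  filter_upwards [he] with x hx _ using hx

theorem add (h₁ : IsPrimitive f₁ g₁) (h₂ : IsPrimitive f₂ g₂) :
    IsPrimitive (fun x => f₁ x + f₂ x) (fun x => g₁ x + g₂ x) := by
  refine ⟨h₁.1.add h₂.1, fun a b => ?_⟩
  rw [intervalIntegral.integral_add (intervalIntegrable_of_locallyIntegrable h₁.1 a b) (intervalIntegrable_of_locallyIntegrable h₂.1 a b),
    ← h₁.2, ← h₂.2]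
  ring

theorem sub (h₁ : IsPrimitive f₁ g₁) (h₂ : IsPrimitive f₂ g₂) :
    IsPrimitive (fun x => f₁ x - f₂ x) (fun x => g₁ x - g₂ x) := by
  refine ⟨h₁.1.sub h₂.1, fun a b => ?_⟩
  rw [intervalIntegral.integral_sub (intervalIntegrable_of_locallyIntegrable h₁.1 a b) (intervalIntegrable_of_locallyIntegrable h₂.1 a b),
    ← h₁.2, ← h₂.2]
  ring

theorem const_mul (c : ℝ) (h : IsPrimitive f g) :
    IsPrimitive (fun x => c * f x) (fun x => c * g x) := by
  refine ⟨h.1.smul c, fun a b => ?_⟩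
  rw [intervalIntegral.integral_const_mul, ← h.2]
  ring

theorem sub_const (h : IsPrimitive f g) (c : ℝ) : IsPrimitive (fun x => f x - c) g :=
  ⟨h.1, fun a b => by rw [← h.2]; ring⟩

theorem comp_add (h : IsPrimitive f g) (a : ℝ) :
    IsPrimitive (fun x => f (x + a)) (fun x => g (x + a)) := by
  refine ⟨?_, fun x y => ?_⟩
  · intro x
    have h1 := (h.1 (x + a))
    obtain ⟨s, hs, hi⟩ := h1
    refine ⟨(fun y => y + a) ⁻¹' s, (continuous_add_const a).continuousAt.preimage_mem_nhds hs, ?_⟩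
    exact ((measurePreserving_add_right volume a).integrableOn_comp_preimage
      (measurableEmbedding_addRight a)).mpr hi
  · rw [intervalIntegral.integral_comp_add_right, ← h.2]

theorem mul (h₁ : IsPrimitive f₁ g₁) (h₂ : IsPrimitive f₂ g₂) :
    IsPrimitive (fun x => f₁ x * f₂ x) (fun x => g₁ x * f₂ x + f₁ x * g₂ x) := by
  refine of_absolutelyContinuous
    (fun a b => (h₁.absolutelyContinuous a b).fun_mul (h₂.absolutelyContinuous a b)) ?_ ?_
  · refine LocallyIntegrable.add ?_ (locallyIntegrable_continuous_mul h₂.1 h₁.continuous)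
    simpa only [mul_comm] using locallyIntegrable_continuous_mul h₁.1 h₂.continuous
  · filter_upwards [h₁.ae_hasDerivAt, h₂.ae_hasDerivAt] with x a b
    exact a.mul b

end IsPrimitive

theorem _root_.LipschitzWith.comp_absolutelyContinuousOnInterval {F f : ℝ → ℝ} {K : NNReal}
    (hF : LipschitzWith K F) {a b : ℝ} (h : AbsolutelyContinuousOnInterval f a b) :
    AbsolutelyContinuousOnInterval (fun x => F (f x)) a b := by
  have h0 := Tendsto.const_mul (K : ℝ) h
  rw [mul_zero] at h0
  refine squeeze_zero (fun t => ?_) (fun t => ?_) h0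
  · exact Finset.sum_nonneg (fun i _ => dist_nonneg)
  · rw [Finset.mul_sum]
    exact Finset.sum_le_sum fun i _ => hF.dist_le_mul _ _

theorem IsPrimitive.comp_lipschitz {F F' f g : ℝ → ℝ} {K : NNReal} (hF : LipschitzWith K F)
    (hF' : ∀ y, HasDerivAt F (F' y) y) (hc : Continuous F') (h : IsPrimitive f g) :
    IsPrimitive (fun x => F (f x)) (fun x => F' (f x) * g x) := by
  refine .of_absolutelyContinuous
    (fun a b => hF.comp_absolutelyContinuousOnInterval (h.absolutelyContinuous a b))
    (locallyIntegrable_continuous_mul h.1 (hc.comp h.continuous)) ?_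
  filter_upwards [h.ae_hasDerivAt] with x hx
  exact (hF' (f x)).comp x hx

theorem lipschitzWith_sin : LipschitzWith 1 Real.sin :=
  lipschitzWith_of_nnnorm_deriv_le Real.differentiable_sin fun x => by
    rw [Real.deriv_sin, ← NNReal.coe_le_coe]; simpa using Real.abs_cos_le_one x

theorem lipschitzWith_cos : LipschitzWith 1 Real.cos :=
  lipschitzWith_of_nnnorm_deriv_le Real.differentiable_cos fun x => by
    rw [Real.deriv_cos', ← NNReal.coe_le_coe]; simpa using Real.abs_sin_le_one x

theorem IsPrimitive.sin {f g : ℝ → ℝ} (h : IsPrimitive f g) :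
    IsPrimitive (fun x => Real.sin (f x)) (fun x => Real.cos (f x) * g x) :=
  h.comp_lipschitz lipschitzWith_sin Real.hasDerivAt_sin Real.continuous_cos

theorem IsPrimitive.cos {f g : ℝ → ℝ} (h : IsPrimitive f g) :
    IsPrimitive (fun x => Real.cos (f x)) (fun x => -Real.sin (f x) * g x) :=
  h.comp_lipschitz (F' := fun y => -Real.sin y) lipschitzWith_cos Real.hasDerivAt_cos
    (by fun_prop)

theorem exists_forall_abs_ge_eq_zero_of_compactSupport {φ : ℝ → ℝ} (hc : HasCompactSupport φ) :
    ∃ R : ℝ, 0 < R ∧ (∀ x, R ≤ |x| → φ x = 0) := by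
  obtain ⟨R, hR⟩ := hc.isCompact.isBounded.subset_closedBall 0
  refine ⟨max R 0 + 1, by positivity, fun x hx => ?_⟩
  by_contra h
  have := hR (subset_tsupport _ (Function.mem_support.mpr h))
  simp only [Metric.mem_closedBall, dist_zero_right, Real.norm_eq_abs] at this
  linarith [le_max_left R 0]

theorem integral_eq_of_vanish {F : ℝ → ℝ} {R : ℝ} (hR : 0 < R) (h : ∀ x, R ≤ |x| → F x = 0) :
    ∫ x, F x = ∫ x in (-R)..R, F x := by
  rw [intervalIntegral.integral_of_le (by linarith)]
  refine (setIntegral_eq_integral_of_forall_compl_eq_zero fun x hx => h x ?_).symm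
  simp only [Set.mem_Ioc, not_and_or, not_lt, not_le] at hx
  rcases hx with hx | hx
  · rw [abs_of_nonpos (by linarith)]; linarith
  · exact hx.le.trans (le_abs_self x)

theorem IsPrimitive.isWeakDeriv {f g : ℝ → ℝ} (h : IsPrimitive f g) : IsWeakDeriv f g := by
  refine ⟨h.continuous.locallyIntegrable, h.1, fun φ hφ hc => ?_⟩
  obtain ⟨R, hR, hv⟩ := exists_forall_abs_ge_eq_zero_of_compactSupport hc
  obtain ⟨R', hR', hv'⟩ := exists_forall_abs_ge_eq_zero_of_compactSupport hc.deriv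
  have hφ' : IsPrimitive φ (deriv φ) := .of_hasDerivAt
    (fun x => (hφ.differentiable (by simp) x).hasDerivAt) (hφ.continuous_deriv (by simp))
  set S := max R R'
  have hS : 0 < S := lt_max_of_lt_left hR
  have h1 := (h.mul hφ').2 (-S) S
  rw [intervalIntegral.integral_add] at h1
  · rw [integral_eq_of_vanish (R := S) hS, integral_eq_of_vanish (R := S) hS]
    · beta_reduce at h1
      rw [hv S, hv (-S)] at h1
      · linarith
      · rw [abs_neg, abs_of_pos hS]; exact le_max_left _ _
      · rw [abs_of_pos hS]; exact le_max_left _ _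
    · intro x hx; rw [hv x ((le_max_left _ _).trans hx), mul_zero]
    · intro x hx; rw [hv' x ((le_max_right _ _).trans hx), mul_zero]
  · have := locallyIntegrable_continuous_mul h.1 hφ.continuous
    simp only [mul_comm] at this ⊢
    exact intervalIntegrable_of_locallyIntegrable this _ _
  · exact intervalIntegrable_of_locallyIntegrable (locallyIntegrable_continuous_mul
      (hφ.continuous_deriv (by simp)).locallyIntegrable h.continuous) _ _

theorem IsWeakDeriv.sub {f₁ g₁ f₂ g₂ : ℝ → ℝ} (h₁ : IsWeakDeriv f₁ g₁) (h₂ : IsWeakDeriv f₂ g₂) :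
    IsWeakDeriv (fun x => f₁ x - f₂ x) (fun x => g₁ x - g₂ x) := by
  refine ⟨h₁.1.sub h₂.1, h₁.2.1.sub h₂.2.1, fun φ hφ hc => ?_⟩
  have key : ∀ {u ψ : ℝ → ℝ}, LocallyIntegrable u → Continuous ψ → HasCompactSupport ψ →
      Integrable fun x => u x * ψ x := fun hu hψ hcψ => by
    simpa [mul_comm] using hu.integrable_smul_left_of_hasCompactSupport hψ hcψ
  simp only [sub_mul]
  rw [integral_sub (key h₁.1 (hφ.continuous_deriv (by simp)) hc.deriv)
    (key h₂.1 (hφ.continuous_deriv (by simp)) hc.deriv),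
    integral_sub (key h₁.2.1 hφ.continuous hc) (key h₂.2.1 hφ.continuous hc),
    h₁.2.2 φ hφ hc, h₂.2.2 φ hφ hc]
  ring

theorem IsWeakDeriv.congr {f₁ g₁ f₂ g₂ : ℝ → ℝ} (h : IsWeakDeriv f₁ g₁) (hf : f₁ =ᵐ[volume] f₂)
    (hg : g₁ =ᵐ[volume] g₂) : IsWeakDeriv f₂ g₂ := by
  refine ⟨(locallyIntegrable_congr hf).mp h.1, (locallyIntegrable_congr hg).mp h.2.1,
    fun φ hφ hc => ?_⟩
  rw [← integral_congr_ae (f := fun x => f₁ x * deriv φ x), h.2.2 φ hφ hc,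
    integral_congr_ae (f := fun x => g₁ x * φ x)]
  · filter_upwards [hg] with x hx; rw [hx]
  · filter_upwards [hf] with x hx; rw [hx]

/-- A function with vanishing weak derivative is almost everywhere constant. -/
theorem IsWeakDeriv.ae_eq_const {f : ℝ → ℝ} (h : IsWeakDeriv f fun _ => 0) :
    ∃ c, f =ᵐ[volume] fun _ => c := by
  let b : ContDiffBump (0 : ℝ) := ⟨1, 2, by norm_num, by norm_num⟩
  set φ₀ : ℝ → ℝ := b.normed volume with hφ₀
  have hφ₀s : ContDiff ℝ ∞ φ₀ := b.contDiff_normed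
  have hφ₀c : HasCompactSupport φ₀ := b.hasCompactSupport_normed
  have hφ₀i : ∫ x, φ₀ x = 1 := b.integral_normed
  have key : ∀ {u ψ : ℝ → ℝ}, LocallyIntegrable u → Continuous ψ → HasCompactSupport ψ →
      Integrable fun x => ψ x * u x := fun hu hψ hcψ => by
    simpa using hu.integrable_smul_left_of_hasCompactSupport hψ hcψ
  set c := ∫ x, φ₀ x * f x
  refine ⟨c, ae_eq_of_integral_contDiff_smul_eq h.1 (locallyIntegrable_const c) fun φ hφ hc => ?_⟩
  set I := ∫ x, φ x
  have hint : Integrable φ := hφ.continuous.integrable_of_hasCompactSupport hc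
  have hint₀ : Integrable φ₀ := hφ₀s.continuous.integrable_of_hasCompactSupport hφ₀c
  -- Subtracting a multiple of a bump of integral one makes the mean zero, so ρ has the compactly
  -- supported antiderivative χ. Testing with χ shows that the pairing of `f` with `φ` depends only
  -- on the integral of `φ`.
  set ρ : ℝ → ℝ := fun x => φ x - I * φ₀ x
  have hρs : ContDiff ℝ ∞ ρ := hφ.sub (contDiff_const.mul hφ₀s)
  have hρc : HasCompactSupport ρ := hc.sub (hφ₀c.mul_left)
  have hρint : Integrable ρ := hint.sub (hint₀.const_mul I)
  have hρ0 : ∫ x, ρ x = 0 := by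
    rw [integral_sub hint (hint₀.const_mul I), integral_const_mul, hφ₀i]; simp [I]
  obtain ⟨R, hR, hv⟩ := exists_forall_abs_ge_eq_zero_of_compactSupport hρc
  set χ : ℝ → ℝ := fun x => ∫ t in (-R)..x, ρ t
  have hχd : ∀ x, HasDerivAt χ (ρ x) x := fun x =>
    intervalIntegral.integral_hasDerivAt_right (hρs.continuous.intervalIntegrable _ _)
      hρs.continuous.stronglyMeasurable.stronglyMeasurableAtFilter hρs.continuous.continuousAt
  have hχ' : deriv χ = ρ := funext fun x => (hχd x).deriv
  have hχs : ContDiff ℝ ∞ χ := by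
    rw [contDiff_infty_iff_deriv, hχ']
    exact ⟨fun x => (hχd x).differentiableAt, hρs⟩
  have hχc : HasCompactSupport χ := by
    refine HasCompactSupport.intro (isCompact_Icc (a := -R) (b := R)) fun x hx => ?_
    simp only [Set.mem_Icc, not_and_or, not_le] at hx
    rcases hx with hx | hx
    · refine intervalIntegral.integral_zero_ae (Eventually.of_forall fun t ht => hv t ?_)
      rw [Set.uIoc_of_ge hx.le] at ht
      rw [abs_of_nonpos (by linarith [ht.2])]; linarith [ht.2]
    · have h1 : ∫ t in (-R)..R, ρ t = 0 := by rw [← integral_eq_of_vanish hR hv, hρ0]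
      have h2 : ∫ t in R..x, ρ t = 0 := by
        refine intervalIntegral.integral_zero_ae (Eventually.of_forall fun t ht => hv t ?_)
        rw [Set.uIoc_of_le hx.le] at ht
        exact ht.1.le.trans (le_abs_self t)
      have h3 := intervalIntegral.integral_add_adjacent_intervals
        (hρs.continuous.intervalIntegrable (-R) R (μ := volume))
        (hρs.continuous.intervalIntegrable R x)
      show ∫ t in (-R)..x, ρ t = 0
      rw [← h3, h1, h2, add_zero]
  have h4 := h.2.2 χ hχs hχc
  rw [hχ'] at h4
  have h5 : ∫ x, f x * ρ x = (∫ x, φ x * f x) - I * c := by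
    have : (fun x => f x * ρ x) = fun x => φ x * f x - I * (φ₀ x * f x) := by
      funext x; simp only [ρ]; ring
    rw [this, integral_sub (key h.1 hφ.continuous hc)
      ((key h.1 hφ₀s.continuous hφ₀c).const_mul I), integral_const_mul]
  simp only [smul_eq_mul]
  rw [integral_mul_const]
  simp only [zero_mul, integral_zero, neg_zero] at h4
  linarith

/-- The difference between `f` and an integral of `g` has zero weak derivative, hence is almost
everywhere constant. This supplies the continuous representative. -/
theorem IsWeakDeriv.exists_isPrimitive {f g : ℝ → ℝ} (h : IsWeakDeriv f g) :
    ∃ F, f =ᵐ[volume] F ∧ IsPrimitive F g := by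
  have hP : IsPrimitive (fun x => ∫ t in (0:ℝ)..x, g t) g := ⟨h.2.1, fun a b =>
    intervalIntegral.integral_interval_sub_left (intervalIntegrable_of_locallyIntegrable h.2.1 _ _)
      (intervalIntegrable_of_locallyIntegrable h.2.1 _ _)⟩
  obtain ⟨c, hc⟩ := (h.sub hP.isWeakDeriv |>.congr .rfl
    (g₂ := fun _ => 0) (by simp)).ae_eq_const
  refine ⟨fun x => (∫ t in (0:ℝ)..x, g t) + c, ?_, h.2.1, fun a b => ?_⟩
  · filter_upwards [hc] with x hx; linarith
  · rw [← hP.2]; ring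

theorem IsWeakDeriv.isPrimitive {f g : ℝ → ℝ} (h : IsWeakDeriv f g) (hf : Continuous f) :
    IsPrimitive f g := by
  obtain ⟨F, hF, hP⟩ := h.exists_isPrimitive
  rwa [(hf.ae_eq_iff_eq volume hP.continuous).mp hF]

end NeelWall

/-! ### Decay at infinity and integration by parts on the line. -/

namespace NeelWall

/-- Integrability of `h` gives `H` a limit at infinity, and an integrable function can have no limit
there but zero. -/
theorem IsPrimitive.tendsto_atTop_zero {H h : ℝ → ℝ} (hP : IsPrimitive H h) (hH : Integrable H)
    (hh : Integrable h) : Tendsto H atTop (𝓝 0) := by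
  have h1 : Tendsto H atTop (𝓝 (H 0 + ∫ x in Set.Ioi 0, h x)) := by
    have := intervalIntegral_tendsto_integral_Ioi 0 hh.integrableOn tendsto_id
    rw [hP.eq_add 0]
    simpa using this.const_add (H 0)
  have h2 : H 0 + ∫ x in Set.Ioi 0, h x = 0 := by
    refine IntegrableAtFilter.eq_zero_of_tendsto (hH.integrableAtFilter _) ?_ h1
    intro s hs
    rcases mem_atTop_sets.mp hs with ⟨b, hb⟩
    exact measure_mono_top (s₁ := Set.Ici b) hb Real.volume_Ici
  rwa [h2] at h1

theorem IsPrimitive.comp_neg {H h : ℝ → ℝ} (hP : IsPrimitive H h) :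
    IsPrimitive (fun x => H (-x)) (fun x => -h (-x)) := by
  have hl : LocallyIntegrable fun x => h (-x) := by
    intro x
    obtain ⟨s, hs, hi⟩ := hP.1 (-x)
    refine ⟨Neg.neg ⁻¹' s, continuous_neg.continuousAt.preimage_mem_nhds hs, ?_⟩
    exact ((Measure.measurePreserving_neg (volume : Measure ℝ)).integrableOn_comp_preimage
      (MeasurableEquiv.neg ℝ).measurableEmbedding).mpr hi
  refine ⟨hl.neg, fun a b => ?_⟩
  rw [hP.2, intervalIntegral.integral_neg, intervalIntegral.integral_comp_neg,
    intervalIntegral.integral_symm]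

theorem IsPrimitive.tendsto_atBot_zero {H h : ℝ → ℝ} (hP : IsPrimitive H h) (hH : Integrable H)
    (hh : Integrable h) : Tendsto H atBot (𝓝 0) := by
  have := (hP.comp_neg.tendsto_atTop_zero hH.comp_neg hh.comp_neg.neg).comp tendsto_neg_atBot_atTop
  simpa [Function.comp_def] using this

theorem IsPrimitive.integral_eq_zero {H h : ℝ → ℝ} (hP : IsPrimitive H h) (hH : Integrable H)
    (hh : Integrable h) : ∫ x, h x = 0 := by
  have h1 := intervalIntegral_tendsto_integral hh tendsto_neg_atTop_atBot tendsto_id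
  have h2 : Tendsto (fun R : ℝ => H R - H (-R)) atTop (𝓝 (0 - 0)) :=
    (hP.tendsto_atTop_zero hH hh).sub
      ((hP.tendsto_atBot_zero hH hh).comp tendsto_neg_atTop_atBot)
  simp only [hP.2, sub_zero] at h2
  exact tendsto_nhds_unique h1 h2

theorem IsPrimitive.integral_mul_add_mul {f g F G : ℝ → ℝ} (h : IsPrimitive f g)
    (H : IsPrimitive F G) (hf : MemLp f 2) (hg : MemLp g 2) (hF : MemLp F 2) (hG : MemLp G 2) :
    ∫ x, (g x * F x + f x * G x) = 0 :=
  (h.mul H).integral_eq_zero (hf.integrable_mul hF)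
    ((hg.integrable_mul hF).add (hf.integrable_mul hG))

/-- An `H¹` function is square integrable and tends to zero at infinity. -/
theorem IsPrimitive.tendsto_zero_of_memLp {f g : ℝ → ℝ} (h : IsPrimitive f g) (hf : MemLp f 2)
    (hg : MemLp g 2) : Tendsto f atTop (𝓝 0) ∧ Tendsto f atBot (𝓝 0) := by
  have hi : Integrable fun x => g x * f x + f x * g x :=
    (hg.integrable_mul hf).add (hf.integrable_mul hg)
  have key : ∀ {l : Filter ℝ}, Tendsto (fun x => f x * f x) l (𝓝 0) → Tendsto f l (𝓝 0) := by
    intro l hl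
    have := hl.sqrt
    simp only [Real.sqrt_mul_self_eq_abs, Real.sqrt_zero] at this
    exact (tendsto_zero_iff_abs_tendsto_zero _).mpr this
  exact ⟨key ((h.mul h).tendsto_atTop_zero (hf.integrable_mul hf) hi),
    key ((h.mul h).tendsto_atBot_zero (hf.integrable_mul hf) hi)⟩

/-! ### The L² Fourier transform of real functions. -/

open Classical in
/-- The `L²` Fourier transform of a real function, zero if `f` is not square integrable. -/
noncomputable def ft (f : ℝ → ℝ) : ℝ → ℂ :=
  if h : MemLp (fun x => (f x : ℂ)) 2 (volume : Measure ℝ) then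
    ((𝓕 (h.toLp _) : Lp ℂ 2 (volume : Measure ℝ)) : ℝ → ℂ) else 0

theorem ft_eq {f : ℝ → ℝ} (h : MemLp (fun x => (f x : ℂ)) 2 (volume : Measure ℝ)) :
    ft f = ((𝓕 (h.toLp _) : Lp ℂ 2 (volume : Measure ℝ)) : ℝ → ℂ) := by
  rw [ft, dif_pos h]

theorem memLp_ofReal_iff {f : ℝ → ℝ} :
    MemLp (fun x => (f x : ℂ)) 2 (volume : Measure ℝ) ↔ MemLp f 2 :=
  ⟨fun h => by simpa using h.re, fun h => h.ofReal⟩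

theorem memLp_ft (f : ℝ → ℝ) : MemLp (ft f) 2 (volume : Measure ℝ) := by
  unfold ft
  split_ifs
  · exact Lp.memLp _
  · exact MemLp.zero

theorem ft_congr {f g : ℝ → ℝ} (h : f =ᵐ[volume] g) : ft f = ft g := by
  have h' : (fun x => (f x : ℂ)) =ᵐ[volume] fun x => (g x : ℂ) := by
    filter_upwards [h] with x hx; rw [hx]
  by_cases hf : MemLp (fun x => (f x : ℂ)) 2 (volume : Measure ℝ)
  · have hg := hf.ae_eq h'
    rw [ft_eq hf, ft_eq hg, (MemLp.toLp_eq_toLp_iff hf hg).mpr h']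
  · have hg : ¬ MemLp (fun x => (g x : ℂ)) 2 (volume : Measure ℝ) :=
      fun hg => hf (hg.ae_eq h'.symm)
    rw [ft, ft, dif_neg hf, dif_neg hg]

theorem ft_sub {f g : ℝ → ℝ} (hf : MemLp f 2) (hg : MemLp g 2) :
    ft (fun x => f x - g x) =ᵐ[volume] fun ξ => ft f ξ - ft g ξ := by
  have hf' := memLp_ofReal_iff.mpr hf
  have hg' := memLp_ofReal_iff.mpr hg
  have hs := memLp_ofReal_iff.mpr (hf.sub hg)
  have e : hs.toLp _ = hf'.toLp _ - hg'.toLp _ := by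
    rw [← MemLp.toLp_sub]; congr 1; funext x; simp
  have e' : ft (fun x => f x - g x) = ft (f - g) := rfl
  rw [e', ft_eq hs, ft_eq hf', ft_eq hg', e]
  have : (𝓕 (hf'.toLp _ - hg'.toLp _) : Lp ℂ 2 (volume : Measure ℝ)) =
      𝓕 (hf'.toLp _) - 𝓕 (hg'.toLp _) := (Lp.fourierTransformₗᵢ ℝ ℂ).map_sub _ _
  rw [this]
  exact Lp.coeFn_sub _ _

theorem ft_inner {f g : ℝ → ℝ} (hf : MemLp f 2) (hg : MemLp g 2) :
    ∫ ξ, (ft f ξ * (starRingEnd ℂ) (ft g ξ)).re = ∫ x, f x * g x := by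
  have hf' := memLp_ofReal_iff.mpr hf
  have hg' := memLp_ofReal_iff.mpr hg
  have h := Lp.inner_fourier_eq (hg'.toLp _) (hf'.toLp _)
  rw [L2.inner_def, L2.inner_def] at h
  simp only [RCLike.inner_apply] at h
  have h1 : ∫ x, (hf'.toLp _ : ℝ → ℂ) x * (starRingEnd ℂ) ((hg'.toLp _ : ℝ → ℂ) x) =
      ((∫ x, f x * g x : ℝ) : ℂ) := by
    rw [← integral_complex_ofReal]
    refine integral_congr_ae ?_
    filter_upwards [hf'.coeFn_toLp, hg'.coeFn_toLp] with x a b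
    rw [a, b]; simp
  rw [h1] at h
  rw [ft_eq hf', ft_eq hg']
  have hi : Integrable fun ξ => ((𝓕 (hf'.toLp _) : Lp ℂ 2 (volume : Measure ℝ)) : ℝ → ℂ) ξ *
      (starRingEnd ℂ) (((𝓕 (hg'.toLp _) : Lp ℂ 2 (volume : Measure ℝ)) : ℝ → ℂ) ξ) :=
    (Lp.memLp _).integrable_mul (Lp.memLp _).star
  have h2 := congrArg Complex.re h
  rw [Complex.ofReal_re] at h2
  rw [← h2]
  exact integral_re (𝕜 := ℂ) hi

theorem lintegral_ft_sq {f : ℝ → ℝ} (hf : MemLp f 2) :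
    ∫⁻ ξ, ‖ft f ξ‖ₑ ^ 2 = ∫⁻ x, ENNReal.ofReal (f x ^ 2) := by
  have hf' := memLp_ofReal_iff.mpr hf
  have h := Lp.norm_fourier_eq (hf'.toLp _)
  have key : ∀ u : Lp ℂ 2 (volume : Measure ℝ), ‖u‖ₑ ^ 2 = ∫⁻ x, ‖u x‖ₑ ^ 2 := by
    intro u
    rw [Lp.enorm_def, eLpNorm_eq_lintegral_rpow_enorm_toReal (by norm_num) (by norm_num)]
    simp only [ENNReal.toReal_ofNat, ENNReal.rpow_ofNat]
    rw [← ENNReal.rpow_natCast, ← ENNReal.rpow_mul]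
    norm_num
  have h' : ‖(𝓕 (hf'.toLp _) : Lp ℂ 2 (volume : Measure ℝ))‖ₑ = ‖hf'.toLp _‖ₑ := by
    rw [← ofReal_norm, ← ofReal_norm, h]
  rw [ft_eq hf', ← key, h', key]
  refine lintegral_congr_ae ?_
  filter_upwards [hf'.coeFn_toLp] with x a
  rw [a, ← ofReal_norm, ← ENNReal.ofReal_pow (norm_nonneg _)]
  simp

theorem integral_mul_ft {f : ℝ → ℝ} (hf : MemLp f 2) (φ : SchwartzMap ℝ ℂ) :
    ∫ ξ, φ ξ * ft f ξ = ∫ x, (𝓕 φ) x * (f x : ℂ) := by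
  have hf' := memLp_ofReal_iff.mpr hf
  have h := Lp.fourier_toTemperedDistribution_eq (hf'.toLp _)
  have h2 := DFunLike.congr_fun h φ
  rw [TemperedDistribution.fourier_apply, Lp.toTemperedDistribution_apply,
    Lp.toTemperedDistribution_apply] at h2
  rw [ft_eq hf']
  simp only [smul_eq_mul] at h2
  rw [← h2]
  refine integral_congr_ae ?_
  filter_upwards [hf'.coeFn_toLp] with x a
  rw [a]

/-- Identities between L² transforms are checked by pairing with test functions: `integral_mul_ft`
moves the transform onto a Schwartz function, where the classical formulas hold. -/
theorem ft_ae_eq_of_forall {f : ℝ → ℝ} {G : ℝ → ℂ} (hG : LocallyIntegrable G)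
    (h : ∀ φ : ℝ → ℂ, ContDiff ℝ ∞ φ → HasCompactSupport φ →
      ∫ ξ, φ ξ * ft f ξ = ∫ ξ, φ ξ * G ξ) : ft f =ᵐ[volume] G := by
  refine ae_eq_of_integral_contDiff_smul_eq
    ((memLp_ft f).locallyIntegrable (by norm_num)) hG fun φ hφ hc => ?_
  have h1 : ContDiff ℝ ∞ fun x => (φ x : ℂ) := Complex.ofRealCLM.contDiff.comp hφ
  have h2 : HasCompactSupport fun x => (φ x : ℂ) := hc.comp_left (g := Complex.ofReal) rfl
  simpa only [Complex.real_smul] using h _ h1 h2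

theorem memLp_comp_add {f : ℝ → ℝ} (hf : MemLp f 2) (a : ℝ) : MemLp (fun x => f (x + a)) 2 :=
  hf.comp_measurePreserving (measurePreserving_add_right volume a)

theorem ft_comp_add {f : ℝ → ℝ} (hf : MemLp f 2) (a : ℝ) :
    ft (fun x => f (x + a)) =ᵐ[volume]
      fun ξ => Complex.exp ((2 * Real.pi * (a * ξ) : ℝ) * Complex.I) * ft f ξ := by
  have hec : Continuous fun ξ : ℝ => Complex.exp ((2 * Real.pi * (a * ξ) : ℝ) * Complex.I) := by
    fun_prop
  have hes : ContDiff ℝ ∞ fun ξ : ℝ => Complex.exp ((2 * Real.pi * (a * ξ) : ℝ) * Complex.I) := by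
    refine Complex.contDiff_exp.comp ?_
    have h1 : ContDiff ℝ ∞ fun ξ : ℝ => 2 * Real.pi * (a * ξ) := by fun_prop
    exact (Complex.ofRealCLM.contDiff.comp h1).mul contDiff_const
  refine ft_ae_eq_of_forall ?_ fun φ hφ hc => ?_
  · have := (locallyIntegrableOn_univ.mpr ((memLp_ft f).locallyIntegrable (by norm_num))
      ).continuousOn_smul isOpen_univ.isLocallyClosed hec.continuousOn
    rw [locallyIntegrableOn_univ] at this
    exact this
  · set ψ : ℝ → ℂ := fun ξ => Complex.exp ((2 * Real.pi * (a * ξ) : ℝ) * Complex.I) * φ ξ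
    have hψ : ContDiff ℝ ∞ ψ := hes.mul hφ
    have hψc : HasCompactSupport ψ := hc.mul_left
    have h1 := integral_mul_ft (memLp_comp_add hf a) (hc.toSchwartzMap hφ)
    have h2 := integral_mul_ft hf (hψc.toSchwartzMap hψ)
    simp only [HasCompactSupport.toSchwartzMap_toFun] at h1 h2
    -- Modulating the test function translates its transform.
    have h3 : ∀ x, (𝓕 (hψc.toSchwartzMap hψ)) x = (𝓕 (hc.toSchwartzMap hφ)) (x - a) := by
      intro x
      rw [SchwartzMap.fourier_coe, SchwartzMap.fourier_coe,
        Real.fourier_real_eq_integral_exp_smul, Real.fourier_real_eq_integral_exp_smul]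
      refine integral_congr_ae (Eventually.of_forall fun v => ?_)
      simp only [HasCompactSupport.toSchwartzMap_toFun, ψ, smul_eq_mul]
      rw [← mul_assoc, ← Complex.exp_add]
      congr 2
      push_cast; ring
    have h4 : ∫ x, (𝓕 (hψc.toSchwartzMap hψ)) x * (f x : ℂ) =
        ∫ x, (𝓕 (hc.toSchwartzMap hφ)) x * (f (x + a) : ℂ) := by
      rw [← integral_add_right_eq_self _ a]
      simp only [h3, add_sub_cancel_right]
    rw [h1, ← h4, ← h2]
    refine integral_congr_ae (Eventually.of_forall fun v => ?_)
    simp only [ψ]; ring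

theorem ft_neg_apply {f : ℝ → ℝ} (hf : MemLp f 2) :
    ∀ᵐ ξ, ft f ξ = (starRingEnd ℂ) (ft f (-ξ)) := by
  have hm : MemLp (fun ξ => (starRingEnd ℂ) (ft f (-ξ))) 2 (volume : Measure ℝ) :=
    ((memLp_ft f).comp_measurePreserving (Measure.measurePreserving_neg volume)).star
  refine ft_ae_eq_of_forall (hm.locallyIntegrable (by norm_num)) fun φ hφ hc => ?_
  set ψ : ℝ → ℂ := fun ξ => (starRingEnd ℂ) (φ (-ξ))
  have hψ : ContDiff ℝ ∞ ψ := Complex.conjCLE.contDiff.comp (hφ.comp contDiff_neg)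
  have hψc : HasCompactSupport ψ :=
    (hc.comp_homeomorph (Homeomorph.neg ℝ)).comp_left (g := starRingEnd ℂ) (by simp)
  have h1 := integral_mul_ft hf (hc.toSchwartzMap hφ)
  have h2 := integral_mul_ft hf (hψc.toSchwartzMap hψ)
  simp only [HasCompactSupport.toSchwartzMap_toFun] at h1 h2
  have h3 : ∀ x, (𝓕 (hψc.toSchwartzMap hψ)) x = (starRingEnd ℂ) ((𝓕 (hc.toSchwartzMap hφ)) x) := by
    intro x
    rw [SchwartzMap.fourier_coe, SchwartzMap.fourier_coe,
      Real.fourier_real_eq_integral_exp_smul, Real.fourier_real_eq_integral_exp_smul,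
      ← integral_conj, ← integral_neg_eq_self]
    refine integral_congr_ae (Eventually.of_forall fun v => ?_)
    simp only [HasCompactSupport.toSchwartzMap_toFun, ψ, smul_eq_mul, map_mul, neg_neg,
      ← Complex.exp_conj]
    congr 2
    simp [Complex.conj_ofNat]
  have h4 : ∫ ξ, φ ξ * (starRingEnd ℂ) (ft f (-ξ)) = (starRingEnd ℂ) (∫ ξ, ψ ξ * ft f ξ) := by
    rw [← integral_conj, ← integral_neg_eq_self]
    simp [ψ]
  rw [h4, h2, h1, ← integral_conj]
  refine integral_congr_ae (Eventually.of_forall fun v => ?_)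
  simp [h3]

/-- Every square integrable function with the symmetry of the Fourier transform of a real function
is one. -/
theorem exists_ft_eq {G : ℝ → ℂ} (hG : MemLp G 2 (volume : Measure ℝ))
    (hs : ∀ᵐ ξ, G ξ = (starRingEnd ℂ) (G (-ξ))) :
    ∃ v : ℝ → ℝ, MemLp v 2 ∧ ft v =ᵐ[volume] G := by
  set V : Lp ℂ 2 (volume : Measure ℝ) := 𝓕⁻ (hG.toLp G)
  have hV := Lp.memLp V
  have h1' := memLp_ofReal_iff.mpr hV.re
  have h2' := memLp_ofReal_iff.mpr hV.im
  have hdec : V = h1'.toLp _ + Complex.I • h2'.toLp _ := by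
    apply Lp.ext
    filter_upwards [Lp.coeFn_add (h1'.toLp _) (Complex.I • h2'.toLp _),
      Lp.coeFn_smul Complex.I (h2'.toLp _), h1'.coeFn_toLp, h2'.coeFn_toLp] with x a b c d
    rw [a, Pi.add_apply, b, Pi.smul_apply, c, d, smul_eq_mul, mul_comm]
    exact (Complex.re_add_im _).symm
  have hF : (𝓕 V : Lp ℂ 2 (volume : Measure ℝ)) = hG.toLp G := FourierTransform.fourier_fourierInv_eq _
  have hF2 : (𝓕 V : Lp ℂ 2 (volume : Measure ℝ)) =
      𝓕 (h1'.toLp _) + Complex.I • 𝓕 (h2'.toLp _) := by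
    conv_lhs => rw [hdec]
    exact ((Lp.fourierTransformₗᵢ ℝ ℂ).map_add _ _).trans
      (congrArg _ ((Lp.fourierTransformₗᵢ ℝ ℂ).map_smul _ _))
  have key : ∀ᵐ ξ, G ξ = ft (fun x => (V x).re) ξ + Complex.I * ft (fun x => (V x).im) ξ := by
    have e1 := ft_eq (f := fun x => (V x).re) h1'
    have e2 := ft_eq (f := fun x => (V x).im) h2'
    filter_upwards [hG.coeFn_toLp, Lp.coeFn_add (𝓕 (h1'.toLp _)) (Complex.I • 𝓕 (h2'.toLp _)),
      Lp.coeFn_smul Complex.I (𝓕 (h2'.toLp _))] with ξ a b c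
    rw [← a, ← hF, hF2, b, Pi.add_apply, c, Pi.smul_apply, e1, e2, smul_eq_mul]
    rfl
  refine ⟨fun x => (V x).re, hV.re, ?_⟩
  have hneg := (Measure.measurePreserving_neg (volume : Measure ℝ)).quasiMeasurePreserving.ae key
  filter_upwards [key, hneg, hs, ft_neg_apply (f := fun x => (V x).re) hV.re,
    ft_neg_apply (f := fun x => (V x).im) hV.im] with ξ a b c d e
  -- The inverse transform of G is split into real and imaginary parts, with transforms R and J, so
  -- that G = R + iJ. Both are transforms of real functions, so the conjugate of G(-ξ) is R - iJ,
  -- and the symmetry of G forces J = 0.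
  have h3 : (starRingEnd ℂ) (G (-ξ)) =
      ft (fun x => (V x).re) ξ - Complex.I * ft (fun x => (V x).im) ξ := by
    rw [b, map_add, map_mul, ← d, ← e, Complex.conj_I]; ring
  rw [h3, a] at c
  rw [a]
  linear_combination (-1 / 2 : ℂ) * c

end NeelWall

/-! ### Derivatives and the half-Laplacian as Fourier multipliers. -/

namespace NeelWall

theorem IsPrimitive.integral_schwartz {f g : ℝ → ℝ} (h : IsPrimitive f g) (hf : MemLp f 2)
    (hg : MemLp g 2) (Φ : SchwartzMap ℝ ℂ) :
    ∫ x, deriv Φ x * (f x : ℂ) = -∫ x, Φ x * (g x : ℂ) := by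
  have hΦ : MemLp (fun x => Φ x) 2 (volume : Measure ℝ) := Φ.memLp 2
  have hfun : (fun x => deriv Φ x) = SchwartzMap.derivCLM ℂ ℂ Φ := by
    funext x; exact (SchwartzMap.derivCLM_apply ℂ Φ x).symm
  have hΦ' : MemLp (fun x => deriv Φ x) 2 (volume : Measure ℝ) := by
    rw [hfun]; exact (SchwartzMap.derivCLM ℂ ℂ Φ).memLp 2
  have hi1 : Integrable fun x => deriv Φ x * (f x : ℂ) := hΦ'.integrable_mul hf.ofReal
  have hi2 : Integrable fun x => Φ x * (g x : ℂ) := hΦ.integrable_mul hg.ofReal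
  have hd : ∀ x, HasDerivAt Φ (deriv Φ x) x := Φ.hasDerivAt
  have hc : Continuous fun x => deriv Φ x := by
    rw [hfun]; exact (SchwartzMap.derivCLM ℂ ℂ Φ).continuous
  have hre : IsPrimitive (fun x => (Φ x).re) (fun x => (deriv Φ x).re) := .of_hasDerivAt
    (fun x => Complex.reCLM.hasFDerivAt.comp_hasDerivAt x (hd x)) (Complex.continuous_re.comp hc)
  have him : IsPrimitive (fun x => (Φ x).im) (fun x => (deriv Φ x).im) := .of_hasDerivAt
    (fun x => Complex.imCLM.hasFDerivAt.comp_hasDerivAt x (hd x)) (Complex.continuous_im.comp hc)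
  have e1 := hre.integral_mul_add_mul h hΦ.re hΦ'.re hf hg
  have e2 := him.integral_mul_add_mul h hΦ.im hΦ'.im hf hg
  rw [← add_eq_zero_iff_eq_neg, ← integral_add hi1 hi2]
  have hi := hi1.add hi2
  apply Complex.ext
  · rw [Complex.zero_re, ← e1]
    refine (integral_re (𝕜 := ℂ) hi).symm.trans ?_
    simp
  · rw [Complex.zero_im, ← e2]
    refine (integral_im (𝕜 := ℂ) hi).symm.trans ?_
    simp

theorem locallyIntegrable_continuous_mul_complex {F : ℝ → ℂ} {G : ℝ → ℂ} (hF : Continuous F)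
    (hG : LocallyIntegrable G) : LocallyIntegrable fun ξ => F ξ * G ξ := by
  have := (locallyIntegrableOn_univ.mpr hG).continuousOn_smul isOpen_univ.isLocallyClosed
    hF.continuousOn
  rwa [locallyIntegrableOn_univ] at this

theorem IsPrimitive.ft_deriv {f g : ℝ → ℝ} (h : IsPrimitive f g) (hf : MemLp f 2)
    (hg : MemLp g 2) :
    ft g =ᵐ[volume] fun ξ => 2 * Real.pi * Complex.I * ξ * ft f ξ := by
  refine ft_ae_eq_of_forall (locallyIntegrable_continuous_mul_complex (by fun_prop)
    ((memLp_ft f).locallyIntegrable (by norm_num))) fun φ hφ hc => ?_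
  set ψ : ℝ → ℂ := fun ξ => (-2 * Real.pi * Complex.I * ξ) * φ ξ
  have hψ : ContDiff ℝ ∞ ψ :=
    (contDiff_const.mul Complex.ofRealCLM.contDiff).mul hφ
  have hψc : HasCompactSupport ψ := hc.mul_left
  have h1 := integral_mul_ft hg (hc.toSchwartzMap hφ)
  have h2 := integral_mul_ft hf (hψc.toSchwartzMap hψ)
  simp only [HasCompactSupport.toSchwartzMap_toFun] at h1 h2
  have h3 : ∀ x, (𝓕 (hψc.toSchwartzMap hψ)) x = deriv (𝓕 (hc.toSchwartzMap hφ) : SchwartzMap ℝ ℂ) x := by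
    intro x
    rw [SchwartzMap.fourier_coe, SchwartzMap.fourier_coe]
    refine ((Real.hasDerivAt_fourier (f := φ) ?_ ?_ x).deriv).symm
    · exact hφ.continuous.integrable_of_hasCompactSupport hc
    · have h4 : HasCompactSupport fun x : ℝ => (x : ℂ) * φ x := hc.mul_left
      simp only [Complex.real_smul]
      have h5 := hφ.continuous
      exact (by fun_prop : Continuous fun x : ℝ => (x : ℂ) * φ x).integrable_of_hasCompactSupport h4
  simp only [h3] at h2
  rw [h.integral_schwartz hf hg] at h2
  rw [h1, ← neg_inj, ← h2, ← integral_neg]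
  refine integral_congr_ae (Eventually.of_forall fun v => ?_)
  simp only [ψ]; ring

theorem IsWeakDeriv.ft_deriv {f g : ℝ → ℝ} (h : IsWeakDeriv f g) (hf : MemLp f 2)
    (hg : MemLp g 2) :
    ft g =ᵐ[volume] fun ξ => 2 * Real.pi * Complex.I * ξ * ft f ξ := by
  obtain ⟨F, hF, hP⟩ := h.exists_isPrimitive
  rw [ft_congr hF]
  exact hP.ft_deriv (hf.ae_eq hF) hg

/-- Write the test function as the transform of its inverse transform; differentiating it multiplies
that inverse transform by -2πiξ, which is integration by parts read on the Fourier side. -/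
theorem isWeakDeriv_of_ft {f g : ℝ → ℝ} (hf : MemLp f 2) (hg : MemLp g 2)
    (h : ft g =ᵐ[volume] fun ξ => 2 * Real.pi * Complex.I * ξ * ft f ξ) : IsWeakDeriv f g := by
  refine ⟨hf.locallyIntegrable (by norm_num), hg.locallyIntegrable (by norm_num),
    fun φ hφ hc => ?_⟩
  have hφC : ContDiff ℝ ∞ fun x => (φ x : ℂ) := Complex.ofRealCLM.contDiff.comp hφ
  have hcC : HasCompactSupport fun x => (φ x : ℂ) := hc.comp_left (g := Complex.ofReal) rfl
  set Φ : SchwartzMap ℝ ℂ := hcC.toSchwartzMap hφC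
  set Φ' : SchwartzMap ℝ ℂ := SchwartzMap.derivCLM ℂ ℂ Φ
  have hΦ' : ∀ x, Φ' x = ((deriv φ x : ℝ) : ℂ) := fun x => by
    have := (hφ.differentiable (by simp) x).hasDerivAt.ofReal_comp
    exact this.deriv
  have h1 := integral_mul_ft hf (𝓕⁻ Φ')
  have h2 := integral_mul_ft hg (𝓕⁻ Φ)
  rw [FourierTransform.fourier_fourierInv_eq] at h1 h2
  have h3 : ∀ ξ : ℝ, (𝓕⁻ Φ') ξ = -(2 * Real.pi * Complex.I * ξ) * (𝓕⁻ Φ) ξ := by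
    intro ξ
    rw [SchwartzMap.fourierInv_coe, SchwartzMap.fourierInv_coe, Real.fourierInv_eq_fourier_neg,
      Real.fourierInv_eq_fourier_neg]
    have := congrFun (Real.fourier_deriv (f := Φ) Φ.integrable (Φ.differentiable)
      Φ'.integrable) (-ξ)
    refine Eq.trans this ?_
    simp
  have h4 : ∫ ξ, (𝓕⁻ Φ') ξ * ft f ξ = -∫ ξ, (𝓕⁻ Φ) ξ * ft g ξ := by
    rw [← integral_neg]
    refine integral_congr_ae ?_
    filter_upwards [h] with ξ hξ
    rw [hξ, h3]; ring
  rw [h1, h2] at h4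
  have h5 : ((∫ x, f x * deriv φ x : ℝ) : ℂ) = ((-∫ x, g x * φ x : ℝ) : ℂ) := by
    rw [Complex.ofReal_neg, ← integral_complex_ofReal, ← integral_complex_ofReal]
    simp only [hΦ', Φ, HasCompactSupport.toSchwartzMap_toFun] at h4
    simpa [mul_comm] using h4
  exact_mod_cast h5

/-- `v` is the half-Laplacian of the square integrable function `u`. -/
def HalfLap (u v : ℝ → ℝ) : Prop :=
  MemLp u 2 ∧ MemLp v 2 ∧ ft v =ᵐ[volume] fun ξ => ((|2 * Real.pi * ξ| : ℝ) : ℂ) * ft u ξ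

theorem isHalfLaplacian_iff {f v : ℝ → ℝ} :
    IsHalfLaplacian f v ↔ ∃ c, HalfLap (fun x => f x - c) v := by
  constructor
  · rintro ⟨c, hf, hv, h⟩
    refine ⟨c, memLp_ofReal_iff.mp hf, memLp_ofReal_iff.mp hv, ?_⟩
    rw [ft_eq hf, ft_eq hv]
    exact h
  · rintro ⟨c, hf, hv, h⟩
    refine ⟨c, memLp_ofReal_iff.mpr hf, memLp_ofReal_iff.mpr hv, ?_⟩
    rwa [ft_eq (memLp_ofReal_iff.mpr hf), ft_eq (memLp_ofReal_iff.mpr hv)] at h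

theorem isHalfLaplacian_sub_const {f v : ℝ → ℝ} (c : ℝ) :
    IsHalfLaplacian (fun x => f x - c) v ↔ IsHalfLaplacian f v := by
  rw [isHalfLaplacian_iff, isHalfLaplacian_iff]
  constructor
  · rintro ⟨d, h⟩
    exact ⟨c + d, by simpa [sub_sub] using h⟩
  · rintro ⟨d, h⟩
    exact ⟨d - c, by simpa [sub_sub] using h⟩

theorem HalfLap.isHalfLaplacian {u v : ℝ → ℝ} (h : HalfLap u v) : IsHalfLaplacian u v :=
  isHalfLaplacian_iff.mpr ⟨0, by simpa using h⟩

/-- If `f` itself is square integrable, the additive constant in `IsHalfLaplacian` is zero. -/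
theorem IsHalfLaplacian.halfLap {u v : ℝ → ℝ} (h : IsHalfLaplacian u v) (hu : MemLp u 2) :
    HalfLap u v := by
  obtain ⟨c, hc⟩ := isHalfLaplacian_iff.mp h
  have h' : MemLp (fun _ : ℝ => c) 2 (volume : Measure ℝ) := by
    convert! hu.sub hc.1 using 1
    funext x; simp
  rw [memLp_const_iff (by norm_num) (by norm_num)] at h'
  rcases h' with h' | h'
  · subst h'; simpa using hc
  · simp at h'

/-- The symbols |2πξ| and 2πiξ have equal modulus, so one product is square integrable as soon as
the other is. The first symbol is real and even, so the result is again the transform of a real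
function. -/
theorem halfLap_of_isWeakDeriv {u u' : ℝ → ℝ} (h : IsWeakDeriv u u') (hu : MemLp u 2)
    (hu' : MemLp u' 2) : ∃ v, HalfLap u v := by
  have hd := h.ft_deriv hu hu'
  have hm : MemLp (fun ξ : ℝ => ((|2 * Real.pi * ξ| : ℝ) : ℂ) * ft u ξ) 2 volume := by
    refine (memLp_ft u').of_le ?_ ?_
    · exact (Continuous.aestronglyMeasurable (by fun_prop)).mul (memLp_ft u).1
    · filter_upwards [hd] with ξ hξ
      rw [hξ]
      simp
  obtain ⟨v, hv, he⟩ := exists_ft_eq hm (by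
    filter_upwards [ft_neg_apply hu] with ξ hξ
    rw [map_mul, ← hξ, Complex.conj_ofReal]
    simp)
  exact ⟨v, hu, hv, he⟩

namespace HalfLap

variable {u v u₁ v₁ u₂ v₂ : ℝ → ℝ}

theorem sub (h₁ : HalfLap u₁ v₁) (h₂ : HalfLap u₂ v₂) :
    HalfLap (fun x => u₁ x - u₂ x) (fun x => v₁ x - v₂ x) := by
  refine ⟨h₁.1.sub h₂.1, h₁.2.1.sub h₂.2.1, ?_⟩
  filter_upwards [h₁.2.2, h₂.2.2, ft_sub h₁.1 h₂.1, ft_sub h₁.2.1 h₂.2.1] with ξ a b c d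
  rw [c, d, a, b]; ring

theorem symm (h₁ : HalfLap u₁ v₁) (h₂ : HalfLap u₂ v₂) :
    ∫ x, u₁ x * v₂ x = ∫ x, u₂ x * v₁ x := by
  rw [← ft_inner h₁.1 h₂.2.1, ← ft_inner h₂.1 h₁.2.1]
  refine integral_congr_ae ?_
  filter_upwards [h₁.2.2, h₂.2.2] with ξ a b
  rw [a, b]
  simp only [map_mul, Complex.conj_ofReal, Complex.mul_re, Complex.mul_im, Complex.ofReal_re,
    Complex.ofReal_im, Complex.conj_re, Complex.conj_im]
  ring

theorem integral_mul_eq (h : HalfLap u v) :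
    ∫ x, u x * v x = ∫ ξ : ℝ, |2 * Real.pi * ξ| * ‖ft u ξ‖ ^ 2 := by
  rw [← ft_inner h.1 h.2.1]
  refine integral_congr_ae ?_
  filter_upwards [h.2.2] with ξ a
  rw [a, ← Complex.normSq_eq_norm_sq, Complex.normSq_apply]
  simp only [map_mul, Complex.conj_ofReal, Complex.mul_re, Complex.mul_im, Complex.ofReal_re,
    Complex.ofReal_im, Complex.conj_re, Complex.conj_im]
  ring

theorem integral_mul_nonneg (h : HalfLap u v) : 0 ≤ ∫ x, u x * v x := by
  rw [h.integral_mul_eq]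
  exact integral_nonneg fun ξ => by positivity

theorem ofReal_integral_mul (h : HalfLap u v) : ENNReal.ofReal (∫ x, u x * v x) =
    ∫⁻ ξ : ℝ, ENNReal.ofReal |2 * Real.pi * ξ| * ‖ft u ξ‖ₑ ^ 2 := by
  rw [h.integral_mul_eq, ofReal_integral_eq_lintegral_ofReal]
  · refine lintegral_congr fun ξ => ?_
    rw [ENNReal.ofReal_mul (abs_nonneg _), ENNReal.ofReal_pow (norm_nonneg _), ofReal_norm]
  · have := (memLp_ft v).integrable_mul (memLp_ft u).star
    refine this.norm.congr ?_
    filter_upwards [h.2.2] with ξ a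
    simp only [Pi.mul_apply, a, norm_mul, Pi.star_apply, norm_star, Complex.norm_real,
      Real.norm_eq_abs, abs_abs]
    ring
  · exact Eventually.of_forall fun ξ => by positivity

/-- Plancherel and the equality of moduli of the two symbols. This is how the nonlocal term is
estimated by local quantities in the first variation. -/
theorem integral_sq_eq {u' : ℝ → ℝ} (h : HalfLap u v) (hu : IsWeakDeriv u u')
    (hu' : MemLp u' 2) : ∫ x, v x ^ 2 = ∫ x, u' x ^ 2 := by
  have e : ∀ w : ℝ → ℝ, ∫ x, w x ^ 2 = ∫ x, w x * w x := fun w =>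
    integral_congr_ae (Eventually.of_forall fun x => pow_two (w x))
  rw [e, e, ← ft_inner h.2.1 h.2.1, ← ft_inner hu' hu']
  refine integral_congr_ae ?_
  filter_upwards [h.2.2, hu.ft_deriv h.1 hu'] with ξ a b
  rw [Complex.mul_conj, Complex.mul_conj, Complex.ofReal_re, Complex.ofReal_re, a, b,
    Complex.normSq_mul, Complex.normSq_mul]
  congr 1
  rw [Complex.normSq_eq_norm_sq, Complex.normSq_eq_norm_sq]
  simp

theorem comp_add (h : HalfLap u v) (a : ℝ) :
    HalfLap (fun x => u (x + a)) (fun x => v (x + a)) := by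
  refine ⟨memLp_comp_add h.1 a, memLp_comp_add h.2.1 a, ?_⟩
  filter_upwards [h.2.2, ft_comp_add h.1 a, ft_comp_add h.2.1 a] with ξ x y z
  rw [y, z, x]; ring

theorem isWeakDeriv {u' w : ℝ → ℝ} (h : HalfLap u v) (hu : IsWeakDeriv u u')
    (h' : HalfLap u' w) : IsWeakDeriv v w := by
  refine isWeakDeriv_of_ft h.2.1 h'.2.1 ?_
  filter_upwards [h.2.2, h'.2.2, hu.ft_deriv h.1 h'.1] with ξ a b c
  rw [a, b, c]; ring

theorem halfLaplacian_ae_eq (h : HalfLap u v) : halfLaplacian u =ᵐ[volume] v :=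
  h.isHalfLaplacian.halfLaplacian_ae_eq

end HalfLap

/-- The defining predicate is insensitive to constants, so the two choices are made from the same
predicate and agree everywhere. It reconciles sin θ in the equation with sin θ - h in the energy. -/
theorem halfLaplacian_sub_const (f : ℝ → ℝ) (c : ℝ) :
    halfLaplacian (fun x => f x - c) = halfLaplacian f := by
  classical
  have h : IsHalfLaplacian (fun x => f x - c) = IsHalfLaplacian f :=
    funext fun v => propext (isHalfLaplacian_sub_const c)
  exact congrArg (fun P : (ℝ → ℝ) → Prop => if H : ∃ v, P v then H.choose else 0) h

end NeelWall

/-! ### Quadratic forms with radial kernels: box kernels for the Dirichlet integral, z⁻² for the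
H^{1/2} seminorm. -/

namespace NeelWall

open scoped ENNReal

/-- The quadratic form `∬ K(x - y) (f x - f y)² dx dy`. -/
noncomputable def kernelForm (K : ℝ → ℝ≥0∞) (f : ℝ → ℝ) : ℝ≥0∞ :=
  ∫⁻ x, ∫⁻ y, K (x - y) * ENNReal.ofReal ((f x - f y) ^ 2)

/-- Even measurable kernels which are nonincreasing in `|z|`. -/
structure IsRadial (K : ℝ → ℝ≥0∞) : Prop where
  measurable : Measurable K
  anti : ∀ z w, |z| ≤ |w| → K w ≤ K z

theorem IsRadial.neg {K : ℝ → ℝ≥0∞} (hK : IsRadial K) (z : ℝ) : K (-z) = K z :=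
  le_antisymm (hK.anti _ _ (by simp)) (hK.anti _ _ (by simp))

/-- The kernel `z⁻²`. -/
noncomputable def invSq (z : ℝ) : ℝ≥0∞ := (ENNReal.ofReal (z ^ 2))⁻¹

/-- The kernel `3 / (2 ε³)` on `(-ε, ε)`. -/
noncomputable def boxKernel (ε z : ℝ) : ℝ≥0∞ :=
  if |z| < ε then ENNReal.ofReal (3 / (2 * ε ^ 3)) else 0

theorem isRadial_invSq : IsRadial invSq := by
  refine ⟨by unfold invSq; fun_prop, fun z w h => ?_⟩
  exact ENNReal.inv_le_inv.mpr (ENNReal.ofReal_le_ofReal (sq_le_sq.mpr h))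

theorem isRadial_boxKernel (ε : ℝ) : IsRadial (boxKernel ε) := by
  refine ⟨?_, fun z w h => ?_⟩
  · exact Measurable.ite (measurableSet_lt (by fun_prop) (by fun_prop)) measurable_const
      measurable_const
  · unfold boxKernel
    split_ifs with h1 h2
    · exact le_rfl
    · exact absurd (h.trans_lt h1) h2
    · simp
    · exact le_rfl

theorem measurable_kernel_integrand {K : ℝ → ℝ≥0∞} (hK : Measurable K) {f : ℝ → ℝ}
    (hf : Measurable f) :
    Measurable fun p : ℝ × ℝ => K (p.1 - p.2) * ENNReal.ofReal ((f p.1 - f p.2) ^ 2) := by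
  fun_prop

/-- Tonelli's theorem and the substitution x = y + z group the pairs by displacement, reducing the
form to the L² moduli of continuity of `f`. -/
theorem kernelForm_eq {K : ℝ → ℝ≥0∞} (hK : Measurable K) {f : ℝ → ℝ} (hf : Measurable f) :
    kernelForm K f = ∫⁻ z, K z * ∫⁻ y, ENNReal.ofReal ((f (y + z) - f y) ^ 2) := by
  unfold kernelForm
  rw [lintegral_lintegral_swap (measurable_kernel_integrand hK hf).aemeasurable]
  have h1 : ∀ y, ∫⁻ x, K (x - y) * ENNReal.ofReal ((f x - f y) ^ 2) =
      ∫⁻ z, K z * ENNReal.ofReal ((f (y + z) - f y) ^ 2) := fun y => by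
    rw [← lintegral_add_right_eq_self _ y]
    simp [add_comm y]
  simp only [h1]
  rw [lintegral_lintegral_swap (Measurable.aemeasurable (by fun_prop))]
  refine lintegral_congr fun z => ?_
  rw [lintegral_const_mul _ (by fun_prop)]

theorem kernelForm_comp_add (K : ℝ → ℝ≥0∞) (f : ℝ → ℝ) (a : ℝ) :
    kernelForm K (fun x => f (x + a)) = kernelForm K f := by
  unfold kernelForm
  conv_rhs => rw [← lintegral_add_right_eq_self _ a]
  refine lintegral_congr fun x => ?_
  conv_rhs => rw [← lintegral_add_right_eq_self _ a]
  simp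

theorem kernelForm_mono {K : ℝ → ℝ≥0∞} {f g : ℝ → ℝ} (h : ∀ x y, |f x - f y| ≤ |g x - g y|) :
    kernelForm K f ≤ kernelForm K g :=
  lintegral_mono fun x => lintegral_mono fun y =>
    mul_le_mul_right (ENNReal.ofReal_le_ofReal (sq_le_sq.mpr (h x y))) _

theorem kernelForm_sub_const (K : ℝ → ℝ≥0∞) (f : ℝ → ℝ) (c : ℝ) :
    kernelForm K (fun x => f x - c) = kernelForm K f := by
  simp [kernelForm]

theorem sq_lintegral_le {α : Type*} [MeasurableSpace α] {μ : Measure α} {F : α → ℝ≥0∞}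
    (hF : AEMeasurable F μ) : (∫⁻ x, F x ∂μ) ^ 2 ≤ μ Set.univ * ∫⁻ x, F x ^ 2 ∂μ := by
  have h := ENNReal.lintegral_mul_le_Lp_mul_Lq μ Real.HolderConjugate.two_two hF
    (aemeasurable_const (b := (1 : ℝ≥0∞)))
  simp only [Pi.mul_apply, mul_one, lintegral_const, ENNReal.rpow_ofNat, one_pow, one_mul] at h
  calc (∫⁻ x, F x ∂μ) ^ 2
      ≤ ((∫⁻ x, F x ^ 2 ∂μ) ^ (1 / 2 : ℝ) * μ Set.univ ^ (1 / 2 : ℝ)) ^ 2 := by gcongr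
    _ = μ Set.univ * ∫⁻ x, F x ^ 2 ∂μ := by
      rw [mul_pow, ← ENNReal.rpow_natCast, ← ENNReal.rpow_natCast, ← ENNReal.rpow_mul,
        ← ENNReal.rpow_mul]
      norm_num [mul_comm]

theorem IsPrimitive.exists_measurable {f g : ℝ → ℝ} (h : IsPrimitive f g) :
    ∃ g', Measurable g' ∧ g =ᵐ[volume] g' ∧ IsPrimitive f g' := by
  obtain ⟨g', hg', he⟩ := h.1.aestronglyMeasurable.aemeasurable
  exact ⟨g', hg', he, h.congr_deriv he⟩

theorem ofReal_sq_eq_enorm (x : ℝ) : ENNReal.ofReal (x ^ 2) = ‖x‖ₑ ^ 2 := by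
  rw [← sq_abs, ENNReal.ofReal_pow (abs_nonneg x), ← Real.enorm_eq_ofReal_abs]

/-- Cauchy–Schwarz on the interval between the two points. Keeping the integral local lets the later
integration over `y` produce z² times the Dirichlet integral. -/
theorem IsPrimitive.sq_sub_le {f g : ℝ → ℝ} (h : IsPrimitive f g) (y z : ℝ) :
    ENNReal.ofReal ((f (y + z) - f y) ^ 2) ≤
      ENNReal.ofReal |z| * ∫⁻ s in Set.uIoc 0 z, ‖g (y + s)‖ₑ ^ 2 := by
  have h1 : f (y + z) - f y = ∫ s in (0:ℝ)..z, g (y + s) := by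
    rw [intervalIntegral.integral_comp_add_left, add_zero, h.2]
  have h2 : ‖∫ s in (0:ℝ)..z, g (y + s)‖ₑ ≤ ∫⁻ s in Set.uIoc 0 z, ‖g (y + s)‖ₑ := by
    rw [← ofReal_norm, intervalIntegral.norm_intervalIntegral_eq, ofReal_norm]
    exact enorm_integral_le_lintegral_enorm _
  have hm : AEMeasurable (fun s => ‖g (y + s)‖ₑ) (volume.restrict (Set.uIoc 0 z)) := by
    have : AEStronglyMeasurable (fun s => g (y + s)) volume :=
      h.1.aestronglyMeasurable.comp_measurePreserving (measurePreserving_add_left volume y)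
    exact this.restrict.enorm
  rw [ofReal_sq_eq_enorm, h1]
  refine (pow_le_pow_left' h2 2).trans ((sq_lintegral_le hm).trans (le_of_eq ?_))
  congr 1
  rw [Measure.restrict_apply_univ, Set.uIoc, Real.volume_Ioc, max_sub_min_eq_abs]
  simp

theorem IsPrimitive.sq_sub_le_total {f g : ℝ → ℝ} (h : IsPrimitive f g) (x y : ℝ) :
    ENNReal.ofReal ((f x - f y) ^ 2) ≤
      ENNReal.ofReal |x - y| * ∫⁻ s, ENNReal.ofReal (g s ^ 2) := by
  have h1 := h.sq_sub_le y (x - y)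
  rw [add_sub_cancel] at h1
  refine h1.trans (mul_le_mul_right ((setLIntegral_le_lintegral _ _).trans (le_of_eq ?_)) _)
  rw [lintegral_add_left_eq_self (fun s => ‖g s‖ₑ ^ 2) y]
  simp only [ofReal_sq_eq_enorm]

theorem IsPrimitive.lintegral_sq_sub_le {f g : ℝ → ℝ} (h : IsPrimitive f g) (z : ℝ) :
    ∫⁻ y, ENNReal.ofReal ((f (y + z) - f y) ^ 2) ≤
      ENNReal.ofReal (z ^ 2) * ∫⁻ s, ENNReal.ofReal (g s ^ 2) := by
  obtain ⟨g', hg', he, hP⟩ := h.exists_measurable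
  have e1 : ∫⁻ s, ENNReal.ofReal (g s ^ 2) = ∫⁻ s, ‖g' s‖ₑ ^ 2 := by
    refine lintegral_congr_ae ?_
    filter_upwards [he] with s hs
    rw [hs, ofReal_sq_eq_enorm]
  calc ∫⁻ y, ENNReal.ofReal ((f (y + z) - f y) ^ 2)
      ≤ ∫⁻ y, ENNReal.ofReal |z| * ∫⁻ s in Set.uIoc 0 z, ‖g' (y + s)‖ₑ ^ 2 :=
        lintegral_mono fun y => hP.sq_sub_le y z
    _ = ENNReal.ofReal |z| * ∫⁻ y, ∫⁻ s in Set.uIoc 0 z, ‖g' (y + s)‖ₑ ^ 2 :=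
        lintegral_const_mul' _ _ ENNReal.ofReal_ne_top
    _ = ENNReal.ofReal |z| * ∫⁻ s in Set.uIoc 0 z, ∫⁻ y, ‖g' (y + s)‖ₑ ^ 2 := by
        rw [lintegral_lintegral_swap (Measurable.aemeasurable (by fun_prop))]
    _ = _ := by
        have : ∀ s, ∫⁻ y, ‖g' (y + s)‖ₑ ^ 2 = ∫⁻ y, ‖g' y‖ₑ ^ 2 := fun s =>
          lintegral_add_right_eq_self (fun y => ‖g' y‖ₑ ^ 2) s
        simp only [this]
        rw [setLIntegral_const, Set.uIoc, Real.volume_Ioc, max_sub_min_eq_abs, e1, sub_zero,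
          ← sq_abs z, pow_two, ENNReal.ofReal_mul (abs_nonneg z)]
        ring

/-- The integral of z² over (-ε, ε) is 2ε³/3, which explains the factor in `boxKernel`. With this
normalization the form is at most the Dirichlet integral, and its symbol is asymptotically that of
-d²/dx². -/
theorem lintegral_boxKernel {ε : ℝ} (hε : 0 < ε) :
    ∫⁻ z, boxKernel ε z * ENNReal.ofReal (z ^ 2) = 1 := by
  have h1 : ∀ z, boxKernel ε z * ENNReal.ofReal (z ^ 2) =
      (Set.Ioc (-ε) ε).indicator (fun z => ENNReal.ofReal (3 / (2 * ε ^ 3) * z ^ 2)) z ∨ z = ε := by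
    intro z
    by_cases hz : |z| < ε
    · left
      have hz' : z ∈ Set.Ioc (-ε) ε := ⟨(abs_lt.mp hz).1, (abs_lt.mp hz).2.le⟩
      rw [Set.indicator_of_mem hz', boxKernel, if_pos hz,
        ← ENNReal.ofReal_mul (by positivity)]
    · by_cases hz' : z = ε
      · exact Or.inr hz'
      · left
        rw [boxKernel, if_neg hz, zero_mul, Set.indicator_of_notMem]
        rintro ⟨a, b⟩
        exact hz (abs_lt.mpr ⟨a, lt_of_le_of_ne b hz'⟩)
  have h2 : ∫⁻ z, boxKernel ε z * ENNReal.ofReal (z ^ 2) =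
      ∫⁻ z in Set.Ioc (-ε) ε, ENNReal.ofReal (3 / (2 * ε ^ 3) * z ^ 2) := by
    rw [← lintegral_indicator measurableSet_Ioc]
    refine lintegral_congr_ae ?_
    have : ∀ᵐ z : ℝ, z ≠ ε := by simp [ae_iff, measure_singleton]
    filter_upwards [this] with z hz
    exact (h1 z).resolve_right hz
  rw [h2, ← ofReal_integral_eq_lintegral_ofReal, ← intervalIntegral.integral_of_le (by linarith),
    intervalIntegral.integral_const_mul, integral_pow]
  · rw [← ENNReal.ofReal_one]
    congr 1
    field_simp
    norm_num
    ring
  · exact (by fun_prop : Continuous fun z : ℝ => 3 / (2 * ε ^ 3) * z ^ 2).integrableOn_Ioc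
  · exact Eventually.of_forall fun z => by positivity

theorem IsPrimitive.kernelForm_boxKernel_le {f g : ℝ → ℝ} (h : IsPrimitive f g) {ε : ℝ}
    (hε : 0 < ε) : kernelForm (boxKernel ε) f ≤ ∫⁻ s, ENNReal.ofReal (g s ^ 2) := by
  rw [kernelForm_eq (isRadial_boxKernel ε).measurable h.continuous.measurable]
  calc _ ≤ ∫⁻ z, boxKernel ε z * (ENNReal.ofReal (z ^ 2) * ∫⁻ s, ENNReal.ofReal (g s ^ 2)) :=
        lintegral_mono fun z => mul_le_mul_right (h.lintegral_sq_sub_le z) _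
    _ = _ := by
      simp only [← mul_assoc]
      have := (isRadial_boxKernel ε).measurable
      rw [lintegral_mul_const _ (by fun_prop), lintegral_boxKernel hε, one_mul]

/-- Plancherel, with the translation acting as a phase and |e^{it} - 1|² = 2 - 2 cos t. -/
theorem lintegral_sq_sub_eq {f : ℝ → ℝ} (hf : MemLp f 2) (z : ℝ) :
    ∫⁻ y, ENNReal.ofReal ((f (y + z) - f y) ^ 2) =
      ∫⁻ ξ, ENNReal.ofReal (2 - 2 * Real.cos (2 * Real.pi * ξ * z)) * ‖ft f ξ‖ₑ ^ 2 := by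
  have hs : MemLp (fun y => f (y + z) - f y) 2 volume := (memLp_comp_add hf z).sub hf
  rw [← lintegral_ft_sq hs]
  refine lintegral_congr_ae ?_
  filter_upwards [ft_sub (memLp_comp_add hf z) hf, ft_comp_add hf z] with ξ a b
  rw [a, b]
  have h1 : ∀ t : ℝ, ENNReal.ofReal (2 - 2 * Real.cos t) =
      ‖Complex.exp (t * Complex.I) - 1‖ₑ ^ 2 := by
    intro t
    rw [← ofReal_norm, ← ENNReal.ofReal_pow (norm_nonneg _), ← Complex.normSq_eq_norm_sq,
      Complex.exp_mul_I, Complex.normSq_apply]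
    congr 1
    simp only [Complex.sub_re, Complex.add_re, Complex.mul_re, Complex.sub_im, Complex.add_im,
      Complex.mul_im, Complex.I_re, Complex.I_im, Complex.one_re, Complex.one_im,
      Complex.cos_ofReal_re, Complex.cos_ofReal_im, Complex.sin_ofReal_re, Complex.sin_ofReal_im]
    linear_combination (-1 : ℝ) * Real.sin_sq_add_cos_sq t
  rw [show 2 * Real.pi * ξ * z = 2 * Real.pi * (z * ξ) by ring, h1, ← mul_pow, ← enorm_mul]
  congr 2
  ring

theorem enorm_ft_measurable (f : ℝ → ℝ) : AEMeasurable (fun ξ => ‖ft f ξ‖ₑ ^ 2) volume :=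
  ((memLp_ft f).1.enorm).pow_const 2

theorem kernelForm_eq_ft {K : ℝ → ℝ≥0∞} (hK : Measurable K) {f : ℝ → ℝ} (hf : MemLp f 2)
    (hm : Measurable f) : kernelForm K f = ∫⁻ ξ,
      (∫⁻ z, K z * ENNReal.ofReal (2 - 2 * Real.cos (2 * Real.pi * ξ * z))) * ‖ft f ξ‖ₑ ^ 2 := by
  rw [kernelForm_eq hK hm]
  obtain ⟨A, hA, hAe⟩ := enorm_ft_measurable f
  have e1 : ∀ z, ∫⁻ y, ENNReal.ofReal ((f (y + z) - f y) ^ 2) =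
      ∫⁻ ξ, ENNReal.ofReal (2 - 2 * Real.cos (2 * Real.pi * ξ * z)) * A ξ := fun z => by
    rw [lintegral_sq_sub_eq hf]
    refine lintegral_congr_ae ?_
    filter_upwards [hAe] with ξ h; rw [h]
  simp only [e1]
  have e2 : ∀ z, K z * ∫⁻ ξ, ENNReal.ofReal (2 - 2 * Real.cos (2 * Real.pi * ξ * z)) * A ξ =
      ∫⁻ ξ, K z * (ENNReal.ofReal (2 - 2 * Real.cos (2 * Real.pi * ξ * z)) * A ξ) := fun z => by
    rw [lintegral_const_mul _ (by fun_prop)]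
  simp only [e2]
  rw [lintegral_lintegral_swap (Measurable.aemeasurable (by fun_prop))]
  refine lintegral_congr_ae ?_
  filter_upwards [hAe] with ξ h
  rw [h, ← lintegral_mul_const _ (by fun_prop)]
  refine lintegral_congr fun z => ?_
  ring

/-- Fatou's lemma in each variable. Only pointwise convergence is needed, which is all the direct
method provides. -/
theorem kernelForm_le_liminf {K : ℝ → ℝ≥0∞} (hK : Measurable K) {f : ℝ → ℝ} {F : ℕ → ℝ → ℝ}
    (hF : ∀ n, Measurable (F n)) (h : ∀ x, Tendsto (fun n => F n x) atTop (𝓝 (f x))) :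
    kernelForm K f ≤ liminf (fun n => kernelForm K (F n)) atTop := by
  have hp : ∀ x y, K (x - y) * ENNReal.ofReal ((f x - f y) ^ 2) ≤
      liminf (fun n => K (x - y) * ENNReal.ofReal ((F n x - F n y) ^ 2)) atTop := by
    intro x y
    -- The kernel may be infinite, and multiplication by ⊤ is continuous only at nonzero limits; a
    -- zero limit makes the left side zero anyway.
    by_cases h0 : f x - f y = 0
    · simp [h0]
    · refine (Tendsto.liminf_eq ?_).ge
      refine ENNReal.Tendsto.const_mul ?_ (Or.inl ?_)
      · exact ENNReal.tendsto_ofReal (((h x).sub (h y)).pow 2)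
      · simpa using h0
  have hm := fun n => measurable_kernel_integrand hK (hF n)
  calc kernelForm K f
      ≤ ∫⁻ x, ∫⁻ y, liminf (fun n => K (x - y) * ENNReal.ofReal ((F n x - F n y) ^ 2)) atTop :=
        lintegral_mono fun x => lintegral_mono fun y => hp x y
    _ ≤ ∫⁻ x, liminf (fun n => ∫⁻ y, K (x - y) * ENNReal.ofReal ((F n x - F n y) ^ 2)) atTop :=
        lintegral_mono fun x => lintegral_liminf_le fun n =>
          (hm n).comp measurable_prodMk_left
    _ ≤ _ := lintegral_liminf_le fun n => (hm n).lintegral_prod_right'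

/-- Fourier symbol of the box kernel tends to that of `-d²/dx²`. -/
theorem le_liminf_symbol (ξ : ℝ) : ENNReal.ofReal ((2 * Real.pi * ξ) ^ 2) ≤
    liminf (fun n : ℕ => ∫⁻ z, boxKernel (1 / (n + 1)) z *
      ENNReal.ofReal (2 - 2 * Real.cos (2 * Real.pi * ξ * z))) atTop := by
  set s := 2 * Real.pi * ξ
  have hε : Tendsto (fun n : ℕ => (1 / ((n : ℝ) + 1))) atTop (𝓝 0) :=
    tendsto_one_div_add_atTop_nhds_zero_nat
  have hlim : Tendsto (fun n : ℕ => ENNReal.ofReal (s ^ 2 - s ^ 4 * (1 / ((n : ℝ) + 1)) ^ 2))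
      atTop (𝓝 (ENNReal.ofReal (s ^ 2))) := by
    refine ENNReal.tendsto_ofReal ?_
    simpa using (hε.pow 2).const_mul (s ^ 4) |>.const_sub (s ^ 2)
  rw [← hlim.liminf_eq]
  refine liminf_le_liminf ?_
  have hsmall : ∀ᶠ n : ℕ in atTop, |s| * (1 / ((n : ℝ) + 1)) < 1 := by
    have := hε.const_mul |s|
    rw [mul_zero] at this
    exact this.eventually_lt_const one_pos
  filter_upwards [hsmall] with n hn
  set ε : ℝ := 1 / ((n : ℝ) + 1)
  have hε0 : 0 < ε := by positivity
  -- The fourth-order Taylor bound for cosine on |sz| ≤ 1 gives 2 - 2 cos(sz) ≥ z² (s² - s⁴ε²) for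
  -- |z| < ε; the normalization of the kernel then integrates the factor z² to one.
  have hb : ∀ z, boxKernel ε z * ENNReal.ofReal (z ^ 2) * ENNReal.ofReal (s ^ 2 - s ^ 4 * ε ^ 2) ≤
      boxKernel ε z * ENNReal.ofReal (2 - 2 * Real.cos (s * z)) := by
    intro z
    by_cases hz : |z| < ε
    · rw [mul_assoc, ← ENNReal.ofReal_mul (sq_nonneg z)]
      refine mul_le_mul_right (ENNReal.ofReal_le_ofReal ?_) _
      have h1 : |s * z| ≤ 1 := by
        rw [abs_mul]
        exact (mul_le_mul_of_nonneg_left hz.le (abs_nonneg s)).trans hn.le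
      have h2 := (abs_le.mp (Real.cos_bound h1)).2
      have h3 : |s * z| ^ 4 = s ^ 4 * z ^ 2 * z ^ 2 := by
        rw [show |s * z| ^ 4 = (|s * z| ^ 2) ^ 2 by ring, sq_abs]; ring
      have h4 : z ^ 2 ≤ ε ^ 2 := sq_le_sq' (by linarith [(abs_lt.mp hz).1]) (abs_lt.mp hz).2.le
      have h5 : s ^ 4 * z ^ 2 * z ^ 2 ≤ s ^ 4 * z ^ 2 * ε ^ 2 :=
        mul_le_mul_of_nonneg_left h4 (by positivity)
      have h6 : 0 ≤ s ^ 4 * z ^ 2 * ε ^ 2 := by positivity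
      rw [h3] at h2
      nlinarith
    · simp [boxKernel, if_neg hz]
  calc ENNReal.ofReal (s ^ 2 - s ^ 4 * ε ^ 2)
      = ∫⁻ z, boxKernel ε z * ENNReal.ofReal (z ^ 2) * ENNReal.ofReal (s ^ 2 - s ^ 4 * ε ^ 2) := by
        have := (isRadial_boxKernel ε).measurable
        rw [lintegral_mul_const _ (by fun_prop), lintegral_boxKernel hε0, one_mul]
    _ ≤ _ := lintegral_mono hb

/-- A square integrable function with bounded box forms is weakly differentiable. -/
theorem exists_weakDeriv_of_boxKernel_le {f : ℝ → ℝ} (hf : MemLp f 2) (hm : Measurable f)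
    {M : ℝ≥0∞} (hM : M ≠ ⊤) (h : ∀ n : ℕ, kernelForm (boxKernel (1 / (n + 1))) f ≤ M) :
    ∃ g, IsWeakDeriv f g ∧ MemLp g 2 ∧ ∫⁻ x, ENNReal.ofReal (g x ^ 2) ≤ M := by
  obtain ⟨A, hA, hAe⟩ := enorm_ft_measurable f
  -- Fatou's lemma in frequency: the box symbols are asymptotically at least (2πξ)², while each box
  -- form is bounded by `M`.
  have h1 : ∫⁻ ξ, ENNReal.ofReal ((2 * Real.pi * ξ) ^ 2) * ‖ft f ξ‖ₑ ^ 2 ≤ M := by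
    calc ∫⁻ ξ, ENNReal.ofReal ((2 * Real.pi * ξ) ^ 2) * ‖ft f ξ‖ₑ ^ 2
        ≤ ∫⁻ ξ, liminf (fun n : ℕ => (∫⁻ z, boxKernel (1 / (n + 1)) z *
            ENNReal.ofReal (2 - 2 * Real.cos (2 * Real.pi * ξ * z))) * A ξ) atTop := by
          refine lintegral_mono_ae ?_
          filter_upwards [hAe] with ξ hξ
          rw [hξ]
          have hfin : A ξ ≠ ⊤ := by rw [← hξ]; exact ENNReal.pow_ne_top enorm_ne_top
          have := ENNReal.liminf_mul_const_of_ne_top (u := fun n : ℕ => ∫⁻ z,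
            boxKernel (1 / (n + 1)) z *
            ENNReal.ofReal (2 - 2 * Real.cos (2 * Real.pi * ξ * z))) (f := atTop) hfin
          rw [this, mul_comm (A ξ)]
          exact mul_le_mul_left (le_liminf_symbol ξ) _
      _ ≤ liminf (fun n : ℕ => ∫⁻ ξ, (∫⁻ z, boxKernel (1 / (n + 1)) z *
            ENNReal.ofReal (2 - 2 * Real.cos (2 * Real.pi * ξ * z))) * A ξ) atTop := by
          refine lintegral_liminf_le fun n => ?_
          have := (isRadial_boxKernel (1 / ((n : ℝ) + 1))).measurable
          refine Measurable.mul ?_ hA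
          exact Measurable.lintegral_prod_right' (f := fun p : ℝ × ℝ => boxKernel (1 / (n + 1)) p.2 *
            ENNReal.ofReal (2 - 2 * Real.cos (2 * Real.pi * p.1 * p.2))) (by fun_prop)
      _ ≤ M := by
          refine liminf_le_of_frequently_le' (Frequently.of_forall fun n => ?_)
          refine le_trans (le_of_eq ?_) (h n)
          rw [kernelForm_eq_ft (isRadial_boxKernel _).measurable hf hm]
          refine lintegral_congr_ae ?_
          filter_upwards [hAe] with ξ hξ; rw [hξ]
  have e : ∀ ξ : ℝ, ‖2 * Real.pi * Complex.I * ξ * ft f ξ‖ₑ ^ 2 =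
      ENNReal.ofReal ((2 * Real.pi * ξ) ^ 2) * ‖ft f ξ‖ₑ ^ 2 := by
    intro ξ
    rw [enorm_mul, mul_pow, ofReal_sq_eq_enorm, ← ofReal_norm, ← ofReal_norm (2 * Real.pi * ξ)]
    simp
  have hG : MemLp (fun ξ : ℝ => 2 * Real.pi * Complex.I * ξ * ft f ξ) 2 volume := by
    refine ⟨(Continuous.aestronglyMeasurable (by fun_prop)).mul (memLp_ft f).1, ?_⟩
    rw [eLpNorm_lt_top_iff_lintegral_rpow_enorm_lt_top (by norm_num) (by norm_num)]
    simp only [ENNReal.toReal_ofNat, ENNReal.rpow_ofNat, e]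
    exact h1.trans_lt hM.lt_top
  obtain ⟨g, hg, hge⟩ := exists_ft_eq hG (by
    filter_upwards [ft_neg_apply hf] with ξ hξ
    rw [map_mul, ← hξ]
    simp [Complex.conj_ofNat])
  refine ⟨g, isWeakDeriv_of_ft hf hg hge, hg, ?_⟩
  rw [← lintegral_ft_sq hg]
  refine le_trans (le_of_eq (lintegral_congr_ae ?_)) h1
  filter_upwards [hge] with ξ hξ
  rw [hξ, e]

/-- The normalizing constant of the `H^{1/2}` seminorm. -/
noncomputable def gagliardoConst : ℝ≥0∞ :=
  ∫⁻ z, invSq z * ENNReal.ofReal (2 - 2 * Real.cos z)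

/-- Only the finiteness and the nonvanishing of the constant are used, since the energy is divided
by it; its value plays no role. -/
theorem gagliardoConst_ne_top : gagliardoConst ≠ ⊤ := by
  -- The 5 comes from 2 - 2 cos z ≤ min(z², 4), whence (1 + z²)(2 - 2 cos z) ≤ 5z². At z = 0 the
  -- kernel is ⊤, but it multiplies zero.
  have h : ∀ z : ℝ, invSq z * ENNReal.ofReal (2 - 2 * Real.cos z) ≤
      ENNReal.ofReal (5 * (1 + z ^ 2)⁻¹) := by
    intro z
    by_cases hz : z = 0
    · simp [hz]
    · have hz2 : 0 < z ^ 2 := by positivity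
      rw [invSq, ← ENNReal.ofReal_inv_of_pos hz2, ← ENNReal.ofReal_mul (by positivity)]
      refine ENNReal.ofReal_le_ofReal ?_
      rw [inv_mul_le_iff₀ hz2, ← mul_assoc, le_mul_inv_iff₀ (by positivity)]
      have h1 := Real.one_sub_sq_div_two_le_cos (x := z)
      have h2 := Real.neg_one_le_cos z
      have h3 := Real.cos_le_one z
      nlinarith
  refine ((lintegral_mono h).trans_lt ?_).ne
  exact (integrable_inv_one_add_sq.const_mul 5).lintegral_lt_top

theorem gagliardoConst_ne_zero : gagliardoConst ≠ 0 := by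
  have h : ∀ z ∈ Set.Ioc (1:ℝ) 2, ENNReal.ofReal ((2 - 2 * Real.cos 1) / 4) ≤
      invSq z * ENNReal.ofReal (2 - 2 * Real.cos z) := by
    intro z hz
    have hz2 : 0 < z ^ 2 := by nlinarith [hz.1]
    rw [invSq, ← ENNReal.ofReal_inv_of_pos hz2, ← ENNReal.ofReal_mul (by positivity)]
    refine ENNReal.ofReal_le_ofReal ?_
    rw [le_inv_mul_iff₀ hz2]
    have h1 : Real.cos z ≤ Real.cos 1 := Real.cos_le_cos_of_nonneg_of_le_pi (by norm_num)
      (by linarith [Real.pi_gt_three, hz.2]) hz.1.le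
    have h2 : z ^ 2 ≤ 4 := by nlinarith [hz.1, hz.2]
    have h3 := Real.cos_le_one 1
    nlinarith
  have hpos : 0 < ENNReal.ofReal ((2 - 2 * Real.cos 1) / 4) := by
    rw [ENNReal.ofReal_pos]
    have := Real.cos_one_le
    linarith
  have h2 : ENNReal.ofReal ((2 - 2 * Real.cos 1) / 4) ≤ gagliardoConst := by
    calc ENNReal.ofReal ((2 - 2 * Real.cos 1) / 4)
        = ∫⁻ z in Set.Ioc (1:ℝ) 2, ENNReal.ofReal ((2 - 2 * Real.cos 1) / 4) := by
          rw [setLIntegral_const, Real.volume_Ioc]; norm_num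
      _ ≤ ∫⁻ z in Set.Ioc (1:ℝ) 2, invSq z * ENNReal.ofReal (2 - 2 * Real.cos z) :=
          setLIntegral_mono' measurableSet_Ioc h
      _ ≤ gagliardoConst := setLIntegral_le_lintegral _ _
  exact (hpos.trans_le h2).ne'

/-- The kernel is homogeneous of degree -2, so substituting sz leaves one factor |s|: this is how
the symbol |k| arises. -/
theorem lintegral_invSq_scaled (s : ℝ) :
    ∫⁻ z, invSq z * ENNReal.ofReal (2 - 2 * Real.cos (s * z)) =
      gagliardoConst * ENNReal.ofReal |s| := by
  by_cases hs : s = 0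
  · simp [hs]
  · have hmap := Real.smul_map_volume_mul_left hs
    have hm : Measurable fun z : ℝ => invSq z * ENNReal.ofReal (2 - 2 * Real.cos z) := by
      have := isRadial_invSq.measurable
      fun_prop
    have hi : ∀ z, invSq z * ENNReal.ofReal (2 - 2 * Real.cos (s * z)) =
        ENNReal.ofReal (s ^ 2) * (invSq (s * z) * ENNReal.ofReal (2 - 2 * Real.cos (s * z))) := by
      intro z
      rw [← mul_assoc]
      congr 1
      have h1 : ENNReal.ofReal (s ^ 2) ≠ 0 := by
        rw [Ne, ENNReal.ofReal_eq_zero, not_le]; positivity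
      rw [invSq, invSq, mul_pow, ENNReal.ofReal_mul (sq_nonneg s),
        ENNReal.mul_inv (Or.inl h1) (Or.inl ENNReal.ofReal_ne_top), ← mul_assoc,
        ENNReal.mul_inv_cancel h1 ENNReal.ofReal_ne_top, one_mul]
    have h2 : gagliardoConst = ENNReal.ofReal |s| *
        ∫⁻ z, invSq (s * z) * ENNReal.ofReal (2 - 2 * Real.cos (s * z)) := by
      rw [gagliardoConst]
      conv_lhs => rw [← hmap]
      rw [lintegral_smul_measure, lintegral_map hm (by fun_prop), smul_eq_mul]
    simp only [hi]
    rw [lintegral_const_mul' _ _ ENNReal.ofReal_ne_top, h2, ← sq_abs,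
      ENNReal.ofReal_pow (abs_nonneg s)]
    ring

theorem kernelForm_invSq_eq {f : ℝ → ℝ} (hf : MemLp f 2) (hm : Measurable f) :
    kernelForm invSq f =
      gagliardoConst * ∫⁻ ξ, ENNReal.ofReal |2 * Real.pi * ξ| * ‖ft f ξ‖ₑ ^ 2 := by
  rw [kernelForm_eq_ft isRadial_invSq.measurable hf hm]
  simp only [lintegral_invSq_scaled]
  rw [← lintegral_const_mul' _ _ gagliardoConst_ne_top]
  simp only [mul_assoc]

theorem HalfLap.kernelForm_invSq {u v : ℝ → ℝ} (h : HalfLap u v) (hm : Measurable u) :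
    kernelForm invSq u = gagliardoConst * ENNReal.ofReal (∫ x, u x * v x) := by
  rw [kernelForm_invSq_eq h.1 hm, h.ofReal_integral_mul]

end NeelWall

/-! ### Midpoint convexity of kernel forms in the sine variable. -/

namespace NeelWall

open scoped ENNReal

/-- Joint convexity of the squared distance in the `arcsin` metric, at midpoints. -/
theorem sq_arcsin_midpoint_sub_le {a b c d : ℝ} (ha : a ∈ Set.Icc (-(Real.pi / 2)) (Real.pi / 2))
    (hb : b ∈ Set.Icc (-(Real.pi / 2)) (Real.pi / 2))
    (hc : c ∈ Set.Icc (-(Real.pi / 2)) (Real.pi / 2))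
    (hd : d ∈ Set.Icc (-(Real.pi / 2)) (Real.pi / 2)) :
    (Real.arcsin ((Real.sin a + Real.sin b) / 2) - Real.arcsin ((Real.sin c + Real.sin d) / 2)) ^ 2
      ≤ ((a - c) ^ 2 + (b - d) ^ 2) / 2 := by
  by_cases htriv : a = c ∧ b = d
  · obtain ⟨rfl, rfl⟩ := htriv; simp
  -- Move linearly from (a, b) to (c, d) and apply the mean value theorem to the arcsine of the mean
  -- of the two sines: it suffices to bound the speed of this curve.
  set p : ℝ → ℝ := fun s => a + s * (c - a)
  set q : ℝ → ℝ := fun s => b + s * (d - b)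
  set m : ℝ → ℝ := fun s => (Real.sin (p s) + Real.sin (q s)) / 2
  have hp : ∀ s, HasDerivAt p (c - a) s := fun s => by
    simpa only [id, one_mul] using ((hasDerivAt_id s).mul_const (c - a)).const_add a
  have hq : ∀ s, HasDerivAt q (d - b) s := fun s => by
    simpa only [id, one_mul] using ((hasDerivAt_id s).mul_const (d - b)).const_add b
  have hm : ∀ s, HasDerivAt m ((Real.cos (p s) * (c - a) + Real.cos (q s) * (d - b)) / 2) s :=
    fun s => (((hp s).sin).add ((hq s).sin)).div_const 2
  have hpm : ∀ s ∈ Set.Ioo (0:ℝ) 1, p s ∈ Set.Icc (-(Real.pi / 2)) (Real.pi / 2) := by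
    rintro s ⟨h0, h1⟩
    have e : p s = (1 - s) * a + s * c := by simp only [p]; ring
    rw [e]
    constructor <;> nlinarith [ha.1, ha.2, hc.1, hc.2]
  have hqm : ∀ s ∈ Set.Ioo (0:ℝ) 1, q s ∈ Set.Icc (-(Real.pi / 2)) (Real.pi / 2) := by
    rintro s ⟨h0, h1⟩
    have e : q s = (1 - s) * b + s * d := by simp only [q]; ring
    rw [e]
    constructor <;> nlinarith [hb.1, hb.2, hd.1, hd.2]
  have hext : ∀ {x y s : ℝ}, s ∈ Set.Ioo (0:ℝ) 1 → x ≤ Real.pi / 2 → y ≤ Real.pi / 2 →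
      x + s * (y - x) = Real.pi / 2 → x = Real.pi / 2 ∧ y = Real.pi / 2 := by
    rintro x y s ⟨h0, h1⟩ hx hy he
    constructor <;> nlinarith
  have hext' : ∀ {x y s : ℝ}, s ∈ Set.Ioo (0:ℝ) 1 → -(Real.pi / 2) ≤ x → -(Real.pi / 2) ≤ y →
      x + s * (y - x) = -(Real.pi / 2) → x = -(Real.pi / 2) ∧ y = -(Real.pi / 2) := by
    rintro x y s ⟨h0, h1⟩ hx hy he
    constructor <;> nlinarith
  -- The arcsine is not differentiable at ±1. The mean reaches 1 only if both angles are π/2, and an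
  -- interior point of a segment can be extremal only if both endpoints are, which is the excluded
  -- trivial case.
  have hm1 : ∀ s ∈ Set.Ioo (0:ℝ) 1, m s ≠ 1 := by
    intro s hs h1
    have e1 := Real.sin_le_one (p s)
    have e2 := Real.sin_le_one (q s)
    have e3 : Real.sin (p s) = 1 := by simp only [m] at h1; linarith
    have e4 : Real.sin (q s) = 1 := by simp only [m] at h1; linarith
    have e5 : p s = Real.pi / 2 := by
      rw [← Real.arcsin_sin (hpm s hs).1 (hpm s hs).2, e3, Real.arcsin_one]
    have e6 : q s = Real.pi / 2 := by
      rw [← Real.arcsin_sin (hqm s hs).1 (hqm s hs).2, e4, Real.arcsin_one]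
    have f1 := hext hs ha.2 hc.2 e5
    have f2 := hext hs hb.2 hd.2 e6
    exact htriv ⟨f1.1.trans f1.2.symm, f2.1.trans f2.2.symm⟩
  have hm2 : ∀ s ∈ Set.Ioo (0:ℝ) 1, m s ≠ -1 := by
    intro s hs h1
    have e1 := Real.neg_one_le_sin (p s)
    have e2 := Real.neg_one_le_sin (q s)
    have e3 : Real.sin (p s) = -1 := by simp only [m] at h1; linarith
    have e4 : Real.sin (q s) = -1 := by simp only [m] at h1; linarith
    have e5 : p s = -(Real.pi / 2) := by
      rw [← Real.arcsin_sin (hpm s hs).1 (hpm s hs).2, e3, Real.arcsin_neg_one]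
    have e6 : q s = -(Real.pi / 2) := by
      rw [← Real.arcsin_sin (hqm s hs).1 (hqm s hs).2, e4, Real.arcsin_neg_one]
    have f1 := hext' hs ha.1 hc.1 e5
    have f2 := hext' hs hb.1 hd.1 e6
    exact htriv ⟨f1.1.trans f1.2.symm, f2.1.trans f2.2.symm⟩
  have hF : ∀ s ∈ Set.Ioo (0:ℝ) 1, HasDerivAt (fun s => Real.arcsin (m s))
      (1 / √(1 - m s ^ 2) * ((Real.cos (p s) * (c - a) + Real.cos (q s) * (d - b)) / 2)) s :=
    fun s hs => (Real.hasDerivAt_arcsin (hm2 s hs) (hm1 s hs)).comp s (hm s)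
  have hcont : Continuous fun s => Real.arcsin (m s) :=
    Real.continuous_arcsin.comp (continuous_iff_continuousAt.mpr fun s => (hm s).continuousAt)
  obtain ⟨s, hs, he⟩ := exists_hasDerivAt_eq_slope (fun s => Real.arcsin (m s)) _ one_pos
    hcont.continuousOn hF
  have e0 : m 0 = (Real.sin a + Real.sin b) / 2 := by simp [m, p, q]
  have e1 : m 1 = (Real.sin c + Real.sin d) / 2 := by simp [m, p, q]
  rw [e0, e1, sub_zero, div_one] at he
  have hpos : 0 < 1 - m s ^ 2 := by
    have h1 : m s < 1 := lt_of_le_of_ne (by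
      have e1 := Real.sin_le_one (p s)
      have e2 := Real.sin_le_one (q s)
      simp only [m]; linarith) (hm1 s hs)
    have h2 : -1 < m s := lt_of_le_of_ne (by
      have e1 := Real.neg_one_le_sin (p s)
      have e2 := Real.neg_one_le_sin (q s)
      simp only [m]; linarith) (hm2 s hs).symm
    nlinarith
  rw [← neg_sub, neg_sq, ← he, mul_pow, div_pow, one_pow, Real.sq_sqrt hpos.le, one_div,
    inv_mul_le_iff₀ hpos]
  have hs1 := Real.sin_sq_add_cos_sq (p s)
  have hs2 := Real.sin_sq_add_cos_sq (q s)
  simp only [m] at hpos ⊢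
  set P := Real.cos (p s)
  set Q := Real.cos (q s)
  set S := Real.sin (p s)
  set T := Real.sin (q s)
  -- Concavity of 1 - u² at the mean of the sines. With Cauchy–Schwarz for the numerator it is the
  -- convexity of u'² / (1 - u²).
  have hkey : (P ^ 2 + Q ^ 2) / 2 ≤ 1 - ((S + T) / 2) ^ 2 := by nlinarith [sq_nonneg (S - T)]
  have hcs : ((P * (c - a) + Q * (d - b)) / 2) ^ 2 ≤
      (P ^ 2 + Q ^ 2) / 2 * (((a - c) ^ 2 + (b - d) ^ 2) / 2) := by
    nlinarith [sq_nonneg (P * (d - b) - Q * (c - a))]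
  exact hcs.trans (mul_le_mul_of_nonneg_right hkey (by positivity))

theorem lintegral_lintegral_add {P Q : ℝ → ℝ → ℝ≥0∞}
    (hP : Measurable fun p : ℝ × ℝ => P p.1 p.2) :
    ∫⁻ x, ∫⁻ y, P x y + Q x y = (∫⁻ x, ∫⁻ y, P x y) + ∫⁻ x, ∫⁻ y, Q x y := by
  have h1 : Measurable fun x => ∫⁻ y, P x y := hP.lintegral_prod_right'
  rw [← lintegral_add_left h1]
  refine lintegral_congr fun x => ?_
  have h2 : Measurable fun y => P x y := hP.comp measurable_prodMk_left
  rw [lintegral_add_left h2]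

theorem kernelForm_midpoint_le {K : ℝ → ℝ≥0∞} (hK : Measurable K) {A f g : ℝ → ℝ}
    (hf : Measurable f) (hg : Measurable g)
    (h : ∀ x y, (A x - A y) ^ 2 ≤ ((f x - f y) ^ 2 + (g x - g y) ^ 2) / 2) :
    kernelForm K A ≤ 2⁻¹ * (kernelForm K f + kernelForm K g) := by
  have hmf := measurable_kernel_integrand hK hf
  have hmg := measurable_kernel_integrand hK hg
  have e : kernelForm K f + kernelForm K g = ∫⁻ x, ∫⁻ y,
      (K (x - y) * ENNReal.ofReal ((f x - f y) ^ 2) +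
        K (x - y) * ENNReal.ofReal ((g x - g y) ^ 2)) := by
    exact (lintegral_lintegral_add hmf).symm
  rw [e, ← lintegral_const_mul' _ _ (by simp)]
  refine lintegral_mono fun x => ?_
  rw [← lintegral_const_mul' _ _ (by simp)]
  refine lintegral_mono fun y => ?_
  have : ENNReal.ofReal ((A x - A y) ^ 2) ≤
      2⁻¹ * (ENNReal.ofReal ((f x - f y) ^ 2) + ENNReal.ofReal ((g x - g y) ^ 2)) := by
    rw [← ENNReal.ofReal_add (sq_nonneg _) (sq_nonneg _),
      show (2⁻¹ : ℝ≥0∞) = ENNReal.ofReal 2⁻¹ by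
        rw [ENNReal.ofReal_inv_of_pos (by norm_num)]; norm_num,
      ← ENNReal.ofReal_mul (by norm_num)]
    refine ENNReal.ofReal_le_ofReal ((h x y).trans (le_of_eq ?_))
    ring
  refine (mul_le_mul_right this _).trans (le_of_eq ?_)
  ring

/-! ### Two-point symmetrization. -/

/-- Two-point symmetrization with respect to `a`, favouring `(-∞, a]`. -/
noncomputable def polarize (a : ℝ) (f : ℝ → ℝ) (x : ℝ) : ℝ :=
  if x ≤ a then max (f x) (f (2 * a - x)) else min (f x) (f (2 * a - x))

/-- With the sum of the two quantities fixed, the weighted sum is k₂ times that sum plus k₁ - k₂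
times the first quantity; so lowering the first lowers the total. -/
theorem ennreal_weighted_le {k₁ k₂ : ℝ≥0∞} (hk : k₂ ≤ k₁) {A B A' B' : ℝ} (hA : 0 ≤ A)
    (hB : 0 ≤ B) (hA' : 0 ≤ A') (hB' : 0 ≤ B') (hs : A + B = A' + B') (hle : A ≤ A') :
    k₁ * ENNReal.ofReal A + k₂ * ENNReal.ofReal B ≤
      k₁ * ENNReal.ofReal A' + k₂ * ENNReal.ofReal B' := by
  obtain ⟨d, rfl⟩ := le_iff_exists_add.mp hk
  have h1 : ENNReal.ofReal A + ENNReal.ofReal B = ENNReal.ofReal A' + ENNReal.ofReal B' := by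
    rw [← ENNReal.ofReal_add hA hB, ← ENNReal.ofReal_add hA' hB', hs]
  calc (k₂ + d) * ENNReal.ofReal A + k₂ * ENNReal.ofReal B
      = k₂ * (ENNReal.ofReal A + ENNReal.ofReal B) + d * ENNReal.ofReal A := by ring
    _ ≤ k₂ * (ENNReal.ofReal A' + ENNReal.ofReal B') + d * ENNReal.ofReal A' := by
        rw [h1]
        exact add_le_add le_rfl (mul_le_mul_right (ENNReal.ofReal_le_ofReal hle) _)
    _ = _ := by ring

/-- The integrand of `kernelForm` symmetrized under the reflections `x ↦ 2a - x`. -/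
noncomputable def reflectedIntegrand (K : ℝ → ℝ≥0∞) (a : ℝ) (f : ℝ → ℝ) (x y : ℝ) : ℝ≥0∞ :=
  K (x - y) * ENNReal.ofReal ((f x - f y) ^ 2 + (f (2 * a - x) - f (2 * a - y)) ^ 2) +
    K (x - (2 * a - y)) *
      ENNReal.ofReal ((f x - f (2 * a - y)) ^ 2 + (f (2 * a - x) - f y) ^ 2)

theorem kernelForm_eq_reflected {K : ℝ → ℝ≥0∞} (hK : IsRadial K) (a : ℝ) {f : ℝ → ℝ}
    (hf : Measurable f) : 4 * kernelForm K f = ∫⁻ x, ∫⁻ y, reflectedIntegrand K a f x y := by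
  have hKm := hK.measurable
  have e2 : kernelForm K f = ∫⁻ x, ∫⁻ y, K (x - y) *
      ENNReal.ofReal ((f (2 * a - x) - f (2 * a - y)) ^ 2) := by
    unfold kernelForm
    rw [← lintegral_sub_left_eq_self _ (2 * a)]
    refine lintegral_congr fun x => ?_
    rw [← lintegral_sub_left_eq_self _ (2 * a)]
    refine lintegral_congr fun y => ?_
    rw [← hK.neg (x - y)]
    congr 2; ring
  have e3 : kernelForm K f = ∫⁻ x, ∫⁻ y, K (x - (2 * a - y)) *
      ENNReal.ofReal ((f x - f (2 * a - y)) ^ 2) := by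
    unfold kernelForm
    refine lintegral_congr fun x => ?_
    rw [← lintegral_sub_left_eq_self _ (2 * a)]
  have e4 : kernelForm K f = ∫⁻ x, ∫⁻ y, K (x - (2 * a - y)) *
      ENNReal.ofReal ((f (2 * a - x) - f y) ^ 2) := by
    unfold kernelForm
    rw [← lintegral_sub_left_eq_self _ (2 * a)]
    refine lintegral_congr fun x => lintegral_congr fun y => ?_
    rw [← hK.neg (x - (2 * a - y))]
    congr 2; ring
  have h4 : 4 * kernelForm K f = kernelForm K f + kernelForm K f +
      (kernelForm K f + kernelForm K f) := by ring
  rw [h4]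
  nth_rewrite 2 [e2]
  nth_rewrite 2 [e3]
  nth_rewrite 2 [e4]
  unfold kernelForm
  have m1 : Measurable fun p : ℝ × ℝ => K (p.1 - p.2) * ENNReal.ofReal ((f p.1 - f p.2) ^ 2) := by
    fun_prop
  have m2 : Measurable fun p : ℝ × ℝ => K (p.1 - p.2) *
      ENNReal.ofReal ((f (2 * a - p.1) - f (2 * a - p.2)) ^ 2) := by fun_prop
  have m3 : Measurable fun p : ℝ × ℝ => K (p.1 - (2 * a - p.2)) *
      ENNReal.ofReal ((f p.1 - f (2 * a - p.2)) ^ 2) := by fun_prop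
  have m12 := m1.add m2
  have a1 := lintegral_lintegral_add (P := fun x y => K (x - y) * ENNReal.ofReal ((f x - f y) ^ 2))
    (Q := fun x y => K (x - y) *
      ENNReal.ofReal ((f (2 * a - x) - f (2 * a - y)) ^ 2)) m1
  have a2 := lintegral_lintegral_add (P := fun x y => K (x - (2 * a - y)) *
      ENNReal.ofReal ((f x - f (2 * a - y)) ^ 2)) (Q := fun x y => K (x - (2 * a - y)) *
      ENNReal.ofReal ((f (2 * a - x) - f y) ^ 2)) m3
  have a3 := lintegral_lintegral_add (P := fun x y => K (x - y) * ENNReal.ofReal ((f x - f y) ^ 2) +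
    K (x - y) * ENNReal.ofReal ((f (2 * a - x) - f (2 * a - y)) ^ 2))
    (Q := fun x y => K (x - (2 * a - y)) * ENNReal.ofReal ((f x - f (2 * a - y)) ^ 2) +
      K (x - (2 * a - y)) * ENNReal.ofReal ((f (2 * a - x) - f y) ^ 2)) m12
  rw [← a1, ← a2, ← a3]
  refine lintegral_congr fun x => lintegral_congr fun y => ?_
  unfold reflectedIntegrand
  rw [ENNReal.ofReal_add (sq_nonneg _) (sq_nonneg _), ENNReal.ofReal_add (sq_nonneg _) (sq_nonneg _),
    mul_add, mul_add]

theorem sq_max_sub_max_add_le (p p' q q' : ℝ) :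
    (max p p' - max q q') ^ 2 + (min p p' - min q q') ^ 2 ≤ (p - q) ^ 2 + (p' - q') ^ 2 := by
  rcases le_total p p' with h1 | h1 <;> rcases le_total q q' with h2 | h2 <;>
    simp only [max_eq_left, max_eq_right, min_eq_left, min_eq_right, h1, h2] <;>
    nlinarith [mul_nonneg (sub_nonneg.mpr h1) (sub_nonneg.mpr h2)]

theorem sq_max_sub_min_sum (p p' q q' : ℝ) :
    (max p p' - max q q') ^ 2 + (min p p' - min q q') ^ 2 +
      ((max p p' - min q q') ^ 2 + (min p p' - max q q') ^ 2) =
    (p - q) ^ 2 + (p' - q') ^ 2 + ((p - q') ^ 2 + (p' - q) ^ 2) := by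
  rcases le_total p p' with h1 | h1 <;> rcases le_total q q' with h2 | h2 <;>
    simp only [max_eq_left, max_eq_right, min_eq_left, min_eq_right, h1, h2] <;> ring

theorem polarize_of_le {a x : ℝ} (f : ℝ → ℝ) (h : x ≤ a) :
    polarize a f x = max (f x) (f (2 * a - x)) ∧
      polarize a f (2 * a - x) = min (f x) (f (2 * a - x)) := by
  refine ⟨if_pos h, ?_⟩
  rcases eq_or_lt_of_le h with rfl | h
  · have : 2 * x - x = x := by ring
    simp [polarize, this]
  · rw [polarize, if_neg (by linarith)]
    have : 2 * a - (2 * a - x) = x := by ring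
    rw [this, min_comm]

theorem polarize_of_ge {a x : ℝ} (f : ℝ → ℝ) (h : a ≤ x) :
    polarize a f x = min (f x) (f (2 * a - x)) ∧
      polarize a f (2 * a - x) = max (f x) (f (2 * a - x)) := by
  have h' : 2 * a - x ≤ a := by linarith
  have := polarize_of_le f h'
  have e : 2 * a - (2 * a - x) = x := by ring
  rw [e] at this
  exact ⟨this.2.trans (min_comm _ _), this.1.trans (max_comm _ _)⟩

/-- On the pairs formed from x, y and their reflections, the total of the squared differences does
not change, while matching larger values with larger ones lowers the same-side differences.
Same-side points are closer together, so the radial kernel gives these the larger weight. -/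
theorem reflectedIntegrand_polarize_le {K : ℝ → ℝ≥0∞} (hK : IsRadial K) (a : ℝ) (f : ℝ → ℝ)
    (x y : ℝ) : reflectedIntegrand K a (polarize a f) x y ≤ reflectedIntegrand K a f x y := by
  unfold reflectedIntegrand
  have key := sq_max_sub_max_add_le (f x) (f (2 * a - x)) (f y) (f (2 * a - y))
  have key' := sq_max_sub_max_add_le (f x) (f (2 * a - x)) (f (2 * a - y)) (f y)
  have hsum := sq_max_sub_min_sum (f x) (f (2 * a - x)) (f y) (f (2 * a - y))
  rw [max_comm (f (2 * a - y)), min_comm (f (2 * a - y))] at key'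
  rcases le_total x a with hx | hx <;> rcases le_total y a with hy | hy
  · rw [(polarize_of_le f hx).1, (polarize_of_le f hx).2, (polarize_of_le f hy).1,
      (polarize_of_le f hy).2]
    refine ennreal_weighted_le (hK.anti _ _ ?_) (by positivity) (by positivity) (by positivity)
      (by positivity) hsum key
    rw [← sq_le_sq]; nlinarith
  · rw [(polarize_of_le f hx).1, (polarize_of_le f hx).2, (polarize_of_ge f hy).1,
      (polarize_of_ge f hy).2, add_comm, add_comm (K (x - y) * _)]
    refine ennreal_weighted_le (hK.anti _ _ ?_) (by positivity) (by positivity) (by positivity)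
      (by positivity) (by linarith) key'
    rw [← sq_le_sq]; nlinarith
  · rw [(polarize_of_ge f hx).1, (polarize_of_ge f hx).2, (polarize_of_le f hy).1,
      (polarize_of_le f hy).2, add_comm, add_comm (K (x - y) * _)]
    refine ennreal_weighted_le (hK.anti _ _ ?_) (by positivity) (by positivity) (by positivity)
      (by positivity) (by linarith) (by linarith)
    rw [← sq_le_sq]; nlinarith
  · rw [(polarize_of_ge f hx).1, (polarize_of_ge f hx).2, (polarize_of_ge f hy).1,
      (polarize_of_ge f hy).2]
    refine ennreal_weighted_le (hK.anti _ _ ?_) (by positivity) (by positivity) (by positivity)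
      (by positivity) (by linarith) (by linarith)
    rw [← sq_le_sq]; nlinarith

theorem measurable_polarize (a : ℝ) {f : ℝ → ℝ} (hf : Measurable f) : Measurable (polarize a f) :=
  Measurable.ite measurableSet_Iic (by fun_prop) (by fun_prop)

theorem kernelForm_polarize_le {K : ℝ → ℝ≥0∞} (hK : IsRadial K) (a : ℝ) {f : ℝ → ℝ}
    (hf : Measurable f) : kernelForm K (polarize a f) ≤ kernelForm K f := by
  have h : 4 * kernelForm K (polarize a f) ≤ 4 * kernelForm K f := by
    rw [kernelForm_eq_reflected hK a hf, kernelForm_eq_reflected hK a (measurable_polarize a hf)]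
    exact lintegral_mono fun x => lintegral_mono fun y => reflectedIntegrand_polarize_le hK a f x y
  exact (ENNReal.mul_le_mul_iff_right (by norm_num) (by norm_num)).mp h

theorem lintegral_polarize (a : ℝ) {f : ℝ → ℝ} (hf : Measurable f) {F : ℝ → ℝ≥0∞}
    (hF : Measurable F) : ∫⁻ x, F (polarize a f x) = ∫⁻ x, F (f x) := by
  have h : ∀ {u : ℝ → ℝ}, Measurable u →
      2 * ∫⁻ x, F (u x) = ∫⁻ x, (F (u x) + F (u (2 * a - x))) := by
    intro u hu
    rw [lintegral_add_left (by fun_prop), two_mul,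
      lintegral_sub_left_eq_self (fun x => F (u x)) (2 * a)]
  have h2 : 2 * ∫⁻ x, F (polarize a f x) = 2 * ∫⁻ x, F (f x) := by
    rw [h hf, h (measurable_polarize a hf)]
    refine lintegral_congr fun x => ?_
    rcases le_total x a with hx | hx
    · rw [(polarize_of_le f hx).1, (polarize_of_le f hx).2]
      rcases le_total (f x) (f (2 * a - x)) with h | h <;> simp [h, add_comm]
    · rw [(polarize_of_ge f hx).1, (polarize_of_ge f hx).2]
      rcases le_total (f x) (f (2 * a - x)) with h | h <;> simp [h, add_comm]
  exact (ENNReal.mul_right_inj (by norm_num) (by norm_num)).mp h2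

end NeelWall

/-! ### Minimization among folded profiles. -/

namespace NeelWall

open scoped ENNReal

/-- Folded profiles: continuous angles with values in `[-π/2, π/2]` and value `π/2` at `0`. -/
structure IsFolded (ψ : ℝ → ℝ) : Prop where
  continuous : Continuous ψ
  mem : ∀ x, ψ x ∈ Set.Icc (-(Real.pi / 2)) (Real.pi / 2)
  zero : ψ 0 = Real.pi / 2

/-- Twice the energy, with the Dirichlet term replaced by a box form. -/
noncomputable def approxEnergy (h : ℝ) (κ : ℝ≥0∞) (n : ℕ) (ψ : ℝ → ℝ) : ℝ≥0∞ :=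
  kernelForm (boxKernel (1 / (n + 1))) ψ + (∫⁻ x, ENNReal.ofReal ((Real.sin (ψ x) - h) ^ 2)) +
    κ * kernelForm invSq fun x => Real.sin (ψ x)

/-- Twice the energy, as a functional of a folded profile. -/
noncomputable def foldedEnergy (h : ℝ) (κ : ℝ≥0∞) (ψ : ℝ → ℝ) : ℝ≥0∞ :=
  ⨆ n, approxEnergy h κ n ψ

variable {h : ℝ} {κ : ℝ≥0∞} {ψ ψ₁ ψ₂ : ℝ → ℝ}

theorem approxEnergy_le (n : ℕ) (ψ : ℝ → ℝ) : approxEnergy h κ n ψ ≤ foldedEnergy h κ ψ :=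
  le_iSup (fun n => approxEnergy h κ n ψ) n

/-- The angle whose sine is the mean of the sines. -/
noncomputable def midAngle (ψ₁ ψ₂ : ℝ → ℝ) (x : ℝ) : ℝ :=
  Real.arcsin ((Real.sin (ψ₁ x) + Real.sin (ψ₂ x)) / 2)

theorem sin_midAngle (ψ₁ ψ₂ : ℝ → ℝ) (x : ℝ) :
    Real.sin (midAngle ψ₁ ψ₂ x) = (Real.sin (ψ₁ x) + Real.sin (ψ₂ x)) / 2 :=
  Real.sin_arcsin (by linarith [Real.neg_one_le_sin (ψ₁ x), Real.neg_one_le_sin (ψ₂ x)])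
    (by linarith [Real.sin_le_one (ψ₁ x), Real.sin_le_one (ψ₂ x)])

theorem IsFolded.midAngle (h₁ : IsFolded ψ₁) (h₂ : IsFolded ψ₂) : IsFolded (midAngle ψ₁ ψ₂) := by
  refine ⟨?_, fun x => Real.arcsin_mem_Icc _, ?_⟩
  · have := h₁.continuous
    have := h₂.continuous
    exact Real.continuous_arcsin.comp (by fun_prop)
  · simp [NeelWall.midAngle, h₁.zero, h₂.zero]

/-- The box form uses the arcsine inequality and the z⁻² form the convexity of the square. The
potential satisfies an exact parallelogram identity, which supplies the quantitative gain. -/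
theorem approxEnergy_midAngle_le (h₁ : IsFolded ψ₁) (h₂ : IsFolded ψ₂) (n : ℕ) :
    approxEnergy h κ n (midAngle ψ₁ ψ₂) +
      4⁻¹ * ∫⁻ x, ENNReal.ofReal ((Real.sin (ψ₁ x) - Real.sin (ψ₂ x)) ^ 2) ≤
    2⁻¹ * (approxEnergy h κ n ψ₁ + approxEnergy h κ n ψ₂) := by
  have m1 := h₁.continuous.measurable
  have m2 := h₂.continuous.measurable
  have k1 := kernelForm_midpoint_le (isRadial_boxKernel (1 / ((n : ℝ) + 1))).measurable
    (A := midAngle ψ₁ ψ₂) m1 m2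
    fun x y => sq_arcsin_midpoint_sub_le (h₁.mem x) (h₂.mem x) (h₁.mem y) (h₂.mem y)
  have k2 := kernelForm_midpoint_le isRadial_invSq.measurable
    (A := fun x => Real.sin (midAngle ψ₁ ψ₂ x)) (f := fun x => Real.sin (ψ₁ x))
    (g := fun x => Real.sin (ψ₂ x)) (by fun_prop) (by fun_prop) (fun x y => by
      rw [sin_midAngle, sin_midAngle]
      nlinarith [sq_nonneg ((Real.sin (ψ₁ x) - Real.sin (ψ₁ y)) -
        (Real.sin (ψ₂ x) - Real.sin (ψ₂ y)))])
  have k3 : (∫⁻ x, ENNReal.ofReal ((Real.sin (midAngle ψ₁ ψ₂ x) - h) ^ 2)) +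
      4⁻¹ * ∫⁻ x, ENNReal.ofReal ((Real.sin (ψ₁ x) - Real.sin (ψ₂ x)) ^ 2) =
      2⁻¹ * ((∫⁻ x, ENNReal.ofReal ((Real.sin (ψ₁ x) - h) ^ 2)) +
        ∫⁻ x, ENNReal.ofReal ((Real.sin (ψ₂ x) - h) ^ 2)) := by
    rw [← lintegral_const_mul' _ _ (by simp), ← lintegral_add_right _ (by fun_prop),
      ← lintegral_add_right _ (by fun_prop), ← lintegral_const_mul' _ _ (by simp)]
    refine lintegral_congr fun x => ?_
    rw [sin_midAngle, show (4⁻¹ : ℝ≥0∞) = ENNReal.ofReal 4⁻¹ by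
        rw [ENNReal.ofReal_inv_of_pos (by norm_num)]; norm_num,
      show (2⁻¹ : ℝ≥0∞) = ENNReal.ofReal 2⁻¹ by
        rw [ENNReal.ofReal_inv_of_pos (by norm_num)]; norm_num,
      ← ENNReal.ofReal_mul (by norm_num), ← ENNReal.ofReal_add (sq_nonneg _) (by positivity),
      ← ENNReal.ofReal_add (sq_nonneg _) (sq_nonneg _), ← ENNReal.ofReal_mul (by norm_num)]
    congr 1; ring
  unfold approxEnergy
  calc _ = kernelForm (boxKernel (1 / (n + 1))) (midAngle ψ₁ ψ₂) +
        ((∫⁻ x, ENNReal.ofReal ((Real.sin (midAngle ψ₁ ψ₂ x) - h) ^ 2)) +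
          4⁻¹ * ∫⁻ x, ENNReal.ofReal ((Real.sin (ψ₁ x) - Real.sin (ψ₂ x)) ^ 2)) +
        κ * kernelForm invSq (fun x => Real.sin (midAngle ψ₁ ψ₂ x)) := by ring
    _ ≤ _ := by
      rw [k3]
      refine (add_le_add (add_le_add k1 le_rfl) (mul_le_mul_right k2 κ)).trans (le_of_eq ?_)
      ring

theorem foldedEnergy_midAngle_le (h₁ : IsFolded ψ₁) (h₂ : IsFolded ψ₂) :
    foldedEnergy h κ (midAngle ψ₁ ψ₂) +
      4⁻¹ * ∫⁻ x, ENNReal.ofReal ((Real.sin (ψ₁ x) - Real.sin (ψ₂ x)) ^ 2) ≤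
    2⁻¹ * (foldedEnergy h κ ψ₁ + foldedEnergy h κ ψ₂) := by
  rw [foldedEnergy, ENNReal.iSup_add]
  refine iSup_le fun n => (approxEnergy_midAngle_le h₁ h₂ n).trans ?_
  gcongr <;> exact approxEnergy_le n _

/-- Lower bound for the sine relative to a value below one. -/
theorem exists_abs_sub_le_sin_sub (h0 : 0 ≤ h) (h1 : h < 1) :
    ∃ c : ℝ, 0 < c ∧ ∀ y ∈ Set.Icc (-(Real.pi / 2)) (Real.pi / 2),
      |y - Real.arcsin h| ≤ c * |Real.sin y - h| := by
  set t := Real.arcsin h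
  have ht0 : 0 ≤ t := Real.arcsin_nonneg.mpr h0
  have ht1 : t < Real.pi / 2 := by
    rw [← Real.arcsin_one]
    exact Real.strictMonoOn_arcsin ⟨by linarith, h1.le⟩ ⟨by norm_num, le_rfl⟩ h1
  have hst : Real.sin t = h := Real.sin_arcsin (by linarith) h1.le
  -- In sin y - sin t = 2 sin((y-t)/2) cos((y+t)/2), the cosine is at least b > 0, because h < 1
  -- keeps (y+t)/2 away from π/2, and Jordan's inequality bounds the sine below.
  set b := Real.cos ((Real.pi / 2 + t) / 2)
  have hb : 0 < b := Real.cos_pos_of_mem_Ioo ⟨by linarith, by linarith⟩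
  refine ⟨Real.pi / (2 * b), by positivity, fun y hy => ?_⟩
  have e : Real.sin y - h = 2 * Real.sin ((y - t) / 2) * Real.cos ((y + t) / 2) := by
    rw [← hst, Real.sin_sub_sin]
  have hcos : b ≤ Real.cos ((y + t) / 2) := by
    rw [← Real.cos_abs ((y + t) / 2)]
    refine Real.cos_le_cos_of_nonneg_of_le_pi (abs_nonneg _) (by linarith) ?_
    rw [abs_le]
    constructor <;> linarith [hy.1, hy.2]
  have hsin : 2 / Real.pi * |(y - t) / 2| ≤ |Real.sin ((y - t) / 2)| := by
    refine Real.mul_abs_le_abs_sin ?_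
    rw [abs_le]
    constructor <;> linarith [hy.1, hy.2]
  rw [e, abs_mul, abs_mul, abs_of_pos (hb.trans_le hcos)]
  have hp := Real.pi_pos
  have h3 : |y - t| / Real.pi ≤ |Real.sin ((y - t) / 2)| := by
    refine le_trans (le_of_eq ?_) hsin
    rw [abs_div, abs_of_pos (by norm_num : (0:ℝ) < 2)]; ring
  calc |y - t| = Real.pi / (2 * b) * (2 * (|y - t| / Real.pi) * b) := by field_simp
    _ ≤ Real.pi / (2 * b) * (|2| * |Real.sin ((y - t) / 2)| * Real.cos ((y + t) / 2)) := by
      rw [abs_of_pos (by norm_num : (0:ℝ) < 2)]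
      gcongr

theorem memLp_two_of_lintegral {f : ℝ → ℝ} (hf : AEStronglyMeasurable f)
    (h : ∫⁻ x, ENNReal.ofReal (f x ^ 2) ≠ ⊤) : MemLp f 2 := by
  refine ⟨hf, ?_⟩
  rw [eLpNorm_lt_top_iff_lintegral_rpow_enorm_lt_top (by norm_num) (by norm_num)]
  simp only [ENNReal.toReal_ofNat, ENNReal.rpow_ofNat, ← ofReal_sq_eq_enorm]
  exact h.lt_top

/-- Folded profiles of finite energy are `H¹` relative to their limit. -/
theorem IsFolded.exists_isPrimitive (h0 : 0 ≤ h) (h1 : h < 1) (hψ : IsFolded ψ)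
    (hE : foldedEnergy h κ ψ ≠ ⊤) :
    MemLp (fun x => ψ x - Real.arcsin h) 2 ∧ ∃ g, IsPrimitive ψ g ∧ MemLp g 2 ∧
      (∫⁻ x, ENNReal.ofReal (g x ^ 2)) + (∫⁻ x, ENNReal.ofReal ((Real.sin (ψ x) - h) ^ 2)) +
        κ * kernelForm invSq (fun x => Real.sin (ψ x)) ≤ foldedEnergy h κ ψ := by
  have hc := hψ.continuous
  set R := (∫⁻ x, ENNReal.ofReal ((Real.sin (ψ x) - h) ^ 2)) +
        κ * kernelForm invSq (fun x => Real.sin (ψ x))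
  -- Only the box form depends on n, so the supremum falls on it alone, and its finiteness yields
  -- the weak derivative.
  have hJ : (⨆ n : ℕ, kernelForm (boxKernel (1 / ((n : ℝ) + 1))) ψ) + R = foldedEnergy h κ ψ := by
    rw [ENNReal.iSup_add]
    exact iSup_congr fun n => (add_assoc _ _ _).symm
  set M := ⨆ n : ℕ, kernelForm (boxKernel (1 / ((n : ℝ) + 1))) ψ
  have hM : M ≠ ⊤ := ne_top_of_le_ne_top hE (by rw [← hJ]; exact le_self_add)
  have hpot : ∫⁻ x, ENNReal.ofReal ((Real.sin (ψ x) - h) ^ 2) ≠ ⊤ :=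
    ne_top_of_le_ne_top hE (by rw [← hJ]; exact le_self_add.trans le_add_self)
  have hu : MemLp (fun x => Real.sin (ψ x) - h) 2 :=
    memLp_two_of_lintegral (Continuous.aestronglyMeasurable (by fun_prop)) hpot
  obtain ⟨c, hc0, hcle⟩ := exists_abs_sub_le_sin_sub h0 h1
  have hL : MemLp (fun x => ψ x - Real.arcsin h) 2 :=
    hu.of_le_mul (Continuous.aestronglyMeasurable (by fun_prop))
      (Eventually.of_forall fun x => hcle _ (hψ.mem x))
  refine ⟨hL, ?_⟩
  obtain ⟨g, hg, hg2, hgle⟩ := exists_weakDeriv_of_boxKernel_le hL (by fun_prop) hM fun n => by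
    rw [kernelForm_sub_const]
    exact le_iSup (fun n : ℕ => kernelForm (boxKernel (1 / ((n : ℝ) + 1))) ψ) n
  have hP := hg.isPrimitive (by fun_prop)
  refine ⟨g, ⟨hP.1, fun a b => by rw [← hP.2]; ring⟩, hg2, ?_⟩
  rw [← hJ, add_assoc]
  exact add_le_add hgle le_rfl

theorem IsFolded.sq_sub_le (h0 : 0 ≤ h) (h1 : h < 1) (hψ : IsFolded ψ) {M : ℝ} (hM : 0 ≤ M)
    (hE : foldedEnergy h κ ψ ≤ ENNReal.ofReal M) (x y : ℝ) :
    (ψ x - ψ y) ^ 2 ≤ M * |x - y| := by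
  obtain ⟨-, g, hP, -, hg⟩ := hψ.exists_isPrimitive h0 h1 (ne_top_of_le_ne_top (by simp) hE)
  have h2 : ∫⁻ s, ENNReal.ofReal (g s ^ 2) ≤ ENNReal.ofReal M :=
    (le_self_add.trans le_self_add).trans (hg.trans hE)
  have h3 := (hP.sq_sub_le_total x y).trans (mul_le_mul_right h2 _)
  rw [← ENNReal.ofReal_mul (abs_nonneg _)] at h3
  have := (ENNReal.ofReal_le_ofReal_iff (by positivity)).mp h3
  linarith

/-- A Hölder function is pointwise controlled by its `L²` norm. -/
theorem sq_le_of_holder {w : ℝ → ℝ} {C δ I : ℝ} (hC : 0 ≤ C) (hδ : 0 < δ)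
    (hI : 0 ≤ I) (hw : ∀ x y, (w x - w y) ^ 2 ≤ C * |x - y|)
    (hi : ∫⁻ x, ENNReal.ofReal (w x ^ 2) ≤ ENNReal.ofReal I) (x : ℝ) :
    w x ^ 2 ≤ 2 * I / δ + 2 * C * δ := by
  have h1 : ENNReal.ofReal (w x ^ 2) * ENNReal.ofReal δ ≤
      ENNReal.ofReal (2 * I + 2 * C * δ * δ) := by
    calc ENNReal.ofReal (w x ^ 2) * ENNReal.ofReal δ
        = ∫⁻ y in Set.Ioc x (x + δ), ENNReal.ofReal (w x ^ 2) := by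
          rw [setLIntegral_const, Real.volume_Ioc, add_sub_cancel_left]
      _ ≤ ∫⁻ y in Set.Ioc x (x + δ),
          (ENNReal.ofReal 2 * ENNReal.ofReal (w y ^ 2) + ENNReal.ofReal (2 * C * δ)) := by
          refine setLIntegral_mono' measurableSet_Ioc fun y hy => ?_
          rw [← ENNReal.ofReal_mul (by norm_num), ← ENNReal.ofReal_add (by positivity)
            (by positivity)]
          refine ENNReal.ofReal_le_ofReal ?_
          have h2 := hw x y
          have h3 : |x - y| ≤ δ := by
            rw [abs_le]; constructor <;> linarith [hy.1, hy.2]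
          have h4 := mul_le_mul_of_nonneg_left h3 hC
          nlinarith [sq_nonneg (w x - 2 * w y)]
      _ = ENNReal.ofReal 2 * (∫⁻ y in Set.Ioc x (x + δ), ENNReal.ofReal (w y ^ 2)) +
          ENNReal.ofReal (2 * C * δ) * ENNReal.ofReal δ := by
          rw [lintegral_add_right _ measurable_const, lintegral_const_mul' _ _ (by simp),
            setLIntegral_const, Real.volume_Ioc, add_sub_cancel_left]
      _ ≤ ENNReal.ofReal 2 * ENNReal.ofReal I + ENNReal.ofReal (2 * C * δ) * ENNReal.ofReal δ := by
          gcongr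
          exact (setLIntegral_le_lintegral _ _).trans hi
      _ = _ := by
          rw [← ENNReal.ofReal_mul (by norm_num), ← ENNReal.ofReal_mul (by positivity),
            ← ENNReal.ofReal_add (by positivity) (by positivity)]
  rw [← ENNReal.ofReal_mul (sq_nonneg _), ENNReal.ofReal_le_ofReal_iff (by positivity)] at h1
  rw [← le_div_iff₀ hδ] at h1
  refine h1.trans (le_of_eq ?_)
  field_simp

theorem approxEnergy_le_liminf (hκ : κ ≠ ⊤) (n : ℕ) {F : ℕ → ℝ → ℝ} (hF : ∀ k, Continuous (F k))
    (hlim : ∀ x, Tendsto (fun k => F k x) atTop (𝓝 (ψ x))) :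
    approxEnergy h κ n ψ ≤ liminf (fun k => approxEnergy h κ n (F k)) atTop := by
  have hm : ∀ k, Measurable (F k) := fun k => (hF k).measurable
  have k1 := kernelForm_le_liminf (isRadial_boxKernel (1 / ((n : ℝ) + 1))).measurable hm hlim
  have k2 : kernelForm invSq (fun x => Real.sin (ψ x)) ≤
      liminf (fun k => kernelForm invSq fun x => Real.sin (F k x)) atTop :=
    kernelForm_le_liminf isRadial_invSq.measurable (fun k => Real.measurable_sin.comp (hm k))
      fun x => (Real.continuous_sin.tendsto _).comp (hlim x)
  have k3 : ∫⁻ x, ENNReal.ofReal ((Real.sin (ψ x) - h) ^ 2) ≤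
      liminf (fun k => ∫⁻ x, ENNReal.ofReal ((Real.sin (F k x) - h) ^ 2)) atTop := by
    refine le_trans (lintegral_mono fun x => ?_) (lintegral_liminf_le fun k => ?_)
    · refine (Tendsto.liminf_eq ?_).ge
      exact ENNReal.tendsto_ofReal
        ((((Real.continuous_sin.tendsto _).comp (hlim x)).sub_const h).pow 2)
    · have := hm k
      fun_prop
  have k4 : κ * kernelForm invSq (fun x => Real.sin (ψ x)) ≤
      liminf (fun k => κ * kernelForm invSq fun x => Real.sin (F k x)) atTop := by
    exact (mul_le_mul_right k2 κ).trans (ENNReal.liminf_const_mul_of_ne_top hκ).ge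
  unfold approxEnergy
  refine (add_le_add (add_le_add k1 k3) k4).trans ?_
  -- Superadditivity of the lower limit, from monotonicity of the tail infima.
  have hadd : ∀ u v : ℕ → ℝ≥0∞,
      liminf u atTop + liminf v atTop ≤ liminf (fun k => u k + v k) atTop :=
    fun u v => by
      rw [liminf_eq_iSup_iInf_of_nat', liminf_eq_iSup_iInf_of_nat', liminf_eq_iSup_iInf_of_nat',
        ENNReal.iSup_add_iSup]
      · exact iSup_mono fun n => le_iInf fun i => add_le_add (iInf_le _ i) (iInf_le _ i)
      · intro i j
        refine ⟨max i j, add_le_add (le_iInf fun k => ?_) (le_iInf fun k => ?_)⟩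
        · exact (iInf_le _ (k + max i j - i)).trans_eq (congrArg u (by omega))
        · exact (iInf_le _ (k + max i j - j)).trans_eq (congrArg v (by omega))
  exact (add_le_add (hadd _ _) le_rfl).trans (hadd _ _)

/-- The direct method: existence of a minimizer among folded profiles. -/
theorem exists_minimizer (h0 : 0 ≤ h) (h1 : h < 1) (hκ : κ ≠ ⊤)
    (hfin : ∃ ψ, IsFolded ψ ∧ foldedEnergy h κ ψ ≠ ⊤) :
    ∃ ψ, IsFolded ψ ∧ foldedEnergy h κ ψ ≠ ⊤ ∧
      ∀ φ, IsFolded φ → foldedEnergy h κ ψ ≤ foldedEnergy h κ φ := by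
  set m := ⨅ φ : {φ : ℝ → ℝ // IsFolded φ}, foldedEnergy h κ φ.1
  have hm : ∀ φ, IsFolded φ → m ≤ foldedEnergy h κ φ := fun φ hφ =>
    iInf_le (fun φ : {φ : ℝ → ℝ // IsFolded φ} => foldedEnergy h κ φ.1) ⟨φ, hφ⟩
  have hmt : m ≠ ⊤ := by
    obtain ⟨φ, hφ, ht⟩ := hfin
    exact ne_top_of_le_ne_top ht (hm φ hφ)
  have hseq : ∀ k : ℕ, ∃ φ, IsFolded φ ∧
      foldedEnergy h κ φ ≤ m + ENNReal.ofReal (1 / ((k : ℝ) + 1)) := by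
    intro k
    have : m < m + ENNReal.ofReal (1 / ((k : ℝ) + 1)) :=
      ENNReal.lt_add_right hmt (by
        rw [Ne, ENNReal.ofReal_eq_zero, not_le]; positivity)
    obtain ⟨φ, hφ⟩ := iInf_lt_iff.mp this
    exact ⟨φ.1, φ.2, hφ.le⟩
  choose F hF hFle using hseq
  set M : ℝ := m.toReal + 1
  have hM : 0 ≤ M := by positivity
  have hFM : ∀ k, foldedEnergy h κ (F k) ≤ ENNReal.ofReal M := by
    intro k
    refine (hFle k).trans ?_
    rw [ENNReal.ofReal_add ENNReal.toReal_nonneg zero_le_one, ENNReal.ofReal_toReal hmt]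
    gcongr
    rw [div_le_one (by positivity)]
    linarith [(Nat.cast_nonneg k : (0:ℝ) ≤ k)]
  have hHol : ∀ k x y, (F k x - F k y) ^ 2 ≤ M * |x - y| := fun k x y =>
    (hF k).sq_sub_le h0 h1 hM (hFM k) x y
  -- The mean of two near-minimizers has energy at least m, so the convexity gain is bounded by the
  -- average excess of the two. This gives the L² Cauchy property without any compactness.
  have hL2 : ∀ k l : ℕ, ∫⁻ x, ENNReal.ofReal ((Real.sin (F k x) - Real.sin (F l x)) ^ 2) ≤
      ENNReal.ofReal (2 * (1 / ((k : ℝ) + 1) + 1 / ((l : ℝ) + 1))) := by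
    intro k l
    have a := foldedEnergy_midAngle_le (h := h) (κ := κ) (hF k) (hF l)
    have b := hm _ ((hF k).midAngle (hF l))
    set I := ∫⁻ x, ENNReal.ofReal ((Real.sin (F k x) - Real.sin (F l x)) ^ 2)
    have c : m + 4⁻¹ * I ≤ m + ENNReal.ofReal (2⁻¹ * (1 / ((k : ℝ) + 1) + 1 / ((l : ℝ) + 1))) := by
      calc m + 4⁻¹ * I ≤ 2⁻¹ * (foldedEnergy h κ (F k) + foldedEnergy h κ (F l)) :=
            (add_le_add b le_rfl).trans a
        _ ≤ 2⁻¹ * ((m + ENNReal.ofReal (1 / ((k : ℝ) + 1))) +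
              (m + ENNReal.ofReal (1 / ((l : ℝ) + 1)))) := by
            gcongr
            · exact hFle k
            · exact hFle l
        _ = (2⁻¹ * 2) * m + 2⁻¹ * (ENNReal.ofReal (1 / ((k : ℝ) + 1)) +
              ENNReal.ofReal (1 / ((l : ℝ) + 1))) := by ring
        _ = _ := by
            rw [ENNReal.inv_mul_cancel (by norm_num) (by norm_num), one_mul,
              ENNReal.ofReal_mul (by norm_num), ENNReal.ofReal_add (by positivity) (by positivity),
              ENNReal.ofReal_inv_of_pos (by norm_num)]
            norm_num
    have d := (ENNReal.add_le_add_iff_left hmt).mp c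
    calc I = 4 * (4⁻¹ * I) := by
          rw [← mul_assoc, ENNReal.mul_inv_cancel (by norm_num) (by norm_num), one_mul]
      _ ≤ 4 * ENNReal.ofReal (2⁻¹ * (1 / ((k : ℝ) + 1) + 1 / ((l : ℝ) + 1))) := by gcongr
      _ = _ := by
          rw [show (4 : ℝ≥0∞) = ENNReal.ofReal 4 by norm_num, ← ENNReal.ofReal_mul (by norm_num)]
          congr 1; ring
  have hcau : ∀ x, CauchySeq fun k => Real.sin (F k x) := by
    intro x
    rw [Metric.cauchySeq_iff']
    intro ε hε
    -- The bound of `sq_le_of_holder`, with Hölder constant 4M, has two terms: this δ makes the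
    -- Hölder term at most ε²/4, and N is then chosen to do the same for the L² term.
    set δ : ℝ := ε ^ 2 / (32 * (M + 1))
    have hδ : 0 < δ := by positivity
    obtain ⟨N, hN⟩ := exists_nat_one_div_lt (show 0 < ε ^ 2 * δ / 32 by positivity)
    refine ⟨N, fun k hk => ?_⟩
    have hk' : 1 / ((k : ℝ) + 1) ≤ 1 / ((N : ℝ) + 1) := by
      have : (N : ℝ) ≤ k := by exact_mod_cast hk
      gcongr
    have hw : ∀ x y, ((Real.sin (F k x) - Real.sin (F N x)) -
        (Real.sin (F k y) - Real.sin (F N y))) ^ 2 ≤ 4 * M * |x - y| := by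
      intro x y
      have e1 := hHol k x y
      have e2 := hHol N x y
      have e3 : (Real.sin (F k x) - Real.sin (F k y)) ^ 2 ≤ (F k x - F k y) ^ 2 :=
        sq_le_sq.mpr (by simpa [Real.dist_eq] using lipschitzWith_sin.dist_le_mul (F k x) (F k y))
      have e4 : (Real.sin (F N x) - Real.sin (F N y)) ^ 2 ≤ (F N x - F N y) ^ 2 :=
        sq_le_sq.mpr (by simpa [Real.dist_eq] using lipschitzWith_sin.dist_le_mul (F N x) (F N y))
      nlinarith [sq_nonneg ((Real.sin (F k x) - Real.sin (F k y)) +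
        (Real.sin (F N x) - Real.sin (F N y)))]
    have key := sq_le_of_holder (w := fun x => Real.sin (F k x) - Real.sin (F N x))
      (by positivity) hδ (by positivity) hw (hL2 k N) x
    have key2 : 2 * (2 * (1 / ((k : ℝ) + 1) + 1 / ((N : ℝ) + 1))) / δ ≤ ε ^ 2 / 4 := by
      rw [div_le_iff₀ hδ]
      linarith
    have key3 : 2 * (4 * M) * δ ≤ ε ^ 2 / 4 := by
      simp only [δ]
      rw [← mul_div_assoc, div_le_div_iff₀ (by positivity) (by norm_num)]
      nlinarith [sq_nonneg ε]
    rw [Real.dist_eq]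
    refine abs_lt_of_sq_lt_sq ?_ hε.le
    have : 0 < ε ^ 2 := by positivity
    linarith
  choose u hu using fun x => cauchySeq_tendsto_of_complete (hcau x)
  set ψ : ℝ → ℝ := fun x => Real.arcsin (u x)
  -- Folded angles are recovered from their sines by the continuous arcsine, so convergence of the
  -- sines suffices.
  have hlim : ∀ x, Tendsto (fun k => F k x) atTop (𝓝 (ψ x)) := by
    intro x
    have := (Real.continuous_arcsin.tendsto (u x)).comp (hu x)
    refine this.congr fun k => ?_
    exact Real.arcsin_sin ((hF k).mem x).1 ((hF k).mem x).2
  have hψH : ∀ x y, (ψ x - ψ y) ^ 2 ≤ M * |x - y| := fun x y =>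
    le_of_tendsto (((hlim x).sub (hlim y)).pow 2) (Eventually.of_forall fun k => hHol k x y)
  have hψ : IsFolded ψ := by
    refine ⟨?_, fun x => Real.arcsin_mem_Icc _, ?_⟩
    · rw [continuous_iff_continuousAt]
      intro x
      rw [ContinuousAt, tendsto_iff_dist_tendsto_zero]
      have ht : Tendsto (fun y => √(M * |y - x|)) (𝓝 x) (𝓝 0) := by
        have : Continuous fun y => √(M * |y - x|) := by fun_prop
        simpa using this.tendsto x
      refine squeeze_zero (fun y => dist_nonneg) (fun y => ?_) ht
      rw [Real.dist_eq]
      exact Real.abs_le_sqrt (hψH y x)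
    · refine tendsto_nhds_unique (hlim 0) ?_
      simp only [(hF _).zero]
      exact tendsto_const_nhds
  have hle : foldedEnergy h κ ψ ≤ m := by
    refine iSup_le fun n => (approxEnergy_le_liminf hκ n (fun k => (hF k).continuous) hlim).trans ?_
    have hconv : Tendsto (fun k : ℕ => m + ENNReal.ofReal (1 / ((k : ℝ) + 1))) atTop (𝓝 m) := by
      have := ENNReal.tendsto_ofReal (tendsto_one_div_add_atTop_nhds_zero_nat (𝕜 := ℝ))
      rw [ENNReal.ofReal_zero] at this
      simpa using this.const_add m
    rw [← hconv.liminf_eq]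
    exact liminf_le_liminf (Eventually.of_forall fun k => (approxEnergy_le n _).trans (hFle k))
  exact ⟨ψ, hψ, ne_top_of_le_ne_top hmt hle, fun φ hφ => hle.trans (hm φ hφ)⟩

/-- The profile with the mean sine cannot have less energy than the minimizer, so the convexity gain
vanishes; the sines then agree, and with them the folded angles. -/
theorem minimizer_unique (h₁ : IsFolded ψ₁) (h₂ : IsFolded ψ₂) (hE : foldedEnergy h κ ψ₁ ≠ ⊤)
    (hmin : ∀ φ, IsFolded φ → foldedEnergy h κ ψ₁ ≤ foldedEnergy h κ φ)
    (hle : foldedEnergy h κ ψ₂ ≤ foldedEnergy h κ ψ₁) : ψ₂ = ψ₁ := by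
  have a := foldedEnergy_midAngle_le (h := h) (κ := κ) h₁ h₂
  have b := hmin _ (h₁.midAngle h₂)
  have c1 := h₁.continuous
  have c2 := h₂.continuous
  set I := ∫⁻ x, ENNReal.ofReal ((Real.sin (ψ₁ x) - Real.sin (ψ₂ x)) ^ 2) with hI
  have c : foldedEnergy h κ ψ₁ + 4⁻¹ * I ≤ foldedEnergy h κ ψ₁ + 0 := by
    refine (add_le_add b le_rfl).trans (a.trans ?_)
    calc _ ≤ 2⁻¹ * (foldedEnergy h κ ψ₁ + foldedEnergy h κ ψ₁) := by gcongr
      _ = (2⁻¹ * 2) * foldedEnergy h κ ψ₁ + 0 := by ring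
      _ = _ := by rw [ENNReal.inv_mul_cancel (by norm_num) (by norm_num), one_mul]
  have d := (ENNReal.add_le_add_iff_left hE).mp c
  have hI0 : I = 0 := by simpa using d
  rw [hI, lintegral_eq_zero_iff (by fun_prop)] at hI0
  have e : (fun x => Real.sin (ψ₁ x)) =ᵐ[volume] fun x => Real.sin (ψ₂ x) := by
    filter_upwards [hI0] with x hx
    simp only [Pi.zero_apply, ENNReal.ofReal_eq_zero] at hx
    nlinarith [sq_nonneg (Real.sin (ψ₁ x) - Real.sin (ψ₂ x)), pow_eq_zero_iff (two_ne_zero) |>.mp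
      (le_antisymm hx (sq_nonneg (Real.sin (ψ₁ x) - Real.sin (ψ₂ x))))]
  have e' := (Continuous.ae_eq_iff_eq volume (by fun_prop) (by fun_prop)).mp e
  funext x
  have := congrFun e' x
  rw [← Real.arcsin_sin (h₁.mem x).1 (h₁.mem x).2, ← Real.arcsin_sin (h₂.mem x).1 (h₂.mem x).2]
  exact congrArg _ this.symm

theorem approxEnergy_polarize_le (hψ : IsFolded ψ) (a : ℝ) (n : ℕ) :
    approxEnergy h κ n (polarize a ψ) ≤ approxEnergy h κ n ψ := by
  have hm := hψ.continuous.measurable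
  have hs : (fun x => Real.sin (polarize a ψ x)) = polarize a fun x => Real.sin (ψ x) := by
    funext x
    unfold polarize
    split_ifs
    · exact Real.strictMonoOn_sin.monotoneOn.map_max (hψ.mem _) (hψ.mem _)
    · exact Real.strictMonoOn_sin.monotoneOn.map_min (hψ.mem _) (hψ.mem _)
  unfold approxEnergy
  refine add_le_add (add_le_add ?_ ?_) (mul_le_mul_right ?_ κ)
  · exact kernelForm_polarize_le (isRadial_boxKernel _) a hm
  · exact (lintegral_polarize a hm (F := fun t => ENNReal.ofReal ((Real.sin t - h) ^ 2))
      (by fun_prop)).le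
  · rw [hs]
    exact kernelForm_polarize_le isRadial_invSq a (by fun_prop)

/-- For a > 0 the origin lies on the favoured side, where the larger value is kept; since π/2 is the
maximum, the normalization at 0 survives. -/
theorem IsFolded.polarize (hψ : IsFolded ψ) {a : ℝ} (ha : 0 < a) : IsFolded (polarize a ψ) := by
  have hc := hψ.continuous
  refine ⟨?_, fun x => ?_, ?_⟩
  · refine Continuous.if_le (by fun_prop) (by fun_prop) continuous_id continuous_const ?_
    intro x hx
    have : 2 * a - x = x := by linarith
    simp [this]
  · unfold NeelWall.polarize
    split_ifs
    · exact ⟨le_max_of_le_left (hψ.mem _).1, max_le (hψ.mem _).2 (hψ.mem _).2⟩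
    · exact ⟨le_min (hψ.mem _).1 (hψ.mem _).1, min_le_of_left_le (hψ.mem _).2⟩
  · rw [NeelWall.polarize, if_pos ha.le, hψ.zero]
    exact max_eq_left (hψ.mem _).2

theorem kernelForm_comp_neg {K : ℝ → ℝ≥0∞} (hK : IsRadial K) (f : ℝ → ℝ) :
    kernelForm K (fun x => f (-x)) = kernelForm K f := by
  unfold kernelForm
  conv_rhs => rw [← lintegral_sub_left_eq_self _ 0]
  refine lintegral_congr fun x => ?_
  conv_rhs => rw [← lintegral_sub_left_eq_self _ 0]
  refine lintegral_congr fun y => ?_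
  rw [← hK.neg (x - y)]
  simp only [zero_sub]
  congr 2; ring

/-- A minimizing folded profile is even and nonincreasing on `[0, ∞)`. -/
theorem minimizer_symmetric_decreasing (hψ : IsFolded ψ) (hE : foldedEnergy h κ ψ ≠ ⊤)
    (hmin : ∀ φ, IsFolded φ → foldedEnergy h κ ψ ≤ foldedEnergy h κ φ) :
    (∀ x, ψ (-x) = ψ x) ∧ AntitoneOn ψ (Set.Ici 0) := by
  constructor
  · have hf : IsFolded fun x => ψ (-x) :=
      ⟨hψ.continuous.comp continuous_neg, fun x => hψ.mem _, by simpa using hψ.zero⟩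
    have := minimizer_unique (ψ₂ := fun x => ψ (-x)) hψ hf hE hmin (by
      refine iSup_mono fun n => ?_
      unfold approxEnergy
      refine add_le_add (add_le_add ?_ ?_) (mul_le_mul_right ?_ κ)
      · exact (kernelForm_comp_neg (isRadial_boxKernel _) ψ).le
      · refine le_of_eq ?_
        conv_rhs => rw [← lintegral_sub_left_eq_self _ 0]
        simp
      · exact (kernelForm_comp_neg isRadial_invSq fun x => Real.sin (ψ x)).le)
    exact fun x => congrFun this x
  · intro x hx y hy hxy
    rcases eq_or_lt_of_le hxy with rfl | hxy
    · exact le_rfl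
    have ha : 0 < (x + y) / 2 := by
      simp only [Set.mem_Ici] at hx hy; linarith
    -- Symmetrize about the midpoint of x and y, which exchanges the two points. Invariance of the
    -- minimizer says that its value at x is the larger one.
    have := minimizer_unique hψ (hψ.polarize ha) hE hmin
      (iSup_mono fun n => approxEnergy_polarize_le hψ _ n)
    have e1 := (polarize_of_le ψ (show x ≤ (x + y) / 2 by linarith))
    have e2 : 2 * ((x + y) / 2) - x = y := by ring
    rw [e2] at e1
    rw [this] at e1
    exact (le_max_right _ _).trans e1.1.ge

end NeelWall

/-! ### Walls, their energy, and the admissible class. -/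

namespace NeelWall

open scoped ENNReal

/-- A continuous angle with square integrable derivative `g` such that `sin θ - h` is square
integrable. -/
structure IsWall (h : ℝ) (θ g : ℝ → ℝ) : Prop where
  prim : IsPrimitive θ g
  memLp_deriv : MemLp g 2
  memLp_sin : MemLp (fun x => Real.sin (θ x) - h) 2

variable {ν h : ℝ} {θ φ g v : ℝ → ℝ}

theorem IsWall.prim_sin (hw : IsWall h θ g) :
    IsPrimitive (fun x => Real.sin (θ x) - h) (fun x => Real.cos (θ x) * g x) :=
  hw.prim.sin.sub_const h

theorem IsWall.memLp_cos_mul (hw : IsWall h θ g) : MemLp (fun x => Real.cos (θ x) * g x) 2 := by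
  have hc := hw.prim.continuous
  refine hw.memLp_deriv.mono
    (AEStronglyMeasurable.mul (Continuous.aestronglyMeasurable (by fun_prop)) hw.memLp_deriv.1)
    (Eventually.of_forall fun x => ?_)
  rw [norm_mul]
  exact mul_le_of_le_one_left (norm_nonneg _) (Real.abs_cos_le_one _)

theorem IsWall.exists_halfLap (hw : IsWall h θ g) :
    ∃ v, HalfLap (fun x => Real.sin (θ x) - h) v :=
  halfLap_of_isWeakDeriv hw.prim_sin.isWeakDeriv hw.memLp_sin hw.memLp_cos_mul

theorem HalfLap.congr_left {u₁ u₂ : ℝ → ℝ} (h : HalfLap u₁ v) (he : u₁ =ᵐ[volume] u₂) :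
    HalfLap u₂ v :=
  ⟨(memLp_congr_ae he).mp h.1, h.2.1, by rw [← ft_congr he]; exact h.2.2⟩

/-- Replaces the chosen weak derivative and half-Laplacian by concrete ones. The energy is taken at
`φ`, equal to the wall only almost everywhere, because admissible functions need not be continuous.
-/
theorem IsWall.energy_eq (hw : IsWall h θ g) (he : φ =ᵐ[volume] θ)
    (hv : HalfLap (fun x => Real.sin (θ x) - h) v) :
    energy ν h φ = 1 / 2 * ((∫ x, g x ^ 2) + (∫ x, (Real.sin (θ x) - h) ^ 2) +
      ν / 2 * ∫ x, (Real.sin (θ x) - h) * v x) := by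
  have h1 : weakDeriv φ =ᵐ[volume] g :=
    (hw.prim.isWeakDeriv.congr he.symm EventuallyEq.rfl).weakDeriv_ae_eq
  have h2 : halfLaplacian (fun y => Real.sin (φ y) - h) =ᵐ[volume] v :=
    (hv.congr_left (he.symm.mono fun x hx => by simp only [hx])).halfLaplacian_ae_eq
  have i1 : Integrable fun x => g x ^ 2 := hw.memLp_deriv.integrable_sq
  have i2 : Integrable fun x => (Real.sin (θ x) - h) ^ 2 := hw.memLp_sin.integrable_sq
  have i3 : Integrable fun x => (Real.sin (θ x) - h) * v x := hw.memLp_sin.integrable_mul hv.2.1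
  have i4 : Integrable fun x => g x ^ 2 + (Real.sin (θ x) - h) ^ 2 := i1.add i2
  rw [energy, ← integral_const_mul (ν / 2), ← integral_add i1 i2,
    ← integral_add i4 (i3.const_mul _)]
  congr 1
  refine integral_congr_ae ?_
  filter_upwards [he, h1, h2] with x e1 e2 e3
  rw [e1, e2, e3]

theorem ofReal_integral_sq {f : ℝ → ℝ} (hf : MemLp f 2) :
    ENNReal.ofReal (∫ x, f x ^ 2) = ∫⁻ x, ENNReal.ofReal (f x ^ 2) :=
  ofReal_integral_eq_lintegral_ofReal hf.integrable_sq (Eventually.of_forall fun _ => sq_nonneg _)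

theorem HalfLap.const_mul_kernelForm (hν : 0 < ν) {u : ℝ → ℝ} (h : HalfLap u v)
    (hm : Measurable u) :
    ENNReal.ofReal (ν / 2) / gagliardoConst * kernelForm invSq u =
      ENNReal.ofReal (ν / 2 * ∫ x, u x * v x) := by
  rw [h.kernelForm_invSq hm, ← mul_assoc,
    ENNReal.div_mul_cancel gagliardoConst_ne_zero gagliardoConst_ne_top,
    ← ENNReal.ofReal_mul (by positivity)]

/-- The energy as a kernel form. -/
theorem IsWall.ofReal_energy (hν : 0 < ν) (hw : IsWall h θ g) (he : φ =ᵐ[volume] θ) :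
    ENNReal.ofReal (2 * energy ν h φ) =
      (∫⁻ x, ENNReal.ofReal (g x ^ 2)) + (∫⁻ x, ENNReal.ofReal ((Real.sin (θ x) - h) ^ 2)) +
        ENNReal.ofReal (ν / 2) / gagliardoConst * kernelForm invSq fun x => Real.sin (θ x) := by
  obtain ⟨v, hv⟩ := hw.exists_halfLap
  have hc := hw.prim.continuous
  have hm : Measurable fun x => Real.sin (θ x) - h := by fun_prop
  have h3 := hv.integral_mul_nonneg
  rw [hw.energy_eq he hv, ← kernelForm_sub_const invSq (fun x => Real.sin (θ x)) h,
    hv.const_mul_kernelForm hν hm, ← ofReal_integral_sq hw.memLp_deriv,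
    ← ofReal_integral_sq hw.memLp_sin,
    ← ENNReal.ofReal_add (integral_nonneg fun x => sq_nonneg _)
      (integral_nonneg fun x => sq_nonneg _), ← ENNReal.ofReal_add _ (by positivity)]
  · congr 1; ring
  · exact add_nonneg (integral_nonneg fun x => sq_nonneg _) (integral_nonneg fun x => sq_nonneg _)

theorem IsWall.energy_nonneg (hν : 0 < ν) (hw : IsWall h θ g) (he : φ =ᵐ[volume] θ) :
    0 ≤ energy ν h φ := by
  obtain ⟨v, hv⟩ := hw.exists_halfLap
  have h3 := hv.integral_mul_nonneg
  have h1 : 0 ≤ ∫ x, g x ^ 2 := integral_nonneg fun x => sq_nonneg _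
  have h2 : 0 ≤ ∫ x, (Real.sin (θ x) - h) ^ 2 := integral_nonneg fun x => sq_nonneg _
  rw [hw.energy_eq he hv]
  positivity

/-- The cosine of the difference of the folded angles is |cos a cos b| + sin a sin b, which is at
least cos(a - b); and cosine is strictly decreasing on [0, π]. -/
theorem abs_arcsin_sin_sub_le (a b : ℝ) :
    |Real.arcsin (Real.sin a) - Real.arcsin (Real.sin b)| ≤ |a - b| := by
  set A := Real.arcsin (Real.sin a)
  set B := Real.arcsin (Real.sin b)
  have hA := Real.arcsin_mem_Icc (Real.sin a)
  have hB := Real.arcsin_mem_Icc (Real.sin b)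
  have hAB : |A - B| ≤ Real.pi := by
    rw [abs_le]; constructor <;> linarith [hA.1, hA.2, hB.1, hB.2]
  by_contra! hlt
  have h1 := Real.strictAntiOn_cos ⟨abs_nonneg (a - b), hlt.le.trans hAB⟩
    ⟨abs_nonneg _, hAB⟩ hlt
  rw [Real.cos_abs, Real.cos_abs, Real.cos_sub, Real.cos_sub] at h1
  have sA : Real.sin A = Real.sin a := Real.sin_arcsin (Real.neg_one_le_sin a) (Real.sin_le_one a)
  have sB : Real.sin B = Real.sin b := Real.sin_arcsin (Real.neg_one_le_sin b) (Real.sin_le_one b)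
  have cA : Real.cos A = |Real.cos a| := by
    rw [Real.cos_arcsin, ← Real.sqrt_sq_eq_abs, Real.cos_sq']
  have cB : Real.cos B = |Real.cos b| := by
    rw [Real.cos_arcsin, ← Real.sqrt_sq_eq_abs, Real.cos_sq']
  rw [sA, sB, cA, cB, ← abs_mul] at h1
  linarith [le_abs_self (Real.cos a * Real.cos b)]

theorem sin_arcsin_sin (a : ℝ) : Real.sin (Real.arcsin (Real.sin a)) = Real.sin a :=
  Real.sin_arcsin (Real.neg_one_le_sin a) (Real.sin_le_one a)

theorem isFolded_fold (hc : Continuous θ) {b : ℝ} (hb : θ b = Real.pi / 2) :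
    IsFolded fun x => Real.arcsin (Real.sin (θ (x + b))) :=
  ⟨Real.continuous_arcsin.comp (by fun_prop), fun x => Real.arcsin_mem_Icc _, by simp [hb]⟩

/-- Folding is 1-Lipschitz and keeps the sine, and every box form is at most the Dirichlet integral.
The shift by `b` serves to place a crossing of π/2 at the origin. -/
theorem IsWall.foldedEnergy_fold_le (hν : 0 < ν) (hw : IsWall h θ g) (he : φ =ᵐ[volume] θ)
    (b : ℝ) :
    foldedEnergy h (ENNReal.ofReal (ν / 2) / gagliardoConst)
      (fun x => Real.arcsin (Real.sin (θ (x + b)))) ≤ ENNReal.ofReal (2 * energy ν h φ) := by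
  rw [hw.ofReal_energy hν he]
  refine iSup_le fun n => ?_
  unfold approxEnergy
  simp only [sin_arcsin_sin]
  refine add_le_add (add_le_add ?_ ?_) (mul_le_mul_right ?_ _)
  · refine (kernelForm_mono fun x y => abs_arcsin_sin_sub_le (θ (x + b)) (θ (y + b))).trans ?_
    rw [kernelForm_comp_add _ θ b]
    exact hw.prim.kernelForm_boxKernel_le (by positivity)
  · exact (lintegral_add_right_eq_self
      (fun x => ENNReal.ofReal ((Real.sin (θ x) - h) ^ 2)) b).le
  · exact (kernelForm_comp_add invSq (fun x => Real.sin (θ x)) b).le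

/-! ### The reference profile and the admissible class -/

theorem contDiff_etaRef (h : ℝ) : ContDiff ℝ (⊤ : ℕ∞) (etaRef h) := by
  unfold etaRef
  have := Real.smoothTransition.contDiff (n := (⊤ : ℕ∞))
  have h2 : ContDiff ℝ (⊤ : ℕ∞) fun x : ℝ => Real.smoothTransition ((x + 1) / 2) :=
    this.comp (by fun_prop)
  fun_prop

theorem etaRef_of_one_le {x : ℝ} (hx : 1 ≤ x) : etaRef h x = Real.arcsin h := by
  rw [etaRef, Real.smoothTransition.one_of_one_le (by linarith)]; ring

theorem etaRef_of_le_neg_one {x : ℝ} (hx : x ≤ -1) : etaRef h x = Real.pi - Real.arcsin h := by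
  rw [etaRef, Real.smoothTransition.zero_of_nonpos (by linarith)]; ring

theorem memLp_of_continuous_of_vanish {f : ℝ → ℝ} (hf : Continuous f) {R : ℝ}
    (h : ∀ x, R < |x| → f x = 0) : MemLp f 2 :=
  hf.memLp_of_hasCompactSupport (HasCompactSupport.intro (isCompact_closedBall (0 : ℝ) R)
    fun x hx => h x (by simpa [Real.dist_eq] using hx))

theorem memLp_deriv_etaRef (h : ℝ) : MemLp (deriv (etaRef h)) 2 := by
  refine memLp_of_continuous_of_vanish ((contDiff_etaRef h).continuous_deriv (by simp)) (R := 1)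
    fun x hx => ?_
  rcases lt_abs.mp hx with hx | hx
  · have : etaRef h =ᶠ[𝓝 x] fun _ => Real.arcsin h := by
      filter_upwards [lt_mem_nhds hx] with y hy using etaRef_of_one_le (le_of_lt hy)
    rw [this.deriv_eq, deriv_const]
  · have : etaRef h =ᶠ[𝓝 x] fun _ => Real.pi - Real.arcsin h := by
      filter_upwards [gt_mem_nhds (show x < -1 by linarith)] with y hy
        using etaRef_of_le_neg_one (le_of_lt hy)
    rw [this.deriv_eq, deriv_const]

theorem isPrimitive_etaRef (h : ℝ) : IsPrimitive (etaRef h) (deriv (etaRef h)) :=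
  IsPrimitive.of_hasDerivAt
    (fun x => ((contDiff_etaRef h).differentiable (by simp) x).hasDerivAt)
    ((contDiff_etaRef h).continuous_deriv (by simp))

theorem memLp_sin_etaRef (h0 : 0 ≤ h) (h1 : h < 1) :
    MemLp (fun x => Real.sin (etaRef h x) - h) 2 := by
  have hc := (contDiff_etaRef h).continuous
  refine memLp_of_continuous_of_vanish (by fun_prop) (R := 1) fun x hx => ?_
  rcases lt_abs.mp hx with hx | hx
  · rw [etaRef_of_one_le hx.le, Real.sin_arcsin (by linarith) h1.le, sub_self]
  · rw [etaRef_of_le_neg_one (by linarith), Real.sin_pi_sub, Real.sin_arcsin (by linarith) h1.le,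
      sub_self]

/-- Admissible angles have continuous representatives, which are walls joining the two
equilibria. -/
theorem Admissible.exists_isWall (h0 : 0 ≤ h) (h1 : h < 1) (hφ : Admissible h φ) :
    ∃ θ g, φ =ᵐ[volume] θ ∧ IsWall h θ g ∧ Tendsto θ atTop (𝓝 (Real.arcsin h)) ∧
      Tendsto θ atBot (𝓝 (Real.pi - Real.arcsin h)) := by
  obtain ⟨hL, g, hg, hg2⟩ := hφ
  obtain ⟨F, hF, hP⟩ := hg.exists_isPrimitive
  have hF2 : MemLp F 2 := (memLp_congr_ae hF).mp hL
  have hlim := hP.tendsto_zero_of_memLp hF2 hg2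
  have hcF := hP.continuous
  have hcη := (contDiff_etaRef h).continuous
  refine ⟨fun x => F x + etaRef h x, fun x => g x + deriv (etaRef h) x, ?_,
    ⟨hP.add (isPrimitive_etaRef h), hg2.add (memLp_deriv_etaRef h), ?_⟩, ?_, ?_⟩
  · filter_upwards [hF] with x hx
    linarith
  · have h3 : MemLp (fun x => Real.sin (F x + etaRef h x) - Real.sin (etaRef h x)) 2 := by
      refine hF2.mono (Continuous.aestronglyMeasurable (by fun_prop))
        (Eventually.of_forall fun x => ?_)
      simpa [Real.dist_eq] using lipschitzWith_sin.dist_le_mul (F x + etaRef h x) (etaRef h x)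
    refine (h3.add (memLp_sin_etaRef h0 h1)).ae_eq (Eventually.of_forall fun x => ?_)
    simp
  · have : Tendsto (etaRef h) atTop (𝓝 (Real.arcsin h)) :=
      tendsto_const_nhds.congr' (by
        filter_upwards [eventually_ge_atTop 1] with x hx using (etaRef_of_one_le hx).symm)
    simpa using hlim.1.add this
  · have : Tendsto (etaRef h) atBot (𝓝 (Real.pi - Real.arcsin h)) :=
      tendsto_const_nhds.congr' (by
        filter_upwards [eventually_le_atBot (-1)] with x hx using (etaRef_of_le_neg_one hx).symm)
    simpa using hlim.2.add this

/-- Near +∞ the angle, and near -∞ its supplement, lies in [-π/2, π/2], where the distance to the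
limit is controlled by |sin θ - h|, which is square integrable. The remaining compact interval
contributes a bounded term. -/
theorem IsWall.admissible (h0 : 0 ≤ h) (h1 : h < 1) (hw : IsWall h θ g)
    (ht : Tendsto θ atTop (𝓝 (Real.arcsin h)))
    (hb : Tendsto θ atBot (𝓝 (Real.pi - Real.arcsin h))) : Admissible h θ := by
  obtain ⟨c, hc0, hc⟩ := exists_abs_sub_le_sin_sub h0 h1
  have hcθ := hw.prim.continuous
  have hcη := (contDiff_etaRef h).continuous
  have hah : Real.arcsin h < Real.pi / 2 := Real.arcsin_lt_pi_div_two.mpr h1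
  have hah0 : 0 ≤ Real.arcsin h := Real.arcsin_nonneg.mpr h0
  have hpi := Real.pi_pos
  have e1 : ∀ᶠ x in atTop, |θ x - etaRef h x| ≤ c * |Real.sin (θ x) - h| := by
    filter_upwards [eventually_ge_atTop 1, ht.eventually (lt_mem_nhds
      (show -(Real.pi / 2) < Real.arcsin h by linarith)), ht.eventually (gt_mem_nhds hah)]
      with x hx a b
    rw [etaRef_of_one_le hx]
    exact hc _ ⟨a.le, b.le⟩
  have e2 : ∀ᶠ x in atBot, |θ x - etaRef h x| ≤ c * |Real.sin (θ x) - h| := by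
    filter_upwards [eventually_le_atBot (-1), hb.eventually (lt_mem_nhds
      (show Real.pi / 2 < Real.pi - Real.arcsin h by linarith)), hb.eventually (gt_mem_nhds
      (show Real.pi - Real.arcsin h < Real.pi + Real.pi / 2 by linarith))] with x hx a b
    rw [etaRef_of_le_neg_one hx]
    have := hc (Real.pi - θ x) ⟨by linarith, by linarith⟩
    rw [Real.sin_pi_sub] at this
    rwa [show θ x - (Real.pi - Real.arcsin h) = -(Real.pi - θ x - Real.arcsin h) by ring, abs_neg]
  obtain ⟨a, ha⟩ := eventually_atTop.mp e1
  obtain ⟨b, hb'⟩ := eventually_atBot.mp e2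
  obtain ⟨M, hM⟩ := isCompact_Icc.exists_bound_of_continuousOn (s := Set.Icc b a)
    (f := fun x => θ x - etaRef h x) (by fun_prop)
  have hM2 : MemLp ((Set.Icc b a).indicator fun _ => M) 2 (volume : Measure ℝ) :=
    memLp_indicator_const 2 measurableSet_Icc M (Or.inr (by simp))
  refine ⟨?_, _, (hw.prim.sub (isPrimitive_etaRef h)).isWeakDeriv,
    hw.memLp_deriv.sub (memLp_deriv_etaRef h)⟩
  refine ((hw.memLp_sin.norm.const_mul c).add hM2.norm).mono'
    (Continuous.aestronglyMeasurable (by fun_prop)) (Eventually.of_forall fun x => ?_)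
  simp only [Pi.add_apply, Real.norm_eq_abs]
  rcases le_or_gt a x with hx | hx
  · exact (ha x hx).trans (le_add_of_nonneg_right (abs_nonneg _))
  rcases le_or_gt x b with hx' | hx'
  · exact (hb' x hx').trans (le_add_of_nonneg_right (abs_nonneg _))
  · rw [Set.indicator_of_mem (show x ∈ Set.Icc b a from ⟨hx'.le, hx.le⟩)]
    have : |θ x - etaRef h x| ≤ M := hM x ⟨hx'.le, hx.le⟩
    exact (this.trans (le_abs_self M)).trans (le_add_of_nonneg_left (by positivity))

theorem exists_eq_pi_div_two (h1 : h < 1) (hc : Continuous θ)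
    (ht : Tendsto θ atTop (𝓝 (Real.arcsin h)))
    (hb : Tendsto θ atBot (𝓝 (Real.pi - Real.arcsin h))) : ∃ b, θ b = Real.pi / 2 := by
  have hah : Real.arcsin h < Real.pi / 2 := Real.arcsin_lt_pi_div_two.mpr h1
  obtain ⟨x, hx⟩ := (ht.eventually (gt_mem_nhds hah)).exists
  obtain ⟨y, hy⟩ := (hb.eventually (lt_mem_nhds
    (show Real.pi / 2 < Real.pi - Real.arcsin h by linarith))).exists
  exact mem_range_of_exists_le_of_exists_ge hc (Exists.intro x hx.le) (Exists.intro y hy.le)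

end NeelWall

/-! ### From the folded minimizer to a monotone minimizing wall. -/

namespace NeelWall

open scoped ENNReal

variable {ν h : ℝ} {ψ g : ℝ → ℝ}

/-- Reflection of the left half of the graph of a folded profile. -/
noncomputable def unfold (ψ : ℝ → ℝ) (x : ℝ) : ℝ := if 0 ≤ x then ψ x else Real.pi - ψ x

theorem sin_unfold (ψ : ℝ → ℝ) (x : ℝ) : Real.sin (unfold ψ x) = Real.sin (ψ x) := by
  unfold NeelWall.unfold
  split_ifs
  · rfl
  · exact Real.sin_pi_sub _

/-- The value π/2 at 0 is the fixed point of ψ ↦ π - ψ, so no jump appears at the fold. -/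
theorem isPrimitive_unfold (h0 : ψ 0 = Real.pi / 2) (hP : IsPrimitive ψ g) :
    IsPrimitive (unfold ψ) (fun x => if 0 ≤ x then g x else -g x) := by
  have hG : LocallyIntegrable fun x => if 0 ≤ x then g x else -g x := by
    refine hP.1.mono ?_ (Eventually.of_forall fun x => ?_)
    · exact AEStronglyMeasurable.piecewise (s := Set.Ici 0) measurableSet_Ici
        hP.1.aestronglyMeasurable.restrict hP.1.aestronglyMeasurable.neg.restrict
    · split_ifs <;> simp
  have key : ∀ x, unfold ψ x - Real.pi / 2 = ∫ t in (0 : ℝ)..x, if 0 ≤ t then g t else -g t := by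
    intro x
    rcases le_or_gt 0 x with hx | hx
    · rw [unfold, if_pos hx, ← h0, hP.2]
      refine intervalIntegral.integral_congr fun t ht => ?_
      rw [Set.uIcc_of_le hx] at ht
      simp [ht.1]
    · rw [unfold, if_neg hx.not_ge]
      have h2 : ∫ t in (0 : ℝ)..x, (if 0 ≤ t then g t else -g t) = ∫ t in (0 : ℝ)..x, -g t := by
        refine intervalIntegral.integral_congr_ae ?_
        filter_upwards [compl_mem_ae_iff.mpr (measure_singleton (0 : ℝ))] with t ht hm
        rw [Set.uIoc_of_ge hx.le] at hm
        have : t < 0 := lt_of_le_of_ne hm.2 ht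
        simp [this.not_ge]
      rw [h2, intervalIntegral.integral_neg, ← hP.2, h0]
      ring
  refine ⟨hG, fun a b => ?_⟩
  rw [← intervalIntegral.integral_interval_sub_left
    (intervalIntegrable_of_locallyIntegrable hG 0 b)
    (intervalIntegrable_of_locallyIntegrable hG 0 a), ← key, ← key]
  ring

/-- Existence of a monotone energy minimizer. -/
theorem exists_minimizing_wall (hν : 0 < ν) (h0 : 0 ≤ h) (h1 : h < 1) :
    ∃ θ g, IsWall h θ g ∧ Antitone θ ∧ Tendsto θ atTop (𝓝 (Real.arcsin h)) ∧
      Tendsto θ atBot (𝓝 (Real.pi - Real.arcsin h)) ∧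
      ∀ φ, Admissible h φ → energy ν h θ ≤ energy ν h φ := by
  set κ := ENNReal.ofReal (ν / 2) / gagliardoConst with hκdef
  have hκ : κ ≠ ⊤ := ENNReal.div_ne_top (by simp) gagliardoConst_ne_zero
  have hfold : ∀ φ, Admissible h φ → ∃ χ, IsFolded χ ∧
      foldedEnergy h κ χ ≤ ENNReal.ofReal (2 * energy ν h φ) ∧ 0 ≤ energy ν h φ := by
    intro φ hφ
    obtain ⟨θ, g, he, hw, ht, hb⟩ := hφ.exists_isWall h0 h1
    obtain ⟨b, hb⟩ := exists_eq_pi_div_two h1 hw.prim.continuous ht hb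
    exact ⟨_, isFolded_fold hw.prim.continuous hb, hw.foldedEnergy_fold_le hν he b,
      hw.energy_nonneg hν he⟩
  -- The reference profile shows that finite-energy competitors exist.
  have hη : Admissible h (etaRef h) := by
    refine ⟨by simp, deriv fun x => etaRef h x - etaRef h x, ?_, by simp⟩
    simp only [sub_self, deriv_const']
    exact (IsPrimitive.of_hasDerivAt (fun x => hasDerivAt_const x (0 : ℝ))
      continuous_const).isWeakDeriv
  obtain ⟨ψ, hψ, hE, hmin⟩ := exists_minimizer h0 h1 hκ (by
    obtain ⟨χ, hχ, hle, -⟩ := hfold _ hη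
    exact ⟨χ, hχ, ne_top_of_le_ne_top ENNReal.ofReal_ne_top hle⟩)
  obtain ⟨hsym, hanti⟩ := minimizer_symmetric_decreasing hψ hE hmin
  obtain ⟨hL, g, hP, hg, hle⟩ := hψ.exists_isPrimitive h0 h1 hE
  have hlim := (hP.sub_const (Real.arcsin h)).tendsto_zero_of_memLp hL hg
  have hPu := isPrimitive_unfold hψ.zero hP
  have hsq : ∀ x, (if 0 ≤ x then g x else -g x) ^ 2 = g x ^ 2 := fun x => by split_ifs <;> ring
  have hw : IsWall h (unfold ψ) (fun x => if 0 ≤ x then g x else -g x) := by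
    refine ⟨hPu, ?_, ?_⟩
    · refine hg.mono hPu.1.aestronglyMeasurable (Eventually.of_forall fun x => ?_)
      split_ifs <;> simp
    · simp only [sin_unfold]
      refine memLp_two_of_lintegral (by have := hψ.continuous; fun_prop) ?_
      exact ne_top_of_le_ne_top hE ((le_add_self.trans le_self_add).trans hle)
  refine ⟨unfold ψ, _, hw, ?_, ?_, ?_, fun φ hφ => ?_⟩
  · intro x y hxy
    have := (hψ.mem x).2
    have := (hψ.mem y).2
    unfold NeelWall.unfold
    split_ifs with hy hx hx
    · exact hanti hx hy hxy
    · linarith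
    · linarith
    · have := hanti (show -y ∈ Set.Ici 0 by simp only [Set.mem_Ici]; linarith)
        (show -x ∈ Set.Ici 0 by simp only [Set.mem_Ici]; linarith) (by linarith)
      rw [hsym, hsym] at this
      linarith
  · have : Tendsto ψ atTop (𝓝 (Real.arcsin h)) := by
      simpa using hlim.1.add_const (Real.arcsin h)
    refine this.congr' ?_
    filter_upwards [eventually_ge_atTop 0] with x hx
    rw [unfold, if_pos hx]
  · have : Tendsto ψ atBot (𝓝 (Real.arcsin h)) := by
      simpa using hlim.2.add_const (Real.arcsin h)
    refine (this.const_sub Real.pi).congr' ?_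
    filter_upwards [eventually_lt_atBot 0] with x hx
    rw [unfold, if_neg hx.not_ge]
  · obtain ⟨χ, hχ, hχle, hnn⟩ := hfold φ hφ
    have h3 : ENNReal.ofReal (2 * energy ν h (unfold ψ)) ≤ ENNReal.ofReal (2 * energy ν h φ) := by
      rw [hw.ofReal_energy hν EventuallyEq.rfl]
      simp only [hsq, sin_unfold]
      exact hle.trans ((hmin χ hχ).trans hχle)
    -- `ENNReal.ofReal` truncates negative numbers, hence the nonnegativity of the competitor's
    -- energy carried along in `hfold`.
    rw [ENNReal.ofReal_le_ofReal_iff (by positivity)] at h3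
    linarith

end NeelWall

/-! ### First variation and the weak Euler–Lagrange equation. -/

namespace NeelWall

open scoped ENNReal

variable {ν h : ℝ} {θ g v : ℝ → ℝ}

theorem abs_sin_add_sub_le (a t : ℝ) : |Real.sin (a + t) - Real.sin a - t * Real.cos a| ≤ t ^ 2 := by
  have e : Real.sin (a + t) - Real.sin a - t * Real.cos a =
      Real.sin a * (Real.cos t - 1) + Real.cos a * (Real.sin t - t) := by
    rw [Real.sin_add]; ring
  have h1 : |Real.cos t - 1| ≤ t ^ 2 / 2 := by
    rw [abs_le]
    constructor <;> nlinarith [Real.one_sub_sq_div_two_le_cos (x := t), Real.cos_le_one t]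
  have h2 : |Real.sin t - t| ≤ t ^ 2 / 2 := by
    have hpos : ∀ s : ℝ, 0 ≤ s → |Real.sin s - s| ≤ s ^ 2 / 2 := by
      intro s hs
      rw [abs_sub_comm, abs_of_nonneg (by linarith [Real.sin_le hs])]
      have hder : ∀ y, HasDerivAt (fun y => y ^ 2 / 2 - y + Real.sin y) (y - 1 + Real.cos y) y := by
        intro y
        have := (((hasDerivAt_id y).pow 2).div_const 2).sub (hasDerivAt_id y) |>.add
          (Real.hasDerivAt_sin y)
        refine this.congr_deriv ?_
        simp
      have hmono : MonotoneOn (fun y => y ^ 2 / 2 - y + Real.sin y) (Set.Ici 0) := by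
        refine monotoneOn_of_deriv_nonneg (convex_Ici 0) (by fun_prop)
          (fun y _ => (hder y).differentiableAt.differentiableWithinAt) fun y hy => ?_
        rw [interior_Ici, Set.mem_Ioi] at hy
        rw [(hder y).deriv]
        rcases le_or_gt y 2 with h2 | h2
        · nlinarith [Real.one_sub_sq_div_two_le_cos (x := y)]
        · linarith [Real.neg_one_le_cos y]
      have := hmono Set.self_mem_Ici hs hs
      simp only [Real.sin_zero] at this
      linarith
    rcases le_or_gt 0 t with ht | ht
    · exact hpos t ht
    · have := hpos (-t) (by linarith)
      rwa [Real.sin_neg, show -Real.sin t - -t = -(Real.sin t - t) by ring, abs_neg, neg_sq] at this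
  rw [e]
  refine (abs_add_le _ _).trans ?_
  rw [abs_mul, abs_mul]
  have := mul_le_mul (Real.abs_sin_le_one a) h1 (abs_nonneg _) zero_le_one
  have := mul_le_mul (Real.abs_cos_le_one a) h2 (abs_nonneg _) zero_le_one
  linarith

theorem memLp_continuous_bounded_mul {f φ : ℝ → ℝ} (hφ : Continuous φ) {C : ℝ}
    (hC : ∀ x, |φ x| ≤ C) (hf : MemLp f 2) : MemLp (fun x => φ x * f x) 2 := by
  refine hf.of_le_mul (c := C) (hφ.aestronglyMeasurable.mul hf.1)
    (Eventually.of_forall fun x => ?_)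
  rw [norm_mul]
  exact mul_le_mul_of_nonneg_right (hC x) (norm_nonneg _)

theorem integrable_mul_of_memLp {f k : ℝ → ℝ} (hf : MemLp f 2) (hk : MemLp k 2) :
    Integrable fun x => f x * k x :=
  hf.integrable_mul hk

theorem integrable_fun_add {f k : ℝ → ℝ} (hf : Integrable f) (hk : Integrable k) :
    Integrable fun x => f x + k x :=
  hf.add hk

/-- Quadratic upper bound for the energy along an affine variation. -/
theorem IsWall.energy_variation_le (hν : 0 < ν) (hw : IsWall h θ g)
    (hv : HalfLap (fun x => Real.sin (θ x) - h) v) {χ : ℝ → ℝ} (hχ : ContDiff ℝ (⊤ : ℕ∞) χ)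
    (hs : HasCompactSupport χ) : ∃ K, ∀ ε : ℝ, ∃ gε, IsWall h (fun x => θ x + ε * χ x) gε ∧
      2 * energy ν h (fun x => θ x + ε * χ x) ≤ 2 * energy ν h θ +
        2 * ε * ((∫ x, g x * deriv χ x) +
          ∫ x, Real.cos (θ x) * (Real.sin (θ x) - h + ν / 2 * v x) * χ x) + ε ^ 2 * K := by
  set p : ℝ → ℝ := fun x => Real.sin (θ x) - h + ν / 2 * v x
  have hp : MemLp p 2 := hw.memLp_sin.add (hv.2.1.const_mul _)
  have hcθ := hw.prim.continuous
  have hcχ := hχ.continuous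
  have hcχ' : Continuous (deriv χ) := hχ.continuous_deriv (by simp)
  have hPχ : IsPrimitive χ (deriv χ) :=
    IsPrimitive.of_hasDerivAt (fun x => (hχ.differentiable (by simp) x).hasDerivAt) hcχ'
  have hχ2 : MemLp χ 2 := hcχ.memLp_of_hasCompactSupport hs
  have hχ'2 : MemLp (deriv χ) 2 := hcχ'.memLp_of_hasCompactSupport hs.deriv
  obtain ⟨C, hC⟩ := hcχ.bounded_above_of_compact_support hs
  have hχχ2 : MemLp (fun x => χ x * χ x) 2 := memLp_continuous_bounded_mul hcχ hC hχ2
  have hχg : MemLp (fun x => |χ x| * |g x| + |deriv χ x|) 2 := by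
    refine (memLp_continuous_bounded_mul (φ := fun x => |χ x|) (by fun_prop) (C := C)
      (fun x => by simpa using hC x) hw.memLp_deriv.norm).add hχ'2.norm
  -- The summands bound, in order, the Dirichlet term, the second-order remainder of the sine paired
  -- with p, the square of the change w of the sine, and the nonlocal form of w. Bounds by ε²
  -- suffice; the energy need not be shown differentiable.
  refine ⟨(∫ x, deriv χ x ^ 2) + 2 * (∫ x, χ x * χ x * |p x|) + (∫ x, χ x ^ 2) +
    ν / 2 * (1 / 2 * ((∫ x, χ x ^ 2) + ∫ x, (|χ x| * |g x| + |deriv χ x|) ^ 2)), fun ε => ?_⟩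
  set θε : ℝ → ℝ := fun x => θ x + ε * χ x
  have hPε : IsPrimitive θε (fun x => g x + ε * deriv χ x) := hw.prim.add (hPχ.const_mul ε)
  have hcε : Continuous θε := hPε.continuous
  set w : ℝ → ℝ := fun x => Real.sin (θε x) - Real.sin (θ x) with hwdef
  have hwle : ∀ x, |w x| ≤ |ε * χ x| := fun x => by
    have := lipschitzWith_sin.dist_le_mul (θε x) (θ x)
    simpa [Real.dist_eq, θε] using this
  have hw2 : MemLp w 2 := (hχ2.const_mul ε).mono (Continuous.aestronglyMeasurable (by fun_prop))
    (Eventually.of_forall hwle)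
  have hwallε : IsWall h θε (fun x => g x + ε * deriv χ x) := by
    refine ⟨hPε, hw.memLp_deriv.add (hχ'2.const_mul ε), ?_⟩
    refine (hw.memLp_sin.add hw2).ae_eq (Eventually.of_forall fun x => ?_)
    simp [w]
  refine ⟨_, hwallε, ?_⟩
  obtain ⟨vε, hvε⟩ := hwallε.exists_halfLap
  have hz : HalfLap w (fun x => vε x - v x) :=
    (hvε.sub hv).congr_left (Eventually.of_forall fun x => by simp [w])
  have hw' : IsPrimitive w
      (fun x => Real.cos (θε x) * (g x + ε * deriv χ x) - Real.cos (θ x) * g x) :=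
    hPε.sin.sub hw.prim.sin
  have hw'2 : MemLp
      (fun x => Real.cos (θε x) * (g x + ε * deriv χ x) - Real.cos (θ x) * g x) 2 :=
    hwallε.memLp_cos_mul.sub hw.memLp_cos_mul
  have hzw := hz.integral_sq_eq hw'.isWeakDeriv hw'2
  have a1 : ∫ x, (g x + ε * deriv χ x) ^ 2 = (∫ x, g x ^ 2) + 2 * ε * (∫ x, g x * deriv χ x) +
      ε ^ 2 * ∫ x, deriv χ x ^ 2 := by
    have i1 := hw.memLp_deriv.integrable_sq
    have i2 := integrable_mul_of_memLp hw.memLp_deriv hχ'2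
    have i3 := hχ'2.integrable_sq
    rw [← integral_const_mul, ← integral_const_mul, ← integral_add i1 (i2.const_mul _),
      ← integral_add (integrable_fun_add i1 (i2.const_mul _)) (i3.const_mul _)]
    exact integral_congr_ae (Eventually.of_forall fun x => by simp; ring)
  have a2 : ∫ x, (Real.sin (θε x) - h) ^ 2 = (∫ x, (Real.sin (θ x) - h) ^ 2) +
      2 * (∫ x, w x * (Real.sin (θ x) - h)) + ∫ x, w x ^ 2 := by
    have i1 := hw.memLp_sin.integrable_sq
    have i2 := integrable_mul_of_memLp hw2 hw.memLp_sin
    have i3 := hw2.integrable_sq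
    rw [← integral_const_mul, ← integral_add i1 (i2.const_mul _),
      ← integral_add (integrable_fun_add i1 (i2.const_mul _)) i3]
    exact integral_congr_ae (Eventually.of_forall fun x => by simp [w]; ring)
  have a3 : ∫ x, (Real.sin (θε x) - h) * vε x = (∫ x, (Real.sin (θ x) - h) * v x) +
      2 * (∫ x, w x * v x) + ∫ x, w x * (vε x - v x) := by
    have i1 := integrable_mul_of_memLp hw.memLp_sin hv.2.1
    have i2 := integrable_mul_of_memLp hw2 hv.2.1
    have i3 := integrable_mul_of_memLp hw2 hz.2.1
    have i4 := integrable_mul_of_memLp hw.memLp_sin hz.2.1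
    have hsymm := hv.symm hz
    rw [two_mul]
    nth_rewrite 2 [← hsymm]
    rw [← add_assoc, ← integral_add i1 i2, ← integral_add (integrable_fun_add i1 i2) i4,
      ← integral_add (integrable_fun_add (integrable_fun_add i1 i2) i4) i3]
    exact integral_congr_ae (Eventually.of_forall fun x => by simp [w]; ring)
  have hcp : MemLp (fun x => Real.cos (θ x) * p x) 2 :=
    memLp_continuous_bounded_mul (by fun_prop) (fun x => Real.abs_cos_le_one _) hp
  have j1 : Integrable fun x => Real.cos (θ x) * p x * χ x := hcp.integrable_mul hχ2
  have j2 : Integrable fun x => χ x * χ x * |p x| := hχχ2.integrable_mul hp.norm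
  have a4 : (∫ x, w x * (Real.sin (θ x) - h)) + ν / 2 * (∫ x, w x * v x) ≤
      ε * (∫ x, Real.cos (θ x) * p x * χ x) + ε ^ 2 * ∫ x, χ x * χ x * |p x| := by
    have i1 := integrable_mul_of_memLp hw2 hw.memLp_sin
    have i2 := integrable_mul_of_memLp hw2 hv.2.1
    rw [← integral_const_mul, ← integral_const_mul, ← integral_const_mul,
      ← integral_add i1 (i2.const_mul _), ← integral_add (j1.const_mul _) (j2.const_mul _)]
    refine integral_mono (integrable_fun_add i1 (i2.const_mul _)) ((j1.const_mul _).add (j2.const_mul _))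
      fun x => ?_
    have b1 := abs_sin_add_sub_le (θ x) (ε * χ x)
    have b2 := (le_abs_self _).trans ((abs_mul (Real.sin (θ x + ε * χ x) - Real.sin (θ x) -
      ε * χ x * Real.cos (θ x)) (p x)).le.trans (mul_le_mul_of_nonneg_right b1 (abs_nonneg (p x))))
    simp only [w, θε]
    have b3 : (Real.sin (θ x + ε * χ x) - Real.sin (θ x)) * (Real.sin (θ x) - h) +
        ν / 2 * ((Real.sin (θ x + ε * χ x) - Real.sin (θ x)) * v x) =
        (Real.sin (θ x + ε * χ x) - Real.sin (θ x)) * p x := by simp only [p]; ring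
    rw [b3]
    linarith
  have a5 : ∫ x, w x ^ 2 ≤ ε ^ 2 * ∫ x, χ x ^ 2 := by
    rw [← integral_const_mul]
    refine integral_mono hw2.integrable_sq (hχ2.integrable_sq.const_mul _) fun x => ?_
    simp only [← mul_pow]
    exact sq_le_sq.mpr (hwle x)
  -- By Young's inequality and the equality of the L² norms of the half-Laplacian and the
  -- derivative, the nonlocal form of w is controlled by its H¹ norm, of order |ε|.
  have a6 : ∫ x, w x * (vε x - v x) ≤ 1 / 2 * ((∫ x, w x ^ 2) +
      ∫ x, (vε x - v x) ^ 2) := by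
    have i1 := hw2.integrable_sq
    have i2 := hz.2.1.integrable_sq
    rw [← integral_add i1 i2, ← integral_const_mul]
    refine integral_mono (hw2.integrable_mul hz.2.1) ((i1.add i2).const_mul _) fun x => ?_
    nlinarith [sq_nonneg (w x - (vε x - v x))]
  have a7 : ∫ x, (vε x - v x) ^ 2 ≤ ε ^ 2 * ∫ x, (|χ x| * |g x| + |deriv χ x|) ^ 2 := by
    rw [hzw, ← integral_const_mul]
    refine integral_mono hw'2.integrable_sq (hχg.integrable_sq.const_mul _) fun x => ?_
    simp only [← mul_pow]
    refine sq_le_sq.mpr ?_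
    have c1 : |Real.cos (θε x) - Real.cos (θ x)| ≤ |ε * χ x| := by
      have := lipschitzWith_cos.dist_le_mul (θε x) (θ x)
      simpa [Real.dist_eq, θε] using this
    have c2 : Real.cos (θε x) * (g x + ε * deriv χ x) - Real.cos (θ x) * g x =
      (Real.cos (θε x) - Real.cos (θ x)) * g x + Real.cos (θε x) * (ε * deriv χ x) := by ring
    rw [c2]
    refine (abs_add_le _ _).trans ?_
    rw [abs_mul, abs_mul (Real.cos _), abs_mul ε (|χ x| * |g x| + |deriv χ x|),
      abs_of_nonneg (show 0 ≤ |χ x| * |g x| + |deriv χ x| by positivity), mul_add, ← mul_assoc,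
      ← abs_mul ε (χ x), ← abs_mul ε (deriv χ x)]
    refine add_le_add (mul_le_mul_of_nonneg_right c1 (abs_nonneg _)) ?_
    exact mul_le_of_le_one_left (abs_nonneg _) (Real.abs_cos_le_one _)
  rw [hwallε.energy_eq EventuallyEq.rfl hvε, hw.energy_eq EventuallyEq.rfl hv, a1, a2, a3]
  have a8 := mul_le_mul_of_nonneg_left a6 (show 0 ≤ ν / 2 by positivity)
  have a9 := mul_le_mul_of_nonneg_left a5 (show 0 ≤ ν / 2 by positivity)
  have a10 := mul_le_mul_of_nonneg_left a7 (show 0 ≤ ν / 2 by positivity)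
  linarith

/-- At ε = -a / (|K| + 1) the linear term dominates and makes the expression negative unless `a`
vanishes. -/
theorem eq_zero_of_forall_quadratic {a K : ℝ} (h : ∀ ε : ℝ, 0 ≤ 2 * ε * a + ε ^ 2 * K) : a = 0 := by
  have hK : 0 < |K| + 1 := by positivity
  have h1 := h (-a / (|K| + 1))
  have e : 2 * (-a / (|K| + 1)) * a + (-a / (|K| + 1)) ^ 2 * K =
      a ^ 2 * (K - 2 * (|K| + 1)) / (|K| + 1) ^ 2 := by field_simp; ring
  rw [e, le_div_iff₀ (by positivity), zero_mul] at h1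
  have h2 : K - 2 * (|K| + 1) < 0 := by linarith [le_abs_self K]
  by_contra ha
  have : 0 < a ^ 2 := by positivity
  nlinarith

/-- The weak Euler–Lagrange equation of a minimizer. -/
theorem IsWall.isWeakDeriv_of_minimal (hν : 0 < ν) (h0 : 0 ≤ h) (h1 : h < 1) (hw : IsWall h θ g)
    (ht : Tendsto θ atTop (𝓝 (Real.arcsin h)))
    (hb : Tendsto θ atBot (𝓝 (Real.pi - Real.arcsin h)))
    (hmin : ∀ φ, Admissible h φ → energy ν h θ ≤ energy ν h φ)
    (hv : HalfLap (fun x => Real.sin (θ x) - h) v) :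
    IsWeakDeriv g (fun x => Real.cos (θ x) * (Real.sin (θ x) - h + ν / 2 * v x)) := by
  have hcθ := hw.prim.continuous
  refine ⟨hw.prim.1, locallyIntegrable_continuous_mul
    ((hw.memLp_sin.add (hv.2.1.const_mul _)).locallyIntegrable (by norm_num)) (by fun_prop),
    fun χ hχ hs => ?_⟩
  obtain ⟨K, hK⟩ := hw.energy_variation_le hν hv hχ hs
  have hlim : ∀ ε : ℝ, Tendsto (fun x => ε * χ x) atTop (𝓝 0) ∧
      Tendsto (fun x => ε * χ x) atBot (𝓝 0) := by
    intro ε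
    obtain ⟨R, -, hR⟩ := exists_forall_abs_ge_eq_zero_of_compactSupport hs
    constructor <;> refine tendsto_const_nhds.congr' ?_
    · filter_upwards [eventually_ge_atTop R] with x hx
      rw [hR x (hx.trans (le_abs_self x)), mul_zero]
    · filter_upwards [eventually_le_atBot (-R)] with x hx
      rw [hR x ((le_neg_of_le_neg hx).trans (neg_le_abs x)), mul_zero]
  have := eq_zero_of_forall_quadratic (K := K) (a := (∫ x, g x * deriv χ x) +
      ∫ x, Real.cos (θ x) * (Real.sin (θ x) - h + ν / 2 * v x) * χ x) fun ε => by
    obtain ⟨gε, hwε, hle⟩ := hK ε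
    have := hmin _ (hwε.admissible h0 h1 (by simpa using ht.add (hlim ε).1)
      (by simpa using hb.add (hlim ε).2))
    linarith
  linarith

end NeelWall

/-! ### Elliptic regularity. -/

namespace NeelWall

open scoped ENNReal

/-- The Sobolev space `H^k(ℝ)`. -/
def Sobolev : ℕ → (ℝ → ℝ) → Prop
  | 0, f => MemLp f 2
  | k + 1, f => MemLp f 2 ∧ ∃ g, IsWeakDeriv f g ∧ Sobolev k g

/-- Bounded continuous functions with derivative in `H^(k-1)(ℝ)`. -/
def BddSobolev : ℕ → (ℝ → ℝ) → Prop
  | 0, f => Continuous f ∧ ∃ C, ∀ x, |f x| ≤ C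
  | k + 1, f => (Continuous f ∧ ∃ C, ∀ x, |f x| ≤ C) ∧ ∃ g, IsPrimitive f g ∧ Sobolev k g

variable {k : ℕ} {f u g : ℝ → ℝ}

theorem Sobolev.memLp (hf : Sobolev k f) : MemLp f 2 := by
  cases k with
  | zero => exact hf
  | succ k => exact hf.1

theorem Sobolev.congr (hf : Sobolev k f) (he : f =ᵐ[volume] u) : Sobolev k u := by
  cases k with
  | zero => exact (memLp_congr_ae he).mp hf
  | succ k =>
    obtain ⟨h1, g, hg, hk⟩ := hf
    exact ⟨(memLp_congr_ae he).mp h1, g, hg.congr he EventuallyEq.rfl, hk⟩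

theorem Sobolev.of_succ : ∀ {k : ℕ} {f : ℝ → ℝ}, Sobolev (k + 1) f → Sobolev k f
  | 0, _, hf => hf.1
  | _ + 1, _, ⟨h1, g, hg, hk⟩ => ⟨h1, g, hg, hk.of_succ⟩

theorem Sobolev.exists_primitive (hf : Sobolev (k + 1) f) :
    ∃ F g, f =ᵐ[volume] F ∧ IsPrimitive F g ∧ MemLp F 2 ∧ Sobolev k g := by
  obtain ⟨h1, g, hg, hk⟩ := hf
  obtain ⟨F, hF, hP⟩ := hg.exists_isPrimitive
  exact ⟨F, g, hF, hP, (memLp_congr_ae hF).mp h1, hk⟩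

theorem Sobolev.add : ∀ {k : ℕ} {f u : ℝ → ℝ}, Sobolev k f → Sobolev k u →
    Sobolev k fun x => f x + u x
  | 0, _, _, hf, hu => MemLp.add hf hu
  | k + 1, f, u, hf, hu => by
    refine ⟨hf.1.add hu.1, ?_⟩
    obtain ⟨F, g, hF, hP, -, hk⟩ := hf.exists_primitive
    obtain ⟨U, g', hU, hP', -, hk'⟩ := hu.exists_primitive
    refine ⟨_, (hP.add hP').isWeakDeriv.congr ?_ EventuallyEq.rfl, hk.add hk'⟩
    filter_upwards [hF, hU] with x a b
    rw [a, b]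

theorem Sobolev.const_mul (c : ℝ) : ∀ {k : ℕ} {f : ℝ → ℝ}, Sobolev k f →
    Sobolev k fun x => c * f x
  | 0, _, hf => MemLp.const_mul hf c
  | k + 1, f, hf => by
    refine ⟨hf.1.const_mul c, ?_⟩
    obtain ⟨F, g, hF, hP, -, hk⟩ := hf.exists_primitive
    refine ⟨_, (hP.const_mul c).isWeakDeriv.congr ?_ EventuallyEq.rfl, hk.const_mul c⟩
    filter_upwards [hF] with x a
    rw [a]

theorem BddSobolev.of_succ (hf : BddSobolev (k + 1) f) : BddSobolev k f := by
  cases k with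
  | zero => exact hf.1
  | succ k =>
    obtain ⟨h1, g, hg, hk⟩ := hf
    exact ⟨h1, g, hg, hk.of_succ⟩

theorem IsPrimitive.exists_abs_le {F g : ℝ → ℝ} (hP : IsPrimitive F g) (hF : MemLp F 2)
    (hg : MemLp g 2) : ∃ C, ∀ x, |F x| ≤ C := by
  have hlim := hP.tendsto_zero_of_memLp hF hg
  have hc := hP.continuous
  have hlim' : Tendsto F (cocompact ℝ) (𝓝 0) := by
    rw [cocompact_eq_atBot_atTop]
    exact hlim.2.sup hlim.1
  obtain ⟨C, hC⟩ := ZeroAtInftyContinuousMap.bounded (ZeroAtInftyContinuousMap.mk ⟨F, hc⟩ hlim')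
  refine ⟨C + |F 0|, fun x => ?_⟩
  have := hC x 0
  rw [Real.dist_eq] at this
  have h2 := abs_sub_abs_le_abs_sub (F x) (F 0)
  have h3 : |F x - F 0| ≤ C := this
  linarith

theorem BddSobolev.of_primitive {F : ℝ → ℝ} (hP : IsPrimitive F g) (hF : MemLp F 2)
    (hg : Sobolev k g) : BddSobolev (k + 1) F :=
  ⟨⟨hP.continuous, hP.exists_abs_le hF hg.memLp⟩, g, hP, hg⟩

/-- Induction by the Leibniz rule. In f'u the roles are exchanged: u is an H¹ function, hence
bounded, and acts as the multiplier of f'. Sines and cosines of a wall do not generally decay, hence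
the separate class of multipliers. -/
theorem BddSobolev.mul : ∀ {k : ℕ} {f u : ℝ → ℝ}, BddSobolev k f → Sobolev k u →
    Sobolev k fun x => f x * u x
  | 0, _, _, ⟨hc, _, hC⟩, hu => memLp_continuous_bounded_mul hc hC hu
  | k + 1, f, u, hf, hu => by
    obtain ⟨U, u', hU, hPU, hU2, hu'⟩ := hu.exists_primitive
    obtain ⟨⟨hc, C, hC⟩, f', hPf, hf'⟩ := id hf
    refine ⟨memLp_continuous_bounded_mul hc hC hu.1, _,
      (hPf.mul hPU).isWeakDeriv.congr ?_ EventuallyEq.rfl, ?_⟩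
    · filter_upwards [hU] with x hx
      rw [hx]
    · have h1 := (BddSobolev.of_primitive hPU hU2 hu').of_succ.mul hf'
      have h2 := hf.of_succ.mul hu'
      refine (h1.add h2).congr (Eventually.of_forall fun x => ?_)
      ring

/-- The half-Laplacian commutes with differentiation and costs one derivative. -/
theorem Sobolev.halfLap : ∀ {k : ℕ} {u v : ℝ → ℝ}, Sobolev (k + 1) u → HalfLap u v → Sobolev k v
  | 0, _, _, _, h => h.2.1
  | k + 1, u, v, hu, h => by
    obtain ⟨hu2, u', hd, hu'2, u'', hd', hk⟩ := hu
    obtain ⟨w, hw⟩ := halfLap_of_isWeakDeriv hd' hu'2 hk.memLp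
    exact ⟨h.2.1, w, h.isWeakDeriv hd hw, Sobolev.halfLap ⟨hu'2, u'', hd', hk⟩ hw⟩

theorem IsPrimitive.hasDerivAt {F : ℝ → ℝ} (hP : IsPrimitive F g) (hc : Continuous g) (x : ℝ) :
    HasDerivAt F (g x) x := by
  have h1 : HasDerivAt (fun y => F 0 + ∫ t in (0 : ℝ)..y, g t) (g x) x :=
    (intervalIntegral.integral_hasDerivAt_right (hc.intervalIntegrable 0 x)
      (hc.stronglyMeasurableAtFilter _ _) hc.continuousAt).const_add _
  rwa [← hP.eq_add 0] at h1

theorem IsPrimitive.contDiff_succ {F : ℝ → ℝ} (hP : IsPrimitive F g) (hg : ContDiff ℝ k g) :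
    ContDiff ℝ (k + 1 : ℕ) F := by
  have hd := hP.hasDerivAt hg.continuous
  push_cast
  rw [contDiff_succ_iff_deriv]
  refine ⟨fun x => (hd x).differentiableAt, by simp, ?_⟩
  rwa [funext fun x => (hd x).deriv]

theorem Sobolev.exists_contDiff : ∀ {k : ℕ} {f : ℝ → ℝ}, Sobolev (k + 1) f →
    ∃ F, f =ᵐ[volume] F ∧ ContDiff ℝ k F
  | 0, _, hf => by
    obtain ⟨F, g, hF, hP, -⟩ := hf.exists_primitive
    exact ⟨F, hF, by exact_mod_cast (contDiff_zero (𝕜 := ℝ)).mpr hP.continuous⟩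
  | k + 1, _, hf => by
    obtain ⟨F, g, hF, hP, -, hk⟩ := hf.exists_primitive
    obtain ⟨G, hG, hGk⟩ := hk.exists_contDiff
    exact ⟨F, hF, (hP.congr_deriv hG).contDiff_succ hGk⟩

variable {ν h : ℝ} {θ v : ℝ → ℝ}

theorem IsPrimitive.bddSobolev_sin_cos (hP : IsPrimitive θ g) : ∀ {k : ℕ}, Sobolev k g →
    BddSobolev (k + 1) (fun x => Real.sin (θ x)) ∧ BddSobolev (k + 1) (fun x => Real.cos (θ x)) := by
  have hc := hP.continuous
  have bs : Continuous (fun x => Real.sin (θ x)) ∧ ∃ C, ∀ x, |Real.sin (θ x)| ≤ C :=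
    ⟨by fun_prop, 1, fun x => Real.abs_sin_le_one _⟩
  have bc : Continuous (fun x => Real.cos (θ x)) ∧ ∃ C, ∀ x, |Real.cos (θ x)| ≤ C :=
    ⟨by fun_prop, 1, fun x => Real.abs_cos_le_one _⟩
  have step : ∀ {k : ℕ}, Sobolev k g → BddSobolev k (fun x => Real.sin (θ x)) →
      BddSobolev k (fun x => Real.cos (θ x)) → BddSobolev (k + 1) (fun x => Real.sin (θ x)) ∧
        BddSobolev (k + 1) (fun x => Real.cos (θ x)) := by
    intro k hg hs hcs
    refine ⟨⟨bs, _, hP.sin, hcs.mul hg⟩, ⟨bc, _, hP.cos, ?_⟩⟩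
    refine ((hs.mul hg).const_mul (-1)).congr (Eventually.of_forall fun x => ?_)
    ring
  intro k
  induction k with
  | zero => exact fun hg => step hg bs bc
  | succ k ih => exact fun hg => step hg (ih hg.of_succ).1 (ih hg.of_succ).2

/-- Elliptic regularity for the weak Euler–Lagrange equation. -/
theorem IsWall.sobolev_of_isWeakDeriv (hw : IsWall h θ g)
    (hv : HalfLap (fun x => Real.sin (θ x) - h) v)
    (hEL : IsWeakDeriv g (fun x => Real.cos (θ x) * (Real.sin (θ x) - h + ν / 2 * v x))) (k : ℕ) :
    Sobolev k g := by
  induction k with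
  | zero => exact hw.memLp_deriv
  | succ k ih =>
    have hcos := (hw.prim.bddSobolev_sin_cos ih).2.of_succ
    -- The sine is one derivative smoother than `g`, and the half-Laplacian takes back exactly one.
    -- The right side of the equation is therefore as smooth as `g`, so `g` gains a derivative.
    have hu : Sobolev (k + 1) (fun x => Real.sin (θ x) - h) :=
      ⟨hw.memLp_sin, _, hw.prim_sin.isWeakDeriv, hcos.mul ih⟩
    exact ⟨hw.memLp_deriv, _, hEL, hcos.mul (hu.of_succ.add ((hu.halfLap hv).const_mul _))⟩

theorem IsWall.isMonotoneProfile (hw : IsWall h θ g) (hanti : Antitone θ)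
    (ht : Tendsto θ atTop (𝓝 (Real.arcsin h)))
    (hb : Tendsto θ atBot (𝓝 (Real.pi - Real.arcsin h)))
    (hv : HalfLap (fun x => Real.sin (θ x) - h) v)
    (hEL : IsWeakDeriv g (fun x => Real.cos (θ x) * (Real.sin (θ x) - h + ν / 2 * v x))) :
    IsMonotoneProfile ν h θ := by
  have hsm : ContDiff ℝ (⊤ : ℕ∞) θ := by
    refine contDiff_infty.mpr fun n => ?_
    obtain ⟨G, hG, hGn⟩ := (hw.sobolev_of_isWeakDeriv hv hEL (n + 1)).exists_contDiff
    exact ((hw.prim.congr_deriv hG).contDiff_succ hGn).of_le (by norm_cast; omega)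
  refine ⟨hsm, hanti, ?_, ht, hb, ⟨g, hw.prim.isWeakDeriv, hw.memLp_deriv⟩, hw.memLp_sin,
    v, hv.isHalfLaplacian⟩
  have h2 : ContDiff ℝ (⊤ : ℕ∞) (deriv θ) := (contDiff_infty_iff_deriv.mp hsm).2
  have e1 : g =ᵐ[volume] deriv θ := by
    filter_upwards [hw.prim.ae_hasDerivAt] with x hx using hx.deriv.symm
  have e2 := (hEL.congr e1 EventuallyEq.rfl).ae_unique (IsPrimitive.of_hasDerivAt
    (fun x => (h2.differentiable (by simp) x).hasDerivAt)
    (h2.continuous_deriv (by simp))).isWeakDeriv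
  have e3 := hv.halfLaplacian_ae_eq
  rw [halfLaplacian_sub_const] at e3
  filter_upwards [e2, e3] with x a b
  rw [← a, b]
  ring

end NeelWall

/-! ### Pointwise form of the equation. -/

namespace NeelWall

open scoped ENNReal

variable {ν h : ℝ} {θ φ v : ℝ → ℝ}

/-- The pointwise consequences of the profile equation, in terms of a bounded continuous
representative `v` of `(-d²/dx²)^{1/2} sin θ`. -/
structure IsClassicalWall (ν h : ℝ) (θ v : ℝ → ℝ) : Prop where
  wall : IsWall h θ (deriv θ)
  smooth : ContDiff ℝ (⊤ : ℕ∞) θ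
  continuous : Continuous v
  bounded : ∃ C, ∀ x, |v x| ≤ C
  halfLap : HalfLap (fun x => Real.sin (θ x) - h) v
  eq : ∀ x, deriv (deriv θ) x = Real.cos (θ x) * (Real.sin (θ x) - h + ν / 2 * v x)
  tendsto_top : Tendsto (deriv θ) atTop (𝓝 0)
  tendsto_bot : Tendsto (deriv θ) atBot (𝓝 0)

/-- Regularity puts the half-Laplacian of the sine in H¹, hence gives it a bounded continuous
representative; the almost everywhere equation then has continuous sides and holds everywhere. -/
theorem IsMonotoneProfile.exists_isClassicalWall (hp : IsMonotoneProfile ν h θ) :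
    ∃ v, IsClassicalWall ν h θ v := by
  have hsm : ContDiff ℝ (⊤ : ℕ∞) θ := hp.smooth
  have hsm' : ContDiff ℝ (⊤ : ℕ∞) (deriv θ) := (contDiff_infty_iff_deriv.mp hsm).2
  have hcθ := hsm.continuous
  have hP : IsPrimitive θ (deriv θ) :=
    IsPrimitive.of_hasDerivAt (fun x => (hsm.differentiable (by simp) x).hasDerivAt) hsm'.continuous
  have hc2 : Continuous (deriv (deriv θ)) := hsm'.continuous_deriv (by simp)
  have hP' : IsPrimitive (deriv θ) (deriv (deriv θ)) :=
    IsPrimitive.of_hasDerivAt (fun x => (hsm'.differentiable (by simp) x).hasDerivAt) hc2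
  obtain ⟨⟨g, hg, hg2⟩, hsin, v, hv⟩ := hp.finite_energy
  have hw : IsWall h θ (deriv θ) :=
    ⟨hP, (memLp_congr_ae (hg.ae_unique hP.isWeakDeriv)).mp hg2, hsin⟩
  have hv := hv.halfLap hsin
  have hae : deriv (deriv θ) =ᵐ[volume]
      fun x => Real.cos (θ x) * (Real.sin (θ x) - h + ν / 2 * v x) := by
    have e3 := hv.halfLaplacian_ae_eq
    rw [halfLaplacian_sub_const] at e3
    filter_upwards [hp.solves, e3] with x a b
    rw [b] at a
    linarith
  have hEL := hP'.isWeakDeriv.congr EventuallyEq.rfl hae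
  have hS := hw.sobolev_of_isWeakDeriv hv hEL
  have hcos := (hP.bddSobolev_sin_cos (hS 1)).2.of_succ
  have hu : Sobolev 2 (fun x => Real.sin (θ x) - h) :=
    ⟨hsin, _, hw.prim_sin.isWeakDeriv, hcos.mul (hS 1)⟩
  obtain ⟨V, V', hV, hPV, hV2, hV'⟩ := (hu.halfLap hv).exists_primitive
  have hlim := hP'.tendsto_zero_of_memLp hw.memLp_deriv
    ((memLp_congr_ae hae).mpr (by obtain ⟨-, g, hg, hg'⟩ := hS 1;
                                  exact (memLp_congr_ae (hEL.ae_unique hg)).mpr hg'))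
  have hcV := hPV.continuous
  refine ⟨V, hw, hsm, hcV, hPV.exists_abs_le hV2 hV', ⟨hsin, hV2, ?_⟩, ?_, hlim.1, hlim.2⟩
  · rw [← ft_congr hV]; exact hv.2.2
  · have : deriv (deriv θ) =ᵐ[volume]
        fun x => Real.cos (θ x) * (Real.sin (θ x) - h + ν / 2 * V x) := by
      filter_upwards [hae, hV] with x a b
      rw [a, b]
    exact congrFun ((Continuous.ae_eq_iff_eq volume hc2 (by fun_prop)).mp this)

namespace IsClassicalWall

theorem hasDerivAt (hc : IsClassicalWall ν h θ v) (x : ℝ) : HasDerivAt θ (deriv θ x) x :=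
  (hc.smooth.differentiable (by simp) x).hasDerivAt

theorem contDiff_deriv (hc : IsClassicalWall ν h θ v) : ContDiff ℝ (⊤ : ℕ∞) (deriv θ) :=
  (contDiff_infty_iff_deriv.mp hc.smooth).2

theorem hasDerivAt_deriv (hc : IsClassicalWall ν h θ v) (x : ℝ) :
    HasDerivAt (deriv θ) (Real.cos (θ x) * (Real.sin (θ x) - h + ν / 2 * v x)) x := by
  rw [← hc.eq]
  exact (hc.contDiff_deriv.differentiable (by simp) x).hasDerivAt

theorem isMonotoneProfile_comp_add (hc : IsClassicalWall ν h θ v) (hp : IsMonotoneProfile ν h θ)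
    (a : ℝ) : IsMonotoneProfile ν h (fun x => θ (x + a)) := by
  have hcθ := hc.smooth.continuous
  have hcv := hc.continuous
  have hw : IsWall h (fun x => θ (x + a)) (fun x => deriv θ (x + a)) :=
    ⟨hc.wall.prim.comp_add a, memLp_comp_add hc.wall.memLp_deriv a,
      memLp_comp_add hc.wall.memLp_sin a⟩
  exact hw.isMonotoneProfile (fun x y hxy => hp.antitone (by linarith))
    (hp.tendsto_top.comp (tendsto_atTop_add_const_right _ a tendsto_id))
    (hp.tendsto_bot.comp (tendsto_atBot_add_const_right _ a tendsto_id)) (hc.halfLap.comp_add a)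
    ((IsPrimitive.of_hasDerivAt hc.hasDerivAt_deriv (by fun_prop)).comp_add a).isWeakDeriv

/-- A wall touching `π/2` with zero slope is constant. -/
theorem eq_pi_div_two (hc : IsClassicalWall ν h θ v) {a : ℝ} (h1 : θ a = Real.pi / 2)
    (h2 : deriv θ a = 0) (x : ℝ) : θ x = Real.pi / 2 := by
  obtain ⟨C, hC⟩ := hc.bounded
  set G : ℝ → ℝ := fun t => Real.sin (θ t) - h + ν / 2 * v t
  have hG : ∀ t, |G t| ≤ 1 + |h| + |ν / 2| * C := by
    intro t
    refine (abs_add_le _ _).trans (add_le_add ((abs_sub _ _).trans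
      (add_le_add_left (Real.abs_sin_le_one _) _)) ?_)
    rw [abs_mul]
    exact mul_le_mul_of_nonneg_left (hC t) (abs_nonneg _)
  -- The nonlocal term is frozen as a given bounded function of t, which leaves an ordinary
  -- differential equation Lipschitz in (θ, θ'). The constant pair (π/2, 0) solves it because
  -- cos(π/2) = 0.
  set K : NNReal := max 1 (1 + |h| + |ν / 2| * C).toNNReal
  have hlip : ∀ t, LipschitzOnWith K (fun z : ℝ × ℝ => (z.2, Real.cos z.1 * G t)) Set.univ := by
    intro t
    refine LipschitzOnWith.of_dist_le_mul fun z _ y _ => ?_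
    have hK1 : (1 : ℝ) ≤ K := by exact_mod_cast le_max_left (1 : NNReal) _
    have hK2 : 1 + |h| + |ν / 2| * C ≤ K :=
      (Real.le_coe_toNNReal _).trans (by exact_mod_cast le_max_right (1 : NNReal) _)
    rw [Prod.dist_eq]
    refine max_le ?_ ?_
    · exact (le_mul_of_one_le_left dist_nonneg hK1).trans
        (mul_le_mul_of_nonneg_left (le_max_right _ _) K.2)
    · have e : dist (Real.cos z.1 * G t) (Real.cos y.1 * G t) =
          |G t| * dist (Real.cos z.1) (Real.cos y.1) := by
        rw [Real.dist_eq, Real.dist_eq, ← sub_mul, abs_mul, mul_comm]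
      have e2 := lipschitzWith_cos.dist_le_mul z.1 y.1
      rw [NNReal.coe_one, one_mul] at e2
      rw [e]
      exact mul_le_mul ((hG t).trans hK2) (e2.trans (le_max_left _ _)) dist_nonneg K.2
  have := ODE_solution_unique_univ (f := fun t => (θ t, deriv θ t))
    (g := fun _ => (Real.pi / 2, (0 : ℝ))) (t₀ := a) hlip
    (fun t => ⟨(hc.hasDerivAt t).prodMk (hc.hasDerivAt_deriv t), Set.mem_univ _⟩)
    (fun t => ⟨(hasDerivAt_const t _).congr_deriv (by ext <;> simp), Set.mem_univ _⟩)
    (by simp [h1, h2])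
  exact congrArg Prod.fst (congrFun this x)

end IsClassicalWall

end NeelWall

/-! ### Uniqueness of profiles and minimality. -/

namespace NeelWall

open scoped ENNReal

variable {ν h : ℝ} {θ φ v z : ℝ → ℝ}

theorem IsMonotoneProfile.mem_Icc (hp : IsMonotoneProfile ν h θ) (x : ℝ) :
    θ x ∈ Set.Icc (Real.arcsin h) (Real.pi - Real.arcsin h) :=
  ⟨hp.antitone.le_of_tendsto hp.tendsto_top x, hp.antitone.ge_of_tendsto hp.tendsto_bot x⟩

/-- Geometry of a profile centered at the origin. -/
structure IsCentered (ν h : ℝ) (θ v : ℝ → ℝ) : Prop where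
  profile : IsMonotoneProfile ν h θ
  classical : IsClassicalWall ν h θ v
  zero : θ 0 = Real.pi / 2

/-- If `B' ≥ F` off the origin and `B` vanishes at infinity, then `F` has nonpositive integral. -/
theorem integral_nonpos_of_hasDerivAt {F B : ℝ → ℝ} (cF : Continuous F) (iF : Integrable F)
    (cB : Continuous B) (hBd : ∀ x, x ≠ 0 → ∃ N, 0 ≤ N ∧ HasDerivAt B (F x + N) x)
    (hBt : Tendsto B atTop (𝓝 0)) (hBb : Tendsto B atBot (𝓝 0)) : ∫ x, F x ≤ 0 := by
  set I : ℝ → ℝ := fun x => ∫ t in (0 : ℝ)..x, F t with hI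
  have hId : ∀ x, HasDerivAt I (F x) x := fun x =>
    intervalIntegral.integral_hasDerivAt_right (cF.intervalIntegrable 0 x)
      (cF.stronglyMeasurableAtFilter _ _) cF.continuousAt
  have cI : Continuous I := continuous_iff_continuousAt.mpr fun x => (hId x).continuousAt
  have hdiff : ∀ x, x ≠ 0 → ∃ N, 0 ≤ N ∧ HasDerivAt (fun x => B x - I x) N x := by
    intro x hx
    obtain ⟨N, hN, hBN⟩ := hBd x hx
    exact ⟨N, hN, (hBN.sub (hId x)).congr_deriv (by ring)⟩
  -- The derivative is nonnegative on each open half-line, and continuity at the origin glues the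
  -- two. Hence ∫F over (-R, R) is at most B(R) - B(-R), which tends to 0.
  have hmono : Monotone fun x => B x - I x := by
    refine MonotoneOn.Iic_union_Ici (a := 0) ?_ ?_
    · refine monotoneOn_of_deriv_nonneg (convex_Iic 0) (by fun_prop) ?_ ?_ <;>
      · intro x hx
        rw [interior_Iic, Set.mem_Iio] at hx
        obtain ⟨N, hN, hd⟩ := hdiff x hx.ne
        first | exact hd.differentiableAt.differentiableWithinAt | exact hd.deriv ▸ hN
    · refine monotoneOn_of_deriv_nonneg (convex_Ici 0) (by fun_prop) ?_ ?_ <;>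
      · intro x hx
        rw [interior_Ici, Set.mem_Ioi] at hx
        obtain ⟨N, hN, hd⟩ := hdiff x hx.ne'
        first | exact hd.differentiableAt.differentiableWithinAt | exact hd.deriv ▸ hN
  have t1 := intervalIntegral_tendsto_integral iF (tendsto_neg_atTop_atBot) tendsto_id
  have t2 := hBt.sub (hBb.comp tendsto_neg_atTop_atBot)
  rw [sub_zero] at t2
  refine le_of_tendsto_of_tendsto t1 t2 ?_
  filter_upwards [eventually_ge_atTop 0] with R hR
  have := hmono (show -R ≤ R by linarith)
  have e : I R - I (-R) = ∫ t in (-R)..R, F t :=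
    intervalIntegral.integral_interval_sub_left (cF.intervalIntegrable _ _)
      (cF.intervalIntegrable _ _)
  simp only [id, Function.comp] at this ⊢
  linarith

namespace IsCentered

theorem deriv_ne_zero (hc : IsCentered ν h θ v) (h1 : h < 1) {x : ℝ} (hx : θ x = Real.pi / 2) :
    deriv θ x ≠ 0 := by
  intro hd
  have h2 := hc.classical.eq_pi_div_two hx hd
  have h3 := hc.profile.tendsto_top
  rw [funext h2] at h3
  have h4 := tendsto_nhds_unique h3 tendsto_const_nhds
  exact (Real.arcsin_lt_pi_div_two.mpr h1).ne h4

/-- If π/2 were attained again, monotonicity would make the profile constant in between,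
contradicting the nonzero slope at 0. So the cosine vanishes only at the origin. -/
theorem lt_of_pos (hc : IsCentered ν h θ v) (h1 : h < 1) {x : ℝ} (hx : 0 < x) :
    θ x < Real.pi / 2 := by
  refine lt_of_le_of_ne (hc.zero ▸ hc.profile.antitone hx.le) fun he => ?_
  refine hc.deriv_ne_zero h1 hc.zero ?_
  have hd := hc.classical.hasDerivAt 0
  refine (uniqueDiffOn_Icc hx 0 (Set.left_mem_Icc.mpr hx.le)).eq_deriv _ hd.hasDerivWithinAt ?_
  refine (hasDerivWithinAt_const (0 : ℝ) (Set.Icc 0 x) (Real.pi / 2)).congr (fun y hy => ?_) hc.zero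
  have a := hc.profile.antitone hy.1
  have b := hc.profile.antitone hy.2
  rw [hc.zero] at a
  rw [he] at b
  exact le_antisymm a b

theorem lt_of_neg (hc : IsCentered ν h θ v) (h1 : h < 1) {x : ℝ} (hx : x < 0) :
    Real.pi / 2 < θ x := by
  refine lt_of_le_of_ne (hc.zero ▸ hc.profile.antitone hx.le) fun he => ?_
  refine hc.deriv_ne_zero h1 hc.zero ?_
  have hd := hc.classical.hasDerivAt 0
  refine (uniqueDiffOn_Icc hx 0 (Set.right_mem_Icc.mpr hx.le)).eq_deriv _ hd.hasDerivWithinAt ?_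
  refine (hasDerivWithinAt_const (0 : ℝ) (Set.Icc x 0) (Real.pi / 2)).congr (fun y hy => ?_) hc.zero
  have a := hc.profile.antitone hy.1
  have b := hc.profile.antitone hy.2
  rw [hc.zero] at b
  rw [← he] at a
  exact le_antisymm a b

theorem cos_pos (hc : IsCentered ν h θ v) (h0 : 0 ≤ h) (h1 : h < 1) {x : ℝ} (hx : 0 < x) :
    0 < Real.cos (θ x) := by
  have := (hc.profile.mem_Icc x).1
  have := Real.arcsin_nonneg.mpr h0
  exact Real.cos_pos_of_mem_Ioo ⟨by linarith [Real.pi_pos], hc.lt_of_pos h1 hx⟩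

theorem cos_neg (hc : IsCentered ν h θ v) (h0 : 0 ≤ h) (h1 : h < 1) {x : ℝ} (hx : x < 0) :
    Real.cos (θ x) < 0 := by
  have := (hc.profile.mem_Icc x).2
  have := Real.arcsin_nonneg.mpr h0
  exact Real.cos_neg_of_pi_div_two_lt_of_lt (hc.lt_of_neg h1 hx) (by linarith [Real.pi_pos])

theorem deriv_nonpos (hc : IsCentered ν h θ v) (x : ℝ) : deriv θ x ≤ 0 :=
  hc.profile.antitone.deriv_nonpos

/-- The logarithmic slope `θ' / cos θ` times a function vanishing to second order is continuous
at the origin. -/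
theorem tendsto_mul_slope_zero (hc : IsCentered ν h θ v) (h1 : h < 1) {w : ℝ → ℝ}
    (hw : HasDerivAt w 0 0) (hw0 : w 0 = 0) :
    Tendsto (fun x => w x * (deriv θ x / Real.cos (θ x))) (𝓝[≠] 0) (𝓝 0) := by
  have hd := hc.classical.hasDerivAt 0
  have hcos : HasDerivAt (fun x => Real.cos (θ x)) (-deriv θ 0) 0 :=
    hd.cos.congr_deriv (by rw [hc.zero, Real.sin_pi_div_two]; ring)
  have e1 := hasDerivAt_iff_tendsto_slope_zero.mp hcos
  have e2 := hasDerivAt_iff_tendsto_slope_zero.mp hw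
  simp only [zero_add, hw0, hc.zero, Real.cos_pi_div_two, sub_zero, smul_eq_mul] at e1 e2
  have e3 : Tendsto (deriv θ) (𝓝[≠] 0) (𝓝 (deriv θ 0)) :=
    (hc.classical.contDiff_deriv.continuous.tendsto 0).mono_left nhdsWithin_le_nhds
  have e4 := (e2.mul e3).div e1 (neg_ne_zero.mpr (hc.deriv_ne_zero h1 hc.zero))
  rw [zero_mul, zero_div] at e4
  refine e4.congr' ?_
  filter_upwards [self_mem_nhdsWithin] with x hx
  have hx : x ≠ 0 := hx
  simp only [Pi.div_apply]
  rw [mul_assoc, mul_div_mul_left _ _ (inv_ne_zero hx), mul_div_assoc]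

theorem tendsto_mul_slope_top (hc : IsCentered ν h θ v) (h0 : 0 ≤ h) (h1 : h < 1) {w : ℝ → ℝ}
    (hw : Tendsto w atTop (𝓝 0)) :
    Tendsto (fun x => w x * (deriv θ x / Real.cos (θ x))) atTop (𝓝 0) := by
  have h2 : 0 < Real.cos (Real.arcsin h) := Real.cos_pos_of_mem_Ioo
    ⟨Real.neg_pi_div_two_lt_arcsin.mpr (by linarith), Real.arcsin_lt_pi_div_two.mpr h1⟩
  have := hw.mul (hc.classical.tendsto_top.div
    ((Real.continuous_cos.tendsto _).comp hc.profile.tendsto_top) h2.ne')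
  simpa using this

theorem tendsto_mul_slope_bot (hc : IsCentered ν h θ v) (h0 : 0 ≤ h) (h1 : h < 1) {w : ℝ → ℝ}
    (hw : Tendsto w atBot (𝓝 0)) :
    Tendsto (fun x => w x * (deriv θ x / Real.cos (θ x))) atBot (𝓝 0) := by
  have h2 : 0 < Real.cos (Real.arcsin h) := Real.cos_pos_of_mem_Ioo
    ⟨Real.neg_pi_div_two_lt_arcsin.mpr (by linarith), Real.arcsin_lt_pi_div_two.mpr h1⟩
  have := hw.mul (hc.classical.tendsto_bot.div
    ((Real.continuous_cos.tendsto _).comp hc.profile.tendsto_bot)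
    (by rw [Real.cos_pi_sub]; exact neg_ne_zero.mpr h2.ne'))
  simpa using this

/-- With u = sin θ, the quotient is u' / (1 - u²), the momentum of the density u'² / (2(1 - u²));
the identity is the Euler–Lagrange equation in the variable u, where the common factor cos θ has
disappeared. -/
theorem hasDerivAt_slope (hc : IsCentered ν h θ v) {x : ℝ} (hx : Real.cos (θ x) ≠ 0) :
    HasDerivAt (fun x => deriv θ x / Real.cos (θ x)) (Real.sin (θ x) - h + ν / 2 * v x +
      (deriv θ x / Real.cos (θ x)) ^ 2 * Real.sin (θ x)) x := by
  refine ((hc.classical.hasDerivAt_deriv x).div (hc.classical.hasDerivAt x).cos hx).congr_deriv ?_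
  field_simp
  ring

theorem eq_of_sin_eq (hc : IsCentered ν h θ v) (hd : IsCentered ν h φ z) (h0 : 0 ≤ h)
    (he : ∀ x, Real.sin (θ x) = Real.sin (φ x)) : θ = φ := by
  have ha := Real.arcsin_nonneg.mpr h0
  have hpi := Real.pi_pos
  funext x
  have t := hc.profile.mem_Icc x
  have f := hd.profile.mem_Icc x
  rcases le_total 0 x with hx | hx
  · have a := hc.profile.antitone hx
    have b := hd.profile.antitone hx
    rw [hc.zero] at a
    rw [hd.zero] at b
    exact Real.injOn_sin ⟨by linarith [t.1], a⟩ ⟨by linarith [f.1], b⟩ (he x)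
  · have a := hc.profile.antitone hx
    have b := hd.profile.antitone hx
    rw [hc.zero] at a
    rw [hd.zero] at b
    have := Real.injOn_sin (x₁ := Real.pi - θ x) (x₂ := Real.pi - φ x)
      ⟨by linarith [t.2], by linarith⟩ ⟨by linarith [f.2], by linarith⟩
      (by rw [Real.sin_pi_sub, Real.sin_pi_sub]; exact he x)
    linarith

/-- Two profiles centered at the origin coincide. -/
theorem unique (hν : 0 < ν) (h0 : 0 ≤ h) (h1 : h < 1) (hc : IsCentered ν h θ v)
    (hd : IsCentered ν h φ z) : θ = φ := by
  set w : ℝ → ℝ := fun x => Real.sin (φ x) - Real.sin (θ x) with hwdef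
  set F : ℝ → ℝ := fun x => ((Real.sin (φ x) - h + ν / 2 * z x) -
    (Real.sin (θ x) - h + ν / 2 * v x)) * w x with hF
  set B : ℝ → ℝ := fun x => w x * (deriv φ x / Real.cos (φ x)) -
    w x * (deriv θ x / Real.cos (θ x)) with hB
  have cθ := hc.classical.smooth.continuous
  have cφ := hd.classical.smooth.continuous
  have cv := hc.classical.continuous
  have cz := hd.classical.continuous
  have cF : Continuous F := by fun_prop
  have hwd : ∀ x, HasDerivAt w (Real.cos (φ x) * deriv φ x - Real.cos (θ x) * deriv θ x) x :=
    fun x => (hd.classical.hasDerivAt x).sin.sub (hc.classical.hasDerivAt x).sin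
  have hw0 : w 0 = 0 := by simp [w, hc.zero, hd.zero]
  have hwd0 : HasDerivAt w 0 0 := (hwd 0).congr_deriv (by simp [hc.zero, hd.zero])
  have hLap : HalfLap w (fun x => z x - v x) :=
    (hd.classical.halfLap.sub hc.classical.halfLap).congr_left
      (Eventually.of_forall fun x => by simp [w])
  have hwt : Tendsto w atTop (𝓝 0) := by
    have := ((Real.continuous_sin.tendsto _).comp hd.profile.tendsto_top).sub
      ((Real.continuous_sin.tendsto _).comp hc.profile.tendsto_top)
    simpa using this
  have hwb : Tendsto w atBot (𝓝 0) := by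
    have := ((Real.continuous_sin.tendsto _).comp hd.profile.tendsto_bot).sub
      ((Real.continuous_sin.tendsto _).comp hc.profile.tendsto_bot)
    simpa using this
  have cos_ne : ∀ x, x ≠ 0 → Real.cos (θ x) ≠ 0 ∧ Real.cos (φ x) ≠ 0 := by
    intro x hx
    rcases lt_or_gt_of_ne hx with hx | hx
    · exact ⟨(hc.cos_neg h0 h1 hx).ne, (hd.cos_neg h0 h1 hx).ne⟩
    · exact ⟨(hc.cos_pos h0 h1 hx).ne', (hd.cos_pos h0 h1 hx).ne'⟩
  have slope_mul_nonneg : ∀ x, x ≠ 0 →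
      0 ≤ deriv φ x / Real.cos (φ x) * (deriv θ x / Real.cos (θ x)) := by
    intro x hx
    rcases lt_or_gt_of_ne hx with hx | hx
    · exact mul_nonneg (div_nonneg_of_nonpos (hd.deriv_nonpos x) (hd.cos_neg h0 h1 hx).le)
        (div_nonneg_of_nonpos (hc.deriv_nonpos x) (hc.cos_neg h0 h1 hx).le)
    · exact mul_nonneg_of_nonpos_of_nonpos
        (div_nonpos_of_nonpos_of_nonneg (hd.deriv_nonpos x) (hd.cos_pos h0 h1 hx).le)
        (div_nonpos_of_nonpos_of_nonneg (hc.deriv_nonpos x) (hc.cos_pos h0 h1 hx).le)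
  have hBd : ∀ x, x ≠ 0 → ∃ N, 0 ≤ N ∧ HasDerivAt B (F x + N) x := by
    intro x hx
    obtain ⟨n1, n2⟩ := cos_ne x hx
    set p := deriv φ x / Real.cos (φ x) with hp
    set q := deriv θ x / Real.cos (θ x) with hq
    -- Substitute w' = p cos² φ - q cos² θ and the slope equations, then collect terms. The product
    -- pq is nonnegative because both profiles decrease and their cosines have the same sign on each
    -- side.
    refine ⟨(1 - Real.sin (φ x) * Real.sin (θ x)) * (p - q) ^ 2 + p * q * w x ^ 2, ?_, ?_⟩
    · have : Real.sin (φ x) * Real.sin (θ x) ≤ 1 := by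
        nlinarith [sq_nonneg (Real.sin (φ x) - Real.sin (θ x)), Real.sin_sq_le_one (φ x),
          Real.sin_sq_le_one (θ x)]
      have := slope_mul_nonneg x hx
      have : 0 ≤ (1 - Real.sin (φ x) * Real.sin (θ x)) * (p - q) ^ 2 :=
        mul_nonneg (by linarith) (sq_nonneg _)
      positivity
    · refine (((hwd x).mul (hd.hasDerivAt_slope n2)).sub
        ((hwd x).mul (hc.hasDerivAt_slope n1))).congr_deriv ?_
      have e1 : deriv φ x = p * Real.cos (φ x) := by rw [hp]; field_simp
      have e2 : deriv θ x = q * Real.cos (θ x) := by rw [hq]; field_simp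
      have c1 := Real.cos_sq' (φ x)
      have c2 := Real.cos_sq' (θ x)
      rw [← hp, ← hq, e1, e2]
      simp only [hF, hwdef]
      linear_combination (p * (p - q)) * c1 - (q * (p - q)) * c2
  -- At the origin the cosines vanish to first order only, while w vanishes together with its
  -- derivative, so the singularity of the slopes is removed.
  have cB : Continuous B := by
    rw [continuous_iff_continuousAt]
    intro x
    rcases eq_or_ne x 0 with rfl | hx
    · rw [continuousAt_iff_punctured_nhds]
      have := (hd.tendsto_mul_slope_zero h1 hwd0 hw0).sub (hc.tendsto_mul_slope_zero h1 hwd0 hw0)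
      simpa [hB, hw0] using this
    · obtain ⟨N, -, hN⟩ := hBd x hx
      exact hN.continuousAt
  have hBt : Tendsto B atTop (𝓝 0) := by
    simpa using (hd.tendsto_mul_slope_top h0 h1 hwt).sub (hc.tendsto_mul_slope_top h0 h1 hwt)
  have hBb : Tendsto B atBot (𝓝 0) := by
    simpa using (hd.tendsto_mul_slope_bot h0 h1 hwb).sub (hc.tendsto_mul_slope_bot h0 h1 hwb)
  have i1 : Integrable fun x => w x ^ 2 := hLap.1.integrable_sq
  have i2 : Integrable fun x => w x * (z x - v x) := integrable_mul_of_memLp hLap.1 hLap.2.1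
  have hFe : F = fun x => w x ^ 2 + ν / 2 * (w x * (z x - v x)) := by
    funext x
    simp only [hF, hwdef]
    ring
  have iF : Integrable F := by
    rw [hFe]
    exact integrable_fun_add i1 (i2.const_mul _)
  have hle := integral_nonpos_of_hasDerivAt cF iF cB hBd hBt hBb
  -- The integral of F is that of w² plus ν/2 times the nonnegative half-Laplacian form of w, yet it
  -- is nonpositive.
  have hsq : ∫ x, w x ^ 2 = 0 := by
    refine le_antisymm ?_ (integral_nonneg fun x => sq_nonneg _)
    have e := hLap.integral_mul_nonneg
    rw [hFe, integral_add i1 (i2.const_mul _), integral_const_mul] at hle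
    have : 0 ≤ ν / 2 * ∫ x, w x * (z x - v x) := mul_nonneg (half_pos hν).le e
    linarith
  have hw : w = 0 := by
    rw [integral_eq_zero_iff_of_nonneg (fun x => sq_nonneg _) i1] at hsq
    have hcw : Continuous w := by fun_prop
    refine (Continuous.ae_eq_iff_eq volume hcw continuous_const).mp ?_
    filter_upwards [hsq] with x hx
    exact pow_eq_zero_iff two_ne_zero |>.mp hx
  refine hc.eq_of_sin_eq hd h0 fun x => ?_
  have := congrFun hw x
  simp only [hwdef, Pi.zero_apply] at this
  linarith

end IsCentered

/-- Profiles are unique up to translation. -/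
theorem IsMonotoneProfile.exists_translate (hν : 0 < ν) (h0 : 0 ≤ h) (h1 : h < 1)
    (hθ : IsMonotoneProfile ν h θ) (hφ : IsMonotoneProfile ν h φ) :
    ∃ a, ∀ x, φ x = θ (x + a) := by
  have center : ∀ {θ : ℝ → ℝ}, IsMonotoneProfile ν h θ → ∃ b v,
      IsCentered ν h (fun x => θ (x + b)) v := by
    intro θ hθ
    obtain ⟨b, hb⟩ := exists_eq_pi_div_two h1 hθ.smooth.continuous hθ.tendsto_top hθ.tendsto_bot
    obtain ⟨v, hv⟩ := hθ.exists_isClassicalWall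
    have hp := hv.isMonotoneProfile_comp_add hθ b
    obtain ⟨z, hz⟩ := hp.exists_isClassicalWall
    exact ⟨b, z, hp, hz, by simpa using hb⟩
  obtain ⟨b, v, hv⟩ := center hθ
  obtain ⟨c, z, hz⟩ := center hφ
  have := hv.unique hν h0 h1 hz
  refine ⟨b - c, fun x => ?_⟩
  have e := congrFun this (x - c)
  simp only [sub_add_cancel] at e
  rw [← e]
  congr 1; ring

theorem exists_minimizing_profile (hν : 0 < ν) (h0 : 0 ≤ h) (h1 : h < 1) :
    ∃ θ, IsMonotoneProfile ν h θ ∧ ∀ φ, Admissible h φ → energy ν h θ ≤ energy ν h φ := by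
  obtain ⟨θ, g, hw, hanti, ht, hb, hmin⟩ := exists_minimizing_wall hν h0 h1
  obtain ⟨v, hv⟩ := hw.exists_halfLap
  exact ⟨θ, hw.isMonotoneProfile hanti ht hb hv
    (hw.isWeakDeriv_of_minimal hν h0 h1 ht hb hmin hv), hmin⟩

/-- One profile minimizes by construction; any other is a translate of it, and the energy is
translation invariant. -/
theorem IsMonotoneProfile.isEnergyMinimizer (hν : 0 < ν) (h0 : 0 ≤ h) (h1 : h < 1)
    (hθ : IsMonotoneProfile ν h θ) : IsEnergyMinimizer ν h θ := by
  obtain ⟨φ, hφ, hmin⟩ := exists_minimizing_profile hν h0 h1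
  obtain ⟨v, hv⟩ := hθ.exists_isClassicalWall
  obtain ⟨z, hz⟩ := hφ.exists_isClassicalWall
  obtain ⟨a, ha⟩ := hφ.exists_translate hν h0 h1 hθ
  have hθφ : θ = fun x => φ (x + a) := funext ha
  refine ⟨hv.wall.admissible h0 h1 hθ.tendsto_top hθ.tendsto_bot, fun χ hχ => ?_⟩
  refine le_trans (le_of_eq ?_) (hmin χ hχ)
  have hw : IsWall h (fun x => φ (x + a)) (fun x => deriv φ (x + a)) :=
    ⟨hz.wall.prim.comp_add a, memLp_comp_add hz.wall.memLp_deriv a,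
      memLp_comp_add hz.wall.memLp_sin a⟩
  rw [hθφ, hw.energy_eq EventuallyEq.rfl (hz.halfLap.comp_add a),
    hz.wall.energy_eq EventuallyEq.rfl hz.halfLap,
    integral_add_right_eq_self (fun x => deriv φ x ^ 2),
    integral_add_right_eq_self (fun x => (Real.sin (φ x) - h) ^ 2),
    integral_add_right_eq_self (fun x => (Real.sin (φ x) - h) * z x)]

end NeelWall

theorem theorem2 (ν h : ℝ) (hν : 0 < ν) (h_nonneg : 0 ≤ h) (h_lt_one : h < 1) :
    (∃ θ : ℝ → ℝ, NeelWall.IsMonotoneProfile ν h θ) ∧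
    (∀ θ₁ θ₂ : ℝ → ℝ, NeelWall.IsMonotoneProfile ν h θ₁ → NeelWall.IsMonotoneProfile ν h θ₂ →
      ∃ a : ℝ, ∀ x : ℝ, θ₂ x = θ₁ (x + a)) ∧
    (∀ θ : ℝ → ℝ, NeelWall.IsMonotoneProfile ν h θ → NeelWall.IsEnergyMinimizer ν h θ) := by
  refine ⟨?_, fun θ₁ θ₂ h₁ h₂ => h₁.exists_translate hν h_nonneg h_lt_one h₂,
    fun θ hθ => hθ.isEnergyMinimizer hν h_nonneg h_lt_one⟩
  obtain ⟨θ, hθ, -⟩ := NeelWall.exists_minimizing_profile hν h_nonneg h_lt_one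
  exact ⟨θ, hθ⟩
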